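/- Let $G=\{G(x),x\in\mathbb R\}$ be a mean zero Gaussian process with stationary increments (jointly measurable in $x$ and $\omega$), and let $\sigma^2$ be its increment variance function, i.e. $E(G(x)-G(y))^2=\sigma^2(x-y)=\sigma^2(|x-y|)$ for all $x,y\in\mathbb R$; assume $\sigma^2\not\equiv 0$, and set $\sigma(h)=\sqrt{\sigma^2(h)}$. Let $-\infty<a<b<\infty$, let $\eta$ be a standard normal random variable, and let $d\mu(x)=(2\pi)^{-1/2}e^{-x^2/2}\,dx$. For a symmetric (i.e. even) function $f\in L^2(\mathbb R,d\mu)$ and $h>0$ put $$I_G(f,h;a,b)=\int_a^b f\left(\frac{G(x+h)-G(x)}{\sigma(h)}\right)dx .$$ Assume that either $\sigma^2$ is concave on $[0,\infty)$, or there is $r$ with $1<r\le 3/2$ such that $\sigma^2(h)=h^r$ for all $h\ge 0$. Then for every symmetric $f\in L^2(\mathbb R,d\mu)$ that is not almost everywhere equal to a constant, $$\frac{I_G(f,h;a,b)-(b-a)\,E f(\eta)}{\sqrt{\operatorname{Var} I_G(f,h;a,b)}}\longrightarrow N(0,1)\quad\text{in law, as } h\downarrow 0 .$$ -/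

import Mathlib

open MeasureTheory ProbabilityTheory Filter Topology

/-- The functional `I_G(f, h; a, b) = ∫_a^b f ((G(x + h) - G(x)) / σ(h)) dx`, a random variable on
`Ω`, where `σ(h) = √(σ²(h))` and `sigmaSq` is the increment variance function `σ²` of `G`. -/
noncomputable def incrementFunctional {Ω : Type*} (G : ℝ → Ω → ℝ) (sigmaSq : ℝ → ℝ) (f : ℝ → ℝ)
    (a b h : ℝ) (ω : Ω) : ℝ :=
  ∫ x in a..b, f ((G (x + h) ω - G x ω) / √(sigmaSq h))

/-! For fixed h the standardized increments form a stationary Gaussian field Y with standard normal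
marginals and correlation ρ(s) = (σ²(s+h) + σ²(s-h) - 2σ²(s)) / (2σ²(h)) (`incrementCorr`). Let f
have Hermite coefficients c_k. Since f is even and not constant, its Hermite rank K (the least k ≥ 1
with c_k ≠ 0) exists and is even (`exists_hermiteRank`). Everything is measured against τ =
∬|ρ(x-y)|^K over [a,b]².

Truncation. The Hermite remainder of order N ≥ K contributes to the second moment at most its L²(γ)
norm squared times τ (`integral_sq_hermiteRemainder_le`). The polynomial part has variance V at
least c_K² K! τ: each chaos contributes a nonnegative amount, and K is even, so ρ^K = |ρ|^K
(`le_integral_sq_hermiteShiftSum`). Dropping the remainder is therefore harmless uniformly in h.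

Polynomial part. Write g = Xp - p' and F = ∫ g(Y). Gaussian integration by parts gives E[F e^{itF}]
= it E[Γ e^{itF}], where Γ = ∬ ρ p(Y_x) g'(Y_y) has mean V. Solving this differential equation for
the characteristic function gives |E e^{itF} - e^{-Vt²/2}| ≤ t² √Var Γ
(`norm_integral_cexp_sub_le`).

Variance of Γ. Moments of Hermite polynomials are sums over multigraphs. In Var Γ the graphs that do
not join the two pairs of points cancel, and the others become connected graphs on four vertices
with all degrees at least K. Such a monomial is at most a sum of spanning tree weights with edge
exponents K, K-1, 1 (`diagramMonomial_le_treeSum`). Integrating the trees leaf by leaf bounds Var Γ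
by a constant times τ · sup∫|ρ| · sup∫|ρ|^{K-1} (`exists_integral_sq_sub_le`). After division by V²
it remains to show the contraction ∫|ρ| · ∫|ρ|^{K-1} = o(τ).

Contraction. If σ² is concave, the integrals of |ρ|^j are controlled by those of the decreasing
first difference of σ² on [0, h/2], and Chebyshev's inequality there gains a factor h
(`ConcaveOn.integral_abs_incrementCorr_mul_le`). If σ²(h) = h^r, scaling reduces to step 1 and a
long interval of length X = L/h, where |ρ| is comparable to u^{r-2}. The gain is 1/log X for K = 2,
where r = 3/2 is critical, and X^{r-2} for K ≥ 4 (`exists_tendsto_integral_mul_integral_le`). Lévy's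
theorem concludes. -/

/-! ### Hermite polynomials. -/

/-- The `n`-th probabilists' Hermite polynomial with real coefficients. -/
noncomputable def realHermite (n : ℕ) : Polynomial ℝ :=
  (Polynomial.hermite n).map (Int.castRingHom ℝ)

namespace realHermite

open Polynomial

@[simp] lemma zero : realHermite 0 = 1 := by simp [realHermite]

lemma succ (n : ℕ) : realHermite (n + 1) = X * realHermite n - derivative (realHermite n) := by
  simp [realHermite, hermite_succ, Polynomial.derivative_map]

lemma derivative_succ (n : ℕ) :
    derivative (realHermite (n + 1)) = ((n : ℝ[X]) + 1) * realHermite n := by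
  induction n with
  | zero => simp [succ 0]
  | succ n ih =>
    have h : X * realHermite n = realHermite (n + 1) + derivative (realHermite n) := by
      rw [succ n]; ring
    rw [succ (n + 1), derivative_sub, derivative_mul, ih, derivative_mul]
    have : derivative ((n : ℝ[X]) + 1) = 0 := by simp
    rw [this, derivative_X]
    push_cast
    linear_combination ((n : ℝ[X]) + 1) * h

lemma derivative_eq (n : ℕ) :
    derivative (realHermite n) = (n : ℝ[X]) * realHermite (n - 1) := by
  cases n with
  | zero => simp
  | succ n => rw [derivative_succ]; simp

lemma monic (n : ℕ) : (realHermite n).Monic := (hermite_monic n).map _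

lemma natDegree_eq (n : ℕ) : (realHermite n).natDegree = n := by
  rw [realHermite, (hermite_monic n).natDegree_map, natDegree_hermite]

lemma eval_neg (n : ℕ) (x : ℝ) :
    (realHermite n).eval (-x) = (-1) ^ n * (realHermite n).eval x := by
  induction n using Nat.strong_induction_on with
  | _ n ih =>
    match n with
    | 0 => simp
    | 1 => simp [succ 0]
    | n + 2 =>
      have h1 := ih (n + 1) (by omega)
      have h0 := ih n (by omega)
      rw [succ (n + 1), derivative_succ]
      simp only [eval_sub, eval_mul, eval_X, eval_add, eval_natCast, eval_one, h1, h0]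
      ring

end realHermite

/-! ### Variables with all moments. -/

/-- Functions with finite moments of all orders. -/
def MemAllLp {Ω : Type*} [MeasurableSpace Ω] (X : Ω → ℝ) (P : Measure Ω) : Prop :=
  ∀ p : ENNReal, p ≠ ⊤ → MemLp X p P

namespace MemAllLp

variable {Ω : Type*} [MeasurableSpace Ω] {P : Measure Ω} {X Y : Ω → ℝ}

lemma const [IsFiniteMeasure P] (c : ℝ) : MemAllLp (fun _ : Ω => c) P := fun _ _ => memLp_const c

lemma add (hX : MemAllLp X P) (hY : MemAllLp Y P) : MemAllLp (fun ω => X ω + Y ω) P :=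
  fun p hp => (hX p hp).add (hY p hp)

lemma sub (hX : MemAllLp X P) (hY : MemAllLp Y P) : MemAllLp (fun ω => X ω - Y ω) P :=
  fun p hp => (hX p hp).sub (hY p hp)

lemma mul (hX : MemAllLp X P) (hY : MemAllLp Y P) : MemAllLp (fun ω => X ω * Y ω) P := by
  intro p hp
  have : ENNReal.HolderTriple (2 * p) (2 * p) p := ⟨by
    rw [ENNReal.mul_inv (by simp) (by simp), ← add_mul, ENNReal.inv_two_add_inv_two, one_mul]⟩
  exact (hY (2 * p) (ENNReal.mul_ne_top (by simp) hp)).mul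
    (hX (2 * p) (ENNReal.mul_ne_top (by simp) hp))

lemma prod [IsFiniteMeasure P] {ι : Type*} (s : Finset ι) {X : ι → Ω → ℝ}
    (h : ∀ i ∈ s, MemAllLp (X i) P) : MemAllLp (fun ω => ∏ i ∈ s, X i ω) P := by
  classical
  induction s using Finset.induction_on with
  | empty => simpa using const 1
  | insert i s hi ih =>
    simp only [Finset.prod_insert hi]
    exact (h i (by simp)).mul (ih fun j hj => h j (by simp [hj]))

lemma polynomial [IsFiniteMeasure P] (hX : MemAllLp X P) (q : Polynomial ℝ) :
    MemAllLp (fun ω => q.eval (X ω)) P := by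
  induction q using Polynomial.induction_on with
  | C a => simpa using const a
  | add p q hp hq => simpa using hp.add hq
  | monomial n a h => simpa [pow_succ, mul_assoc] using h.mul hX

lemma integrable (hX : MemAllLp X P) : Integrable X P := memLp_one_iff_integrable.1 (hX 1 (by simp))

end MemAllLp

lemma memAllLp_id_gaussianReal : MemAllLp (id : ℝ → ℝ) (gaussianReal 0 1) := fun p hp => by
  lift p to NNReal using hp
  exact memLp_id_gaussianReal p

lemma ProbabilityTheory.HasLaw.memAllLp {Ω : Type*} [MeasurableSpace Ω] {P : Measure Ω} {ξ : Ω → ℝ}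
    (hξ : HasLaw ξ (gaussianReal 0 1) P) : MemAllLp ξ P := fun p hp => by
  have := memAllLp_id_gaussianReal p hp
  rw [← hξ.map_eq] at this
  exact this.comp_of_map hξ.aemeasurable

/-! ### Gaussian integration by parts. -/

section IntegrationByParts

variable {V : Type*} [NormedAddCommGroup V] [NormedSpace ℝ V]

/-- Gaussian integration by parts on the line. -/
lemma integral_smul_gaussianReal_eq {Φ Φ' : ℝ → V} (hd : ∀ u, HasDerivAt Φ (Φ' u) u)
    (h0 : Integrable Φ (gaussianReal 0 1)) (h1 : Integrable (fun u => u • Φ u) (gaussianReal 0 1))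
    (h2 : Integrable Φ' (gaussianReal 0 1)) :
    ∫ u, u • Φ u ∂(gaussianReal 0 1) = ∫ u, Φ' u ∂(gaussianReal 0 1) := by
  have hint : ∀ {f : ℝ → V}, Integrable f (gaussianReal 0 1) →
      Integrable (fun x => gaussianPDFReal 0 1 x • f x) := by
    intro f hf
    rw [gaussianReal_of_var_ne_zero _ one_ne_zero] at hf
    rw [integrable_withDensity_iff_integrable_smul' (measurable_gaussianPDF 0 1)
      (by simp [gaussianPDF])] at hf
    simpa [gaussianPDF, ENNReal.toReal_ofReal, gaussianPDFReal_nonneg] using hf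
  have hpdf : ∀ x, HasDerivAt (gaussianPDFReal 0 1) (-x * gaussianPDFReal 0 1 x) x := by
    intro x
    have h : HasDerivAt (fun y : ℝ => -(y - 0) ^ 2 / (2 * ((1 : NNReal) : ℝ))) (-x) x := by
      have := ((((hasDerivAt_id x).sub_const 0).pow 2).neg).div_const (2 * ((1 : NNReal) : ℝ))
      refine this.congr_deriv ?_
      simp only [id, sub_zero, NNReal.coe_one]
      push_cast
      ring
    have := (h.exp).const_mul (√(2 * Real.pi * ((1 : NNReal) : ℝ)))⁻¹
    refine this.congr_deriv ?_
    simp only [gaussianPDFReal]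
    ring
  -- The density satisfies pdf' = -u pdf, so the claim says that the derivative of pdf · Φ has
  -- integral zero.
  have key := integral_eq_zero_of_hasDerivAt_of_integrable
    (f := fun x => gaussianPDFReal 0 1 x • Φ x)
    (f' := fun x => gaussianPDFReal 0 1 x • Φ' x + (-x * gaussianPDFReal 0 1 x) • Φ x)
    (fun x => (hpdf x).smul (hd x))
    (by
      refine (hint h2).add ?_
      refine ((hint h1).neg).congr (.of_forall fun x => ?_)
      simp [smul_smul, mul_comm])
    (hint h0)
  rw [integral_gaussianReal_eq_integral_smul one_ne_zero,
    integral_gaussianReal_eq_integral_smul one_ne_zero, eq_comm, ← sub_eq_zero,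
    ← integral_sub (hint h2) (hint h1), ← key]
  refine integral_congr_ae (.of_forall fun x => ?_)
  simp [smul_smul, mul_comm, sub_eq_add_neg]

/-- Gaussian integration by parts in the presence of an independent random parameter. -/
lemma integral_smul_eq_of_indepFun {Ω S : Type*} [MeasurableSpace Ω] [MeasurableSpace S]
    {P : Measure Ω} [IsProbabilityMeasure P] {ξ : Ω → ℝ} {C : Ω → S}
    (hξ : HasLaw ξ (gaussianReal 0 1) P) (hC : AEMeasurable C P) (hind : IndepFun ξ C P)
    {Φ Φ' : S → ℝ → V} (hΦ : StronglyMeasurable (Function.uncurry Φ))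
    (hΦ' : StronglyMeasurable (Function.uncurry Φ'))
    (hd : ∀ c u, HasDerivAt (Φ c) (Φ' c u) u)
    (h0 : Integrable (fun ω => Φ (C ω) (ξ ω)) P)
    (h1 : Integrable (fun ω => ξ ω • Φ (C ω) (ξ ω)) P)
    (h2 : Integrable (fun ω => Φ' (C ω) (ξ ω)) P) :
    ∫ ω, ξ ω • Φ (C ω) (ξ ω) ∂P = ∫ ω, Φ' (C ω) (ξ ω) ∂P := by
  have hprob : IsProbabilityMeasure (P.map C) := Measure.isProbabilityMeasure_map hC
  have hlaw : P.map (fun ω => (C ω, ξ ω)) = (P.map C).prod (gaussianReal 0 1) := by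
    rw [(indepFun_iff_map_prod_eq_prod_map_map hC hξ.aemeasurable).1 hind.symm, hξ.map_eq]
  have hm : AEMeasurable (fun ω => (C ω, ξ ω)) P := hC.prodMk hξ.aemeasurable
  have hΦ1 : StronglyMeasurable (fun p : S × ℝ => p.2 • Φ p.1 p.2) :=
    measurable_snd.stronglyMeasurable.smul hΦ
  have tr : ∀ {f : S × ℝ → V}, StronglyMeasurable f → Integrable (fun ω => f (C ω, ξ ω)) P →
      Integrable f ((P.map C).prod (gaussianReal 0 1)) ∧
      ∫ ω, f (C ω, ξ ω) ∂P = ∫ c, ∫ u, f (c, u) ∂(gaussianReal 0 1) ∂(P.map C) := by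
    intro f hf hi
    have hi' : Integrable f ((P.map C).prod (gaussianReal 0 1)) := by
      rw [← hlaw, integrable_map_measure hf.aestronglyMeasurable hm]
      exact hi
    refine ⟨hi', ?_⟩
    rw [← integral_prod _ hi', ← hlaw, integral_map hm hf.aestronglyMeasurable]
  obtain ⟨i0, -⟩ := tr hΦ h0
  obtain ⟨i1, e1⟩ := tr hΦ1 h1
  obtain ⟨i2, e2⟩ := tr hΦ' h2
  refine e1.trans (Eq.trans ?_ e2.symm)
  refine integral_congr_ae ?_
  filter_upwards [i0.prod_right_ae, i1.prod_right_ae, i2.prod_right_ae] with c c0 c1 c2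
  exact integral_smul_gaussianReal_eq (hd c) c0 c1 c2

end IntegrationByParts

lemma MemAllLp.of_bound {Ω : Type*} [MeasurableSpace Ω] {P : Measure Ω} [IsFiniteMeasure P]
    {X : Ω → ℝ} (hX : Measurable X) (C : ℝ) (h : ∀ ω, |X ω| ≤ C) : MemAllLp X P :=
  fun _ _ => MemLp.of_bound hX.aestronglyMeasurable C (.of_forall h)

/-! ### Standard Gaussian fields and their residuals. -/

/-- A jointly measurable Gaussian process with standard normal marginals. -/
structure IsStdGaussianField {T Ω : Type*} [MeasurableSpace T] [MeasurableSpace Ω]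
    (Y : T → Ω → ℝ) (P : Measure Ω) : Prop where
  isGaussianProcess : IsGaussianProcess Y P
  hasLaw : ∀ x, HasLaw (Y x) (gaussianReal 0 1) P
  measurable : Measurable (fun p : T × Ω => Y p.1 p.2)

/-- The covariance kernel of a centred process. -/
noncomputable def covKernel {T Ω : Type*} [MeasurableSpace Ω] (Y : T → Ω → ℝ) (P : Measure Ω)
    (x y : T) : ℝ := ∫ ω, Y x ω * Y y ω ∂P

lemma covKernel_comm {T Ω : Type*} [MeasurableSpace Ω] (Y : T → Ω → ℝ) (P : Measure Ω) (x y : T) :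
    covKernel Y P x y = covKernel Y P y x := by simp [covKernel, mul_comm]

/-- An integral over a parameter of variables that are measurable for a sub-σ-algebra is almost
surely measurable for that sub-σ-algebra. -/
lemma integral_ae_eq_condExp {T Ω : Type*} [MeasurableSpace T] {m mΩ : MeasurableSpace Ω}
    {P : Measure Ω} [IsProbabilityMeasure P] {μ : Measure T} [IsFiniteMeasure μ] (hm : m ≤ mΩ) {B : T → Ω → ℝ}
    (hi : Integrable (fun p : T × Ω => B p.1 p.2) (μ.prod P))
    (hB : ∀ y, StronglyMeasurable[m] (B y)) :
    (fun ω => ∫ y, B y ω ∂μ) =ᵐ[P] P[fun ω => ∫ y, B y ω ∂μ | m] := by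
  set U : Ω → ℝ := fun ω => ∫ y, B y ω ∂μ with hU
  have hUi : Integrable U P := hi.integral_prod_right
  refine Integrable.ae_eq_of_forall_setIntegral_eq _ _ hUi integrable_condExp fun A hA _ => ?_
  set I : Ω → ℝ := A.indicator fun _ => 1 with hI
  have hIi : Integrable I P := (integrable_const 1).indicator hA
  set V : Ω → ℝ := P[I | m] with hV
  have hIb : ∀ᵐ ω ∂P, |I ω| ≤ (1 : ℝ) := .of_forall fun ω => by
    by_cases h : ω ∈ A <;> simp [hI, h]
  have hVb : ∀ᵐ ω ∂P, |V ω| ≤ (1 : ℝ) := ae_bdd_abs_condExp_of_ae_bdd_abs hIb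
  have hVm : StronglyMeasurable[m] V := stronglyMeasurable_condExp
  have hind : ∀ X : Ω → ℝ, ∫ ω in A, X ω ∂P = ∫ ω, X ω * I ω ∂P := fun X => by
    rw [← integral_indicator hA]
    refine integral_congr_ae (.of_forall fun ω => ?_)
    by_cases h : ω ∈ A <;> simp [hI, h]
  have hmulI : ∀ X : Ω → ℝ, Integrable X P → Integrable (X * I) P := fun X hX =>
    hX.mul_bdd (c := 1) hIi.aestronglyMeasurable (by simpa using hIb)
  have hmulV : ∀ X : Ω → ℝ, Integrable X P → Integrable (X * V) P := fun X hX =>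
    hX.mul_bdd (c := 1) (hVm.mono hm).aestronglyMeasurable (by simpa using hVb)
  -- Against an `m`-measurable variable the indicator may be replaced by its conditional expectation
  -- `V`. Fubini carries this from each `B y` to `U`, so joint measurability with respect to `m` is
  -- never needed.
  have swap : ∀ X : Ω → ℝ, StronglyMeasurable[m] X → Integrable X P →
      ∫ ω, X ω * I ω ∂P = ∫ ω, X ω * V ω ∂P := by
    intro X hX hXi
    have := condExp_mul_of_stronglyMeasurable_left hX (hmulI X hXi) hIi
    calc ∫ ω, X ω * I ω ∂P = ∫ ω, (P[X * I | m]) ω ∂P := (integral_condExp hm).symm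
      _ = _ := integral_congr_ae this
  have hfub : ∀ J : Ω → ℝ, AEStronglyMeasurable J P → (∀ᵐ ω ∂P, |J ω| ≤ (1 : ℝ)) →
      ∫ ω, U ω * J ω ∂P = ∫ y, ∫ ω, B y ω * J ω ∂P ∂μ := by
    intro J hJ hJb
    have hJi : Integrable (fun p : T × Ω => B p.1 p.2 * J p.2) (μ.prod P) := by
      refine hi.mul_bdd (c := 1) hJ.comp_snd ?_
      have := (Measure.quasiMeasurePreserving_snd (μ := μ) (ν := P)).ae hJb
      simpa using this
    rw [← integral_prod _ hJi, integral_prod_symm _ hJi]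
    simp [hU, integral_mul_const]
  have hUV : ∫ ω, U ω * V ω ∂P = ∫ ω, (P[U | m]) ω * V ω ∂P := by
    have := condExp_mul_of_stronglyMeasurable_right hVm (hmulV U hUi) hUi
    calc ∫ ω, U ω * V ω ∂P = ∫ ω, (P[U * V | m]) ω ∂P := (integral_condExp hm).symm
      _ = _ := integral_congr_ae this
  rw [hind, hind, swap _ stronglyMeasurable_condExp integrable_condExp, ← hUV,
    hfub I hIi.aestronglyMeasurable hIb, hfub V (hVm.mono hm).aestronglyMeasurable hVb]
  refine integral_congr_ae ?_
  filter_upwards [hi.prod_right_ae] with y hy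
  exact swap _ (hB y) hy

namespace IsStdGaussianField

variable {T Ω : Type*} [MeasurableSpace T] [MeasurableSpace Ω] {P : Measure Ω}
  {Y : T → Ω → ℝ}

lemma memAllLp (hY : IsStdGaussianField Y P) (x : T) : MemAllLp (Y x) P := (hY.hasLaw x).memAllLp

lemma measurable_apply (hY : IsStdGaussianField Y P)
    (x : T) : Measurable (Y x) := hY.measurable.comp measurable_prodMk_left

lemma integral_comp (hY : IsStdGaussianField Y P)
    {V : Type*} [NormedAddCommGroup V] [NormedSpace ℝ V] (x : T) {f : ℝ → V}
    (hf : AEStronglyMeasurable f (gaussianReal 0 1)) :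
    ∫ ω, f (Y x ω) ∂P = ∫ u, f u ∂(gaussianReal 0 1) :=
  (hY.hasLaw x).integral_comp hf

lemma integral_eq_zero (hY : IsStdGaussianField Y P) (x : T) : ∫ ω, Y x ω ∂P = 0 := by
  rw [hY.integral_comp x (f := fun u => u) measurable_id.aestronglyMeasurable]
  exact integral_id_gaussianReal

lemma covKernel_self (hY : IsStdGaussianField Y P) (x : T) : covKernel Y P x x = 1 := by
  have h : ∫ ω, Y x ω * Y x ω ∂P = ∫ u, u * u ∂(gaussianReal 0 1) :=
    hY.integral_comp x (f := fun u => u * u) (by fun_prop)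
  have hv := variance_eq_sub (X := (id : ℝ → ℝ)) (memAllLp_id_gaussianReal 2 (by simp))
  have hid : ∫ u, id u ∂(gaussianReal 0 1) = 0 := integral_id_gaussianReal
  rw [variance_id_gaussianReal, hid] at hv
  rw [covKernel, h]
  simpa [sq] using hv.symm

lemma abs_covKernel_le_one (hY : IsStdGaussianField Y P) (x y : T) : |covKernel Y P x y| ≤ 1 := by
  have hxy := ((hY.memAllLp x).mul (hY.memAllLp y)).integrable
  have hxx := ((hY.memAllLp x).mul (hY.memAllLp x)).integrable
  have hyy := ((hY.memAllLp y).mul (hY.memAllLp y)).integrable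
  have h1 := hY.covKernel_self x
  have h2 := hY.covKernel_self y
  have hs : Integrable (fun ω => (Y x ω * Y x ω + Y y ω * Y y ω) / 2) P := (hxx.add hyy).div_const 2
  have hsum : ∫ ω, (Y x ω * Y x ω + Y y ω * Y y ω) / 2 ∂P = 1 := by
    rw [integral_div, integral_add hxx hyy]
    simp only [covKernel] at h1 h2
    rw [h1, h2]; norm_num
  rw [← hsum]
  refine (abs_integral_le_integral_abs).trans (integral_mono hxy.abs hs fun ω => ?_)
  dsimp only
  rw [abs_le]
  constructor <;> nlinarith [sq_nonneg (Y x ω + Y y ω), sq_nonneg (Y x ω - Y y ω)]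

variable [IsProbabilityMeasure P]

lemma measurable_covKernel (hY : IsStdGaussianField Y P) :
    Measurable (fun p : T × T => covKernel Y P p.1 p.2) := by
  have h : Measurable (fun q : (T × T) × Ω => Y q.1.1 q.2 * Y q.1.2 q.2) :=
    (hY.measurable.comp (by fun_prop : Measurable fun q : (T × T) × Ω => (q.1.1, q.2))).mul
      (hY.measurable.comp (by fun_prop : Measurable fun q : (T × T) × Ω => (q.1.2, q.2)))
  exact (h.stronglyMeasurable.integral_prod_right (ν := P)).measurable

/-- All sections have the same law, so by Fubini integrability of f(Y) on the product space reduces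
to integrability of f for the Gaussian measure. -/
lemma map_prod (hY : IsStdGaussianField Y P) (μ : Measure T) [IsFiniteMeasure μ] :
    (μ.prod P).map (fun p : T × Ω => Y p.1 p.2) = μ Set.univ • gaussianReal 0 1 := by
  ext s hs
  rw [Measure.map_apply hY.measurable hs, Measure.prod_apply (hY.measurable hs)]
  have : ∀ x, P (Prod.mk x ⁻¹' ((fun p : T × Ω => Y p.1 p.2) ⁻¹' s)) = gaussianReal 0 1 s := by
    intro x
    rw [← (hY.hasLaw x).map_eq, Measure.map_apply (hY.measurable_apply x) hs]
    rfl
  simp [this, mul_comm]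

lemma memLp_prod (hY : IsStdGaussianField Y P)
    (μ : Measure T) [IsFiniteMeasure μ] {p : ENNReal} {f : ℝ → ℝ}
    (hf : MemLp f p (gaussianReal 0 1)) :
    MemLp (fun q : T × Ω => f (Y q.1 q.2)) p (μ.prod P) := by
  have : MemLp f p (Measure.map (fun p : T × Ω => Y p.1 p.2) (μ.prod P)) := by
    rw [hY.map_prod]
    exact hf.smul_measure (measure_ne_top μ _)
  exact this.comp_of_map hY.measurable.aemeasurable

lemma memAllLp_prod (hY : IsStdGaussianField Y P) (μ : Measure T) [IsFiniteMeasure μ] :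
    MemAllLp (fun q : T × Ω => Y q.1 q.2) (μ.prod P) :=
  fun p hp => hY.memLp_prod μ (memAllLp_id_gaussianReal p hp)

/-- The field at one point is independent of its residual process. -/
lemma indepFun_residual (hY : IsStdGaussianField Y P) (x : T) :
    IndepFun (Y x) (fun ω y => Y y ω - covKernel Y P x y * Y x ω) P := by
  classical
  have hZm : ∀ y, Measurable fun ω => Y y ω - covKernel Y P x y * Y x ω := fun y =>
    (hY.measurable_apply y).sub ((hY.measurable_apply x).const_mul _)
  -- The value at `x` and the residuals are linear images of one Gaussian process, hence jointly
  -- Gaussian, so vanishing covariances suffice for independence.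
  have hg : IsGaussianProcess (Sum.elim (fun _ : Unit => Y x)
      (fun y ω => Y y ω - covKernel Y P x y * Y x ω)) P := by
    refine hY.isGaussianProcess.of_isGaussianProcess fun s => ?_
    rcases s with _ | y
    · exact ⟨{x}, { toFun := fun v => v ⟨x, by simp⟩
                    map_add' := by simp
                    map_smul' := by simp }, fun ω => rfl⟩
    · exact ⟨{x, y}, { toFun := fun v => v ⟨y, by simp⟩ - covKernel Y P x y * v ⟨x, by simp⟩
                       map_add' := fun _ _ => by simp; ring
                       map_smul' := fun _ _ => by simp; ring }, fun ω => rfl⟩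
  have := hg.indepFun_of_covariance_eq_zero (fun _ => (hY.measurable_apply x).aemeasurable)
    (fun y => (hZm y).aemeasurable) (fun _ y => by
      have hx2 := (hY.memAllLp x) 2 (by simp)
      have hZ : MemAllLp (fun ω => Y y ω - covKernel Y P x y * Y x ω) P :=
        (hY.memAllLp y).sub ((MemAllLp.const _).mul (hY.memAllLp x))
      rw [covariance_eq_sub hx2 (hZ 2 (by simp)), hY.integral_eq_zero x, zero_mul, sub_zero]
      have e : (Y x * fun ω => Y y ω - covKernel Y P x y * Y x ω) =
          fun ω => Y x ω * Y y ω - covKernel Y P x y * (Y x ω * Y x ω) := by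
        ext ω; simp only [Pi.mul_apply]; ring
      rw [e, integral_sub ((hY.memAllLp x).mul (hY.memAllLp y)).integrable
        (((hY.memAllLp x).mul (hY.memAllLp x)).integrable.const_mul _), integral_const_mul]
      have h1 := hY.covKernel_self x
      simp only [covKernel] at h1 ⊢
      rw [h1]; ring)
  exact this.comp (φ := fun v : Unit → ℝ => v ()) (measurable_pi_apply ()) measurable_id

/-- Gaussian integration by parts for a product of polynomials in the values of the field. -/
lemma integral_mul_prod_eq (hY : IsStdGaussianField Y P)
    {ι : Type*} [DecidableEq ι] (x : T) (p : Polynomial ℝ) (s : Finset ι)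
    (y : ι → T) (q : ι → Polynomial ℝ) :
    ∫ ω, (Y x ω * p.eval (Y x ω) - p.derivative.eval (Y x ω)) *
        ∏ j ∈ s, (q j).eval (Y (y j) ω) ∂P =
      ∑ j ∈ s, covKernel Y P x (y j) * ∫ ω, p.eval (Y x ω) * ((q j).derivative.eval (Y (y j) ω) *
        ∏ l ∈ s.erase j, (q l).eval (Y (y l) ω)) ∂P := by
  set ρ : ι → ℝ := fun j => covKernel Y P x (y j) with hρ
  let C : Ω → ι → ℝ := fun ω j => Y (y j) ω - ρ j * Y x ω
  let C' : Ω → s → ℝ := fun ω j => C ω j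
  have hev0 : Measurable fun (v : T → ℝ) (j : s) => v (y j) := by fun_prop
  have hind : IndepFun (Y x) C' P := (hY.indepFun_residual x).comp measurable_id hev0
  have hC : Measurable C' := measurable_pi_lambda _ fun j =>
    (hY.measurable_apply _).sub ((hY.measurable_apply x).const_mul _)
  -- With the residual `c` frozen, every value of the field is affine in `u = Y x`: Y(y j) = ρ j · u
  -- + c j.
  let Φ : (s → ℝ) → ℝ → ℝ := fun c u =>
    p.eval u * ∏ j ∈ s.attach, (q j).eval (ρ j * u + c j)
  let Φ' : (s → ℝ) → ℝ → ℝ := fun c u =>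
    p.derivative.eval u * ∏ j ∈ s.attach, (q j).eval (ρ j * u + c j) +
      p.eval u * ∑ j ∈ s.attach, (∏ l ∈ s.attach.erase j, (q l).eval (ρ l * u + c l)) •
        ((q j).derivative.eval (ρ j * u + c j) * ρ j)
  have hev : ∀ (r : Polynomial ℝ) (j : s),
      Continuous fun z : (s → ℝ) × ℝ => r.eval (ρ j * z.2 + z.1 j) := fun r j =>
    r.continuous.comp (by fun_prop)
  have hev' : ∀ (r : Polynomial ℝ), Continuous fun z : (s → ℝ) × ℝ => r.eval z.2 := fun r =>
    r.continuous.comp (by fun_prop)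
  have hΦc : Continuous (Function.uncurry Φ) :=
    (hev' p).mul (continuous_finsetProd _ fun (j : s) _ => hev (q j) j)
  have hΦ'c : Continuous (Function.uncurry Φ') := by
    refine ((hev' _).mul (continuous_finsetProd _ fun (j : s) _ => hev (q j) j)).add
      ((hev' p).mul (continuous_finsetSum _ fun (j : s) _ => ?_))
    exact (continuous_finsetProd _ fun (l : s) _ => hev (q l) l).smul ((hev _ j).mul continuous_const)
  have hd : ∀ c u, HasDerivAt (Φ c) (Φ' c u) u := by
    intro c u
    refine (p.hasDerivAt u).mul (HasDerivAt.fun_finsetProd fun (j : s) _ => ?_)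
    have h1 : HasDerivAt (fun v : ℝ => ρ j * v + c j) (ρ j) u := by
      simpa using ((hasDerivAt_id u).const_mul (ρ j)).add_const (c j)
    exact ((q j).hasDerivAt _).comp u h1
  have eqv : ∀ ω (j : s), ρ j * Y x ω + C' ω j = Y (y j) ω := fun ω j => by
    simp [C', C]
  have hpol : ∀ r : Polynomial ℝ, ∀ z, MemAllLp (fun ω => r.eval (Y z ω)) P := fun r z =>
    (hY.memAllLp z).polynomial r
  have eΦ : ∀ ω, Φ (C' ω) (Y x ω) = p.eval (Y x ω) * ∏ j ∈ s, (q j).eval (Y (y j) ω) := by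
    intro ω
    simp only [Φ, eqv]
    rw [Finset.prod_attach s fun j => (q j).eval (Y (y j) ω)]
  have hprod : ∀ t : Finset ι, MemAllLp (fun ω => ∏ j ∈ t, (q j).eval (Y (y j) ω)) P := fun t =>
    MemAllLp.prod t fun j _ => hpol _ _
  have herase : ∀ ω (j : s), ∏ l ∈ s.attach.erase j, (q l).eval (Y (y l) ω) =
      ∏ l ∈ s.erase j, (q l).eval (Y (y l) ω) := by
    intro ω j
    refine Finset.prod_bij (fun l _ => (l : ι)) ?_ ?_ ?_ ?_
    · intro a ha
      simp only [Finset.mem_erase, Finset.mem_attach, and_true] at ha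
      simpa using fun h => ha (Subtype.ext h)
    · intro a _ b _ h; exact Subtype.ext h
    · intro b hb
      rw [Finset.mem_erase] at hb
      exact ⟨⟨b, hb.2⟩, by simpa [Subtype.ext_iff] using hb.1, rfl⟩
    · intros; rfl
  have eΦ' : ∀ ω, Φ' (C' ω) (Y x ω) =
      p.derivative.eval (Y x ω) * ∏ j ∈ s, (q j).eval (Y (y j) ω) +
      ∑ j ∈ s, ρ j * (p.eval (Y x ω) * ((q j).derivative.eval (Y (y j) ω) *
        ∏ l ∈ s.erase j, (q l).eval (Y (y l) ω))) := by
    intro ω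
    simp only [Φ', eqv, herase]
    rw [Finset.prod_attach s fun j => (q j).eval (Y (y j) ω), Finset.mul_sum,
      ← Finset.sum_attach s]
    congr 1
    refine Finset.sum_congr rfl fun j _ => ?_
    simp only [smul_eq_mul]; ring
  have hterm : ∀ j, MemAllLp (fun ω => p.eval (Y x ω) * ((q j).derivative.eval (Y (y j) ω) *
        ∏ l ∈ s.erase j, (q l).eval (Y (y l) ω))) P := fun j =>
    (hpol _ _).mul ((hpol _ _).mul (hprod _))
  have hmain : Integrable (fun ω => p.eval (Y x ω) * ∏ j ∈ s, (q j).eval (Y (y j) ω)) P :=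
    ((hpol _ _).mul (hprod _)).integrable
  have hmain1 : Integrable (fun ω => Y x ω * (p.eval (Y x ω) * ∏ j ∈ s, (q j).eval (Y (y j) ω))) P :=
    ((hY.memAllLp x).mul ((hpol _ _).mul (hprod _))).integrable
  have hd1 : Integrable (fun ω => p.derivative.eval (Y x ω) * ∏ j ∈ s, (q j).eval (Y (y j) ω)) P :=
    ((hpol _ _).mul (hprod _)).integrable
  have hd2 : Integrable (fun ω => ∑ j ∈ s, ρ j * (p.eval (Y x ω) *
      ((q j).derivative.eval (Y (y j) ω) * ∏ l ∈ s.erase j, (q l).eval (Y (y l) ω)))) P :=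
    integrable_finsetSum _ fun j _ => (hterm j).integrable.const_mul _
  have key := integral_smul_eq_of_indepFun (hY.hasLaw x) hC.aemeasurable hind
    hΦc.stronglyMeasurable hΦ'c.stronglyMeasurable hd (by simpa only [eΦ] using hmain)
    (by simpa only [eΦ, smul_eq_mul] using hmain1) (by simp only [eΦ']; exact hd1.add hd2)
  simp only [eΦ, eΦ', smul_eq_mul] at key
  rw [integral_add hd1 hd2, integral_finsetSum _
    (fun j _ => (hterm j).integrable.const_mul _)] at key
  simp only [integral_const_mul] at key
  calc _ = ∫ ω, (Y x ω * (p.eval (Y x ω) * ∏ j ∈ s, (q j).eval (Y (y j) ω)) -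
        p.derivative.eval (Y x ω) * ∏ j ∈ s, (q j).eval (Y (y j) ω)) ∂P := by
        congr 1; ext ω; ring
    _ = _ := by rw [integral_sub hmain1 hd1, key]; ring

end IsStdGaussianField

/-! ### Integral functionals and their characteristic exponentials. -/

/-- Cauchy–Schwarz against the constant 1, from expanding ∫(Mb - l)² ≥ 0 with M the total mass and l
= ∫ b. -/
lemma sq_integral_le {T : Type*} [MeasurableSpace T] {μ : Measure T} [IsFiniteMeasure μ] {b : T → ℝ}
    (hb : Integrable b μ) (hb2 : Integrable (fun y => b y ^ 2) μ) :
    (∫ y, b y ∂μ) ^ 2 ≤ μ.real Set.univ * ∫ y, b y ^ 2 ∂μ := by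
  set M := μ.real Set.univ
  set l := ∫ y, b y ∂μ with hl
  have h0 : 0 ≤ ∫ y, (M * b y - l) ^ 2 ∂μ := integral_nonneg fun y => sq_nonneg _
  have e : ∫ y, (M * b y - l) ^ 2 ∂μ = M ^ 2 * ∫ y, b y ^ 2 ∂μ - 2 * M * l * l + l ^ 2 * M := by
    have : (fun y => (M * b y - l) ^ 2) = fun y => M ^ 2 * b y ^ 2 - 2 * M * l * b y + l ^ 2 := by
      ext y; ring
    have h1 : Integrable (fun y => M ^ 2 * b y ^ 2 - 2 * M * l * b y) μ :=
      (hb2.const_mul _).sub (hb.const_mul _)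
    rw [this, integral_add h1 (integrable_const _), integral_sub (hb2.const_mul _) (hb.const_mul _), integral_const_mul, integral_const_mul,
      integral_const, smul_eq_mul]
    ring
  rw [e] at h0
  rcases (measureReal_nonneg : 0 ≤ M).eq_or_lt with hM | hM
  · have : l = 0 := by
      have hz : μ = 0 := by
        rw [← Measure.measure_univ_eq_zero]
        simpa [M, measureReal_def, ENNReal.toReal_eq_zero_iff] using hM.symm
      simp [hl, hz]
    have hM' : M = 0 := hM.symm
    simp [this, hM']
  · nlinarith

/-- Second moments of integrals over a parameter. -/
lemma memLp_two_integral {T Ω : Type*} [MeasurableSpace T] [MeasurableSpace Ω] {P : Measure Ω}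
    [IsFiniteMeasure P] {μ : Measure T} [IsFiniteMeasure μ] {B : T → Ω → ℝ}
    (hB : MemLp (fun p : T × Ω => B p.1 p.2) 2 (μ.prod P)) :
    MemLp (fun ω => ∫ y, B y ω ∂μ) 2 P := by
  have hB1 : Integrable (fun p : T × Ω => B p.1 p.2) (μ.prod P) := hB.integrable (by norm_num)
  have hB2 := hB.integrable_sq
  have hm : AEStronglyMeasurable (fun ω => ∫ y, B y ω ∂μ) P :=
    (hB1.swap.integral_prod_left).aestronglyMeasurable
  rw [memLp_two_iff_integrable_sq hm]
  refine (hB2.swap.integral_prod_left.const_mul (μ.real Set.univ)).mono' (hm.pow 2) ?_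
  filter_upwards [hB1.prod_left_ae, hB2.prod_left_ae] with ω h1 h2
  rw [Real.norm_eq_abs, abs_of_nonneg (sq_nonneg _)]
  exact sq_integral_le h1 h2

namespace IsStdGaussianField

variable {T Ω : Type*} [MeasurableSpace T] {mΩ : MeasurableSpace Ω} {P : Measure Ω}
  {Y : T → Ω → ℝ} [IsProbabilityMeasure P]

lemma memAllLp_covKernel_comp (hY : IsStdGaussianField Y P)
    {S : Type*} [MeasurableSpace S] {Q : Measure S} [IsFiniteMeasure Q]
    {φ ψ : S → T} (hφ : Measurable φ) (hψ : Measurable ψ) :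
    MemAllLp (fun s => covKernel Y P (φ s) (ψ s)) Q :=
  MemAllLp.of_bound (hY.measurable_covKernel.comp (hφ.prodMk hψ)) 1
    fun _ => hY.abs_covKernel_le_one _ _

lemma memLp_integral_polynomial (hY : IsStdGaussianField Y P)
    (μ : Measure T) [IsFiniteMeasure μ] (g : Polynomial ℝ) :
    MemLp (fun ω => ∫ y, g.eval (Y y ω) ∂μ) 2 P :=
  memLp_two_integral (((hY.memAllLp_prod μ).polynomial g) 2 (by simp))

lemma memLp_integral_covKernel_mul (hY : IsStdGaussianField Y P)
    (μ : Measure T) [IsFiniteMeasure μ] (x : T) (g : Polynomial ℝ) :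
    MemLp (fun ω => ∫ y, covKernel Y P x y * g.eval (Y y ω) ∂μ) 2 P :=
  memLp_two_integral (((hY.memAllLp_covKernel_comp measurable_const measurable_fst).mul
    ((hY.memAllLp_prod μ).polynomial g)) 2 (by simp))

/-- Gaussian integration by parts against the characteristic exponential of an integral
functional. -/
lemma integral_mul_cexp_eq (hY : IsStdGaussianField Y P)
    (μ : Measure T) [IsFiniteMeasure μ] (x : T) (p g : Polynomial ℝ)
    (t : ℝ) :
    ∫ ω, ((Y x ω * p.eval (Y x ω) - p.derivative.eval (Y x ω) : ℝ) : ℂ) *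
        Complex.exp (((t * ∫ y, g.eval (Y y ω) ∂μ : ℝ) : ℂ) * Complex.I) ∂P =
      ∫ ω, ((p.eval (Y x ω) * ∫ y, covKernel Y P x y * g.derivative.eval (Y y ω) ∂μ : ℝ) : ℂ) *
        ((t * Complex.I) *
          Complex.exp (((t * ∫ y, g.eval (Y y ω) ∂μ : ℝ) : ℂ) * Complex.I)) ∂P := by
  set ρ : T → ℝ := fun y => covKernel Y P x y with hρ
  let Z : Ω → T → ℝ := fun ω y => Y y ω - ρ y * Y x ω
  have hZ : Measurable Z := measurable_pi_lambda _ fun y =>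
    (hY.measurable_apply y).sub ((hY.measurable_apply x).const_mul _)
  have h𝓩 : MeasurableSpace.comap Z MeasurableSpace.pi ≤ mΩ := hZ.comap_le
  -- Taylor coefficients of u ↦ g(ρ y · u + Z y). Integrated over y, they make the functional a
  -- polynomial in u = Y x whose coefficients depend on the residual only.
  let B : ℕ → T → Ω → ℝ := fun m y ω => ρ y ^ m * (Polynomial.hasseDeriv m g).eval (Z ω y)
  have hZL : MemAllLp (fun q : T × Ω => Z q.2 q.1) (μ.prod P) :=
    (hY.memAllLp_prod μ).sub ((hY.memAllLp_covKernel_comp measurable_const measurable_fst).mul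
      fun q hq => ((hY.memAllLp x) q hq).comp_snd μ)
  have hBi : ∀ m, Integrable (fun q : T × Ω => B m q.1 q.2) (μ.prod P) := fun m => by
    have h1 := (hY.memAllLp_covKernel_comp (Q := μ.prod P) (measurable_const (a := x))
      measurable_fst).polynomial (Polynomial.X ^ m)
    simpa [B, hρ] using (h1.mul (hZL.polynomial (Polynomial.hasseDeriv m g))).integrable
  have hBm : ∀ m y, StronglyMeasurable[MeasurableSpace.comap Z MeasurableSpace.pi] (B m y) := fun m y => by
    have h1 : Measurable[MeasurableSpace.comap Z MeasurableSpace.pi] fun ω => Z ω y := (measurable_pi_apply y).comp (comap_measurable Z)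
    exact (((Polynomial.hasseDeriv m g).continuous.measurable.comp h1).const_mul
      (ρ y ^ m)).stronglyMeasurable
  let c : Ω → ℕ → ℝ := fun ω m => ∫ y, B m y ω ∂μ
  -- The parameter integrals need not be measurable for the σ-algebra of the residual path, because
  -- evaluation is not jointly measurable on an uncountable product. Their conditional expectations
  -- are, they agree almost surely with the integrals, and they inherit independence from `Y x`.
  let c' : Ω → ℕ → ℝ := fun ω m => (P[fun ω => ∫ y, B m y ω ∂μ | MeasurableSpace.comap Z MeasurableSpace.pi]) ω
  have hcc' : ∀ᵐ ω ∂P, c ω = c' ω := by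
    have : ∀ᵐ ω ∂P, ∀ m, c ω m = c' ω m := ae_all_iff.2 fun m =>
      integral_ae_eq_condExp h𝓩 (hBi m) (hBm m)
    filter_upwards [this] with ω hω using funext hω
  have hc'm : Measurable[MeasurableSpace.comap Z MeasurableSpace.pi] c' :=
    @measurable_pi_lambda _ _ _ (MeasurableSpace.comap Z MeasurableSpace.pi) _ _ fun _ =>
      stronglyMeasurable_condExp.measurable
  have hc' : Measurable c' := hc'm.mono h𝓩 le_rfl
  have hind : IndepFun (Y x) c' P := by
    rw [IndepFun_iff_Indep]
    have h1 := hY.indepFun_residual x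
    rw [IndepFun_iff_Indep] at h1
    exact indep_of_indep_of_le_right h1 hc'm.comap_le
  set N := g.natDegree
  let Q : (ℕ → ℝ) → ℝ → ℝ := fun a u => ∑ m ∈ Finset.range (N + 1), a m * u ^ m
  let Q' : (ℕ → ℝ) → ℝ → ℝ := fun a u => ∑ m ∈ Finset.range (N + 1), a m * (m * u ^ (m - 1))
  have hQd : ∀ a u, HasDerivAt (Q a) (Q' a u) u := fun a u => by
    refine HasDerivAt.fun_sum fun m _ => ?_
    exact (hasDerivAt_pow m u).const_mul (a m)
  have htaylor : ∀ r z u, g.eval (r * u + z) =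
      Q (fun m => r ^ m * (Polynomial.hasseDeriv m g).eval z) u := by
    intro r z u
    rw [← Polynomial.taylor_eval, Polynomial.eval_eq_sum_range, Polynomial.natDegree_taylor]
    refine Finset.sum_congr rfl fun m _ => ?_
    rw [Polynomial.taylor_coeff]; ring
  have htaylor' : ∀ r z u, r * g.derivative.eval (r * u + z) =
      Q' (fun m => r ^ m * (Polynomial.hasseDeriv m g).eval z) u := by
    intro r z u
    have h1 : HasDerivAt (fun v : ℝ => r * v + z) r u := by
      simpa using ((hasDerivAt_id u).const_mul r).add_const z
    have h2 := (g.hasDerivAt (r * u + z)).comp u h1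
    have h3 : HasDerivAt (fun v => g.eval (r * v + z))
      (Q' (fun m => r ^ m * (Polynomial.hasseDeriv m g).eval z) u) u := by
      simp only [htaylor]; exact hQd _ u
    rw [mul_comm]
    exact h2.unique h3
  have hBae : ∀ᵐ ω ∂P, ∀ m, Integrable (fun y => B m y ω) μ :=
    ae_all_iff.2 fun m => Integrable.prod_left_ae (f := fun q : T × Ω => B m q.1 q.2) (hBi m)
  have hF : ∀ᵐ ω ∂P, Q (c' ω) (Y x ω) = ∫ y, g.eval (Y y ω) ∂μ ∧
      Q' (c' ω) (Y x ω) = ∫ y, ρ y * g.derivative.eval (Y y ω) ∂μ := by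
    filter_upwards [hcc', hBae] with ω h1 h2
    rw [← h1]
    have e : ∀ y, Y y ω = ρ y * Y x ω + Z ω y := fun y => by simp [Z]
    constructor
    · change ∑ m ∈ Finset.range (N + 1), (∫ y, B m y ω ∂μ) * _ = _
      rw [show (fun y => g.eval (Y y ω)) = fun y =>
        ∑ m ∈ Finset.range (N + 1), B m y ω * Y x ω ^ m from funext fun y => by
          conv_lhs => rw [e y, htaylor]]
      rw [integral_finsetSum _ fun m _ => (h2 m).mul_const _]
      simp only [integral_mul_const]
    · change ∑ m ∈ Finset.range (N + 1), (∫ y, B m y ω ∂μ) * _ = _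
      rw [show (fun y => ρ y * g.derivative.eval (Y y ω)) = fun y =>
        ∑ m ∈ Finset.range (N + 1), B m y ω * (m * Y x ω ^ (m - 1)) from funext fun y => by
          conv_lhs => rw [e y, htaylor']]
      rw [integral_finsetSum _ fun m _ => (h2 m).mul_const _]
      simp only [integral_mul_const]
  let Φ : (ℕ → ℝ) → ℝ → ℂ := fun a u =>
    ((p.eval u : ℝ) : ℂ) * Complex.exp (((t * Q a u : ℝ) : ℂ) * Complex.I)
  let Φ' : (ℕ → ℝ) → ℝ → ℂ := fun a u =>
    ((p.derivative.eval u : ℝ) : ℂ) * Complex.exp (((t * Q a u : ℝ) : ℂ) * Complex.I) +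
    ((p.eval u : ℝ) : ℂ) * (Complex.exp (((t * Q a u : ℝ) : ℂ) * Complex.I) *
      (((t * Q' a u : ℝ) : ℂ) * Complex.I))
  have hQc : Continuous (Function.uncurry Q) := by
    show Continuous fun z : (ℕ → ℝ) × ℝ => ∑ m ∈ Finset.range (N + 1), z.1 m * z.2 ^ m
    fun_prop
  have hQ'c : Continuous (Function.uncurry Q') := by
    show Continuous fun z : (ℕ → ℝ) × ℝ =>
      ∑ m ∈ Finset.range (N + 1), z.1 m * (m * z.2 ^ (m - 1))
    fun_prop
  have hpc : ∀ r : Polynomial ℝ, Continuous fun z : (ℕ → ℝ) × ℝ => ((r.eval z.2 : ℝ) : ℂ) :=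
    fun r => Complex.continuous_ofReal.comp (r.continuous.comp continuous_snd)
  have hec : Continuous fun z : (ℕ → ℝ) × ℝ =>
      Complex.exp (((t * Q z.1 z.2 : ℝ) : ℂ) * Complex.I) := by
    refine Complex.continuous_exp.comp ((Complex.continuous_ofReal.comp ?_).mul continuous_const)
    exact continuous_const.mul hQc
  have hΦc : Continuous (Function.uncurry Φ) := (hpc p).mul hec
  have hΦ'c : Continuous (Function.uncurry Φ') := by
    refine ((hpc _).mul hec).add ((hpc p).mul (hec.mul
      ((Complex.continuous_ofReal.comp ?_).mul continuous_const)))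
    exact continuous_const.mul hQ'c
  have hd : ∀ a u, HasDerivAt (Φ a) (Φ' a u) u := fun a u => by
    refine (p.hasDerivAt u).ofReal_comp.mul ?_
    exact ((((hQd a u).const_mul t).ofReal_comp).mul_const Complex.I).cexp
  have hexp : ∀ r : ℝ, ‖Complex.exp ((r : ℂ) * Complex.I)‖ = 1 := Complex.norm_exp_ofReal_mul_I
  have hem : AEStronglyMeasurable (fun ω =>
      Complex.exp (((t * Q (c' ω) (Y x ω) : ℝ) : ℂ) * Complex.I)) P :=
    (hec.measurable.comp (hc'.prodMk (hY.measurable_apply x))).aestronglyMeasurable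
  have hbd : ∀ X : Ω → ℝ, Integrable X P → Integrable (fun ω => (X ω : ℂ) *
      Complex.exp (((t * Q (c' ω) (Y x ω) : ℝ) : ℂ) * Complex.I)) P := fun X hX =>
    hX.ofReal.mul_bdd (c := 1) hem (.of_forall fun ω => (hexp _).le)
  have hpol : ∀ r : Polynomial ℝ, MemAllLp (fun ω => r.eval (Y x ω)) P := fun r =>
    (hY.memAllLp x).polynomial r
  have hi0 : Integrable (fun ω => Φ (c' ω) (Y x ω)) P := hbd _ (hpol p).integrable
  have hi1 : Integrable (fun ω => Y x ω • Φ (c' ω) (Y x ω)) P := by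
    refine (hbd _ ((hY.memAllLp x).mul (hpol p)).integrable).congr (.of_forall fun ω => ?_)
    simp [Φ, mul_assoc]
  have hi2 : Integrable (fun ω => ((p.derivative.eval (Y x ω) : ℝ) : ℂ) *
      Complex.exp (((t * Q (c' ω) (Y x ω) : ℝ) : ℂ) * Complex.I)) P :=
    hbd _ (hpol _).integrable
  have hQ'i : MemLp (fun ω => Q' (c' ω) (Y x ω)) 2 P :=
    (hY.memLp_integral_covKernel_mul μ x g.derivative).ae_eq
      (by filter_upwards [hF] with ω hω using hω.2.symm)
  have hi3 : Integrable (fun ω => ((p.eval (Y x ω) : ℝ) : ℂ) *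
      (Complex.exp (((t * Q (c' ω) (Y x ω) : ℝ) : ℂ) * Complex.I) *
      (((t * Q' (c' ω) (Y x ω) : ℝ) : ℂ) * Complex.I))) P := by
    have h1 : Integrable (fun ω => p.eval (Y x ω) * Q' (c' ω) (Y x ω)) P :=
      ((hpol p) 2 (by simp)).integrable_mul hQ'i
    refine ((hbd _ h1).mul_const (t * Complex.I)).congr (.of_forall fun ω => ?_)
    push_cast; ring
  have key := integral_smul_eq_of_indepFun (hY.hasLaw x) hc'.aemeasurable hind
    hΦc.stronglyMeasurable hΦ'c.stronglyMeasurable hd hi0 hi1 (hi2.add hi3)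
  simp only [Φ'] at key
  rw [integral_add hi2 hi3] at key
  have e1 : ∫ ω, ((Y x ω * p.eval (Y x ω) - p.derivative.eval (Y x ω) : ℝ) : ℂ) *
        Complex.exp (((t * ∫ y, g.eval (Y y ω) ∂μ : ℝ) : ℂ) * Complex.I) ∂P =
      ∫ ω, (Y x ω • Φ (c' ω) (Y x ω) - ((p.derivative.eval (Y x ω) : ℝ) : ℂ) *
      Complex.exp (((t * Q (c' ω) (Y x ω) : ℝ) : ℂ) * Complex.I)) ∂P := by
    refine integral_congr_ae ?_
    filter_upwards [hF] with ω hω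
    rw [← hω.1]
    simp only [Φ, Complex.real_smul]
    push_cast; ring
  rw [e1, integral_sub hi1 hi2, key, add_sub_cancel_left]
  refine integral_congr_ae ?_
  filter_upwards [hF] with ω hω
  rw [← hω.1, ← hω.2]
  push_cast; ring

end IsStdGaussianField

/-! ### The diagram formula for Hermite moments. -/

section Diagrams

variable {ι : Type*} [Fintype ι] [DecidableEq ι]

/-- The monomial attached to a multigraph with `n i j` directed edges from `i` to `j`. -/
def diagramMonomial (n : ι → ι → ℕ) (R : ι → ι → ℝ) : ℝ := ∏ i, ∏ j, R i j ^ n i j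

/-- The degree of a vertex of a multigraph. -/
def diagramDegree (n : ι → ι → ℕ) (i : ι) : ℕ := ∑ j, (n i j + n j i)

/-- The span of the monomials of loopless multigraphs with prescribed degrees. -/
def diagramSpan (p : ι → ℕ) : Submodule ℝ ((ι → ι → ℝ) → ℝ) :=
  Submodule.span ℝ {m | ∃ n : ι → ι → ℕ, (∀ i, n i i = 0) ∧ (∀ i, diagramDegree n i = p i) ∧
    m = diagramMonomial n}

/-- The recursion satisfied by the moments of Hermite polynomials of Gaussian variables. -/
structure IsHermiteMoment (R : ι → ι → ℝ) (Λ : (ι → ℕ) → ℝ) : Prop where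
  zero : Λ 0 = 1
  rec_eq : ∀ p i, 0 < p i →
    Λ p = ∑ j ∈ Finset.univ.erase i, R i j * (p j * Λ (p - Pi.single i 1 - Pi.single j 1))

/-- Multiplication by an entry of `R` adds an edge from `i` to `j`, which raises exactly the two
degrees at its ends; `i ≠ j` keeps the graph loopless. -/
lemma mul_mem_diagramSpan {p q : ι → ℕ} {i j : ι} (hij : i ≠ j)
    (hq : q = p + Pi.single i 1 + Pi.single j 1) {W : (ι → ι → ℝ) → ℝ} (hW : W ∈ diagramSpan p) :
    (fun R => R i j * W R) ∈ diagramSpan q := by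
  induction hW using Submodule.span_induction with
  | mem m hm =>
    obtain ⟨n, h0, hd, rfl⟩ := hm
    refine Submodule.subset_span ⟨n + Pi.single i (Pi.single j 1), ?_, ?_, ?_⟩
    · intro k
      by_cases hk : k = i
      · subst hk; simp [h0, hij]
      · simp [h0, hk]
    · intro k
      have e : diagramDegree (n + Pi.single i (Pi.single j 1)) k =
          diagramDegree n k + (Pi.single i 1 : ι → ℕ) k + (Pi.single j 1 : ι → ℕ) k := by
        simp only [diagramDegree, Pi.add_apply, Finset.sum_add_distrib]
        have h1 : ∑ l, (Pi.single i (Pi.single j 1) : ι → ι → ℕ) k l = (Pi.single i 1 : ι → ℕ) k := by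
          by_cases hk : k = i
          · subst hk; simp
          · simp [hk]
        have h2 : ∑ l, (Pi.single i (Pi.single j 1) : ι → ι → ℕ) l k = (Pi.single j 1 : ι → ℕ) k := by
          rw [Finset.sum_eq_single i]
          · simp
          · intro l _ hl; simp [hl]
          · simp
        rw [h1, h2]; ring
      rw [e, hd, hq]; rfl
    · funext R
      simp only [diagramMonomial, Pi.add_apply, pow_add, Finset.prod_mul_distrib]
      rw [mul_comm]
      congr 1
      rw [Finset.prod_eq_single i, Finset.prod_eq_single j]
      · simp
      · intro l _ hl; simp [hl]
      · simp
      · intro l _ hl; simp [hl]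
      · simp
  | zero =>
    convert Submodule.zero_mem (diagramSpan q) using 1
    funext R; simp
  | add f g _ _ hf hg => simpa [mul_add] using! Submodule.add_mem _ hf hg
  | smul c f _ hf => simpa [mul_left_comm] using! Submodule.smul_mem _ c hf

/-- Each use of the recursion strips one edge, so induction on the total degree applies. The point
is that `W` depends on the degrees alone: one polynomial serves for the true covariance matrix and
for its masked version. -/
lemma exists_diagramSpan (p : ι → ℕ) : ∃ W ∈ diagramSpan p, ∀ (R : ι → ι → ℝ) (Λ : (ι → ℕ) → ℝ),
    IsHermiteMoment R Λ → Λ p = W R := by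
  induction hs : ∑ i, p i using Nat.strong_induction_on generalizing p with
  | _ s ih =>
    by_cases hp : p = 0
    · subst hp
      refine ⟨diagramMonomial 0, Submodule.subset_span ⟨0, by simp, by simp [diagramDegree], rfl⟩,
        fun R Λ h => ?_⟩
      simp [h.zero, diagramMonomial]
    obtain ⟨i, hi⟩ : ∃ i, 0 < p i := by
      by_contra! h
      exact hp (funext fun i => Nat.le_zero.1 (h i))
    have hW : ∀ j, ∃ W : (ι → ι → ℝ) → ℝ, j ≠ i →
        ((fun R => R i j * (p j * W R)) ∈ diagramSpan p ∧
          ∀ (R : ι → ι → ℝ) (Λ : (ι → ℕ) → ℝ), IsHermiteMoment R Λ →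
          p j * Λ (p - Pi.single i 1 - Pi.single j 1) = p j * W R) := by
      intro j
      -- When `p j = 0` the truncated subtraction produces a meaningless index, but the factor `p j`
      -- removes the term.
      by_cases hj : p j = 0
      · refine ⟨0, fun _ => ⟨?_, by simp [hj]⟩⟩
        convert Submodule.zero_mem (diagramSpan p) using 1
        funext R; simp
      by_cases hij : j = i
      · exact ⟨0, fun h => absurd hij h⟩
      set q := p - Pi.single i 1 - Pi.single j 1 with hq
      have hqp : p = q + Pi.single i 1 + Pi.single j 1 := by
        funext k
        simp only [hq, Pi.add_apply, Pi.sub_apply]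
        by_cases hki : k = i
        · subst hki
          have : (Pi.single j 1 : ι → ℕ) k = 0 := Pi.single_eq_of_ne (Ne.symm hij) _
          simp [this]; omega
        · by_cases hkj : k = j
          · subst hkj
            have : (Pi.single i 1 : ι → ℕ) k = 0 := Pi.single_eq_of_ne hki _
            simp [this]; omega
          · simp [hki, hkj]
      have hlt : ∑ k, q k < s := by
        rw [← hs]
        refine Finset.sum_lt_sum (fun k _ => ?_) ⟨i, Finset.mem_univ _, ?_⟩
        · rw [hqp]; simp only [Pi.add_apply]; omega
        · rw [hqp]; simp only [Pi.add_apply, Pi.single_eq_same]; omega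
      obtain ⟨W, hWm, hWe⟩ := ih _ hlt q rfl
      refine ⟨W, fun _ => ⟨?_, fun R Λ h => by rw [hWe R Λ h]⟩⟩
      have := Submodule.smul_mem _ (p j : ℝ)
        (mul_mem_diagramSpan (i := i) (j := j) (Ne.symm hij) hqp hWm)
      convert this using 1
      funext R
      simp only [Pi.smul_apply, smul_eq_mul]; ring
    choose W hW using hW
    refine ⟨∑ j ∈ Finset.univ.erase i, fun R => R i j * (p j * W j R),
      Submodule.sum_mem _ fun j hj => (hW j (Finset.ne_of_mem_erase hj)).1, fun R Λ h => ?_⟩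
    rw [h.rec_eq p i hi, Finset.sum_apply]
    exact Finset.sum_congr rfl fun j hj => by
      rw [(hW j (Finset.ne_of_mem_erase hj)).2 R Λ h]

/-- Restriction of a covariance matrix to the blocks of a set and its complement. -/
def blockMask (S : Finset ι) (R : ι → ι → ℝ) (i j : ι) : ℝ := if (i ∈ S ↔ j ∈ S) then R i j else 0

/-- Masking kills the terms of the recursion that pair an index of `S` with one outside, so the
recursion runs separately in the two factors. Thus a product of expectations over two blocks is the
universal polynomial at the masked matrix, without constructing independent copies. -/
lemma IsHermiteMoment.blockMask {R : ι → ι → ℝ} {Λ : (ι → ℕ) → ℝ} (h : IsHermiteMoment R Λ)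
    (S : Finset ι) :
    IsHermiteMoment (_root_.blockMask S R) fun p =>
      Λ (fun i => if i ∈ S then p i else 0) * Λ (fun i => if i ∈ S then 0 else p i) where
  zero := by
    have : (fun i : ι => if i ∈ S then (0 : ι → ℕ) i else 0) = 0 := by ext; simp
    have h' : (fun i : ι => if i ∈ S then 0 else (0 : ι → ℕ) i) = 0 := by ext; simp
    simp only [this, h', h.zero, mul_one]
  rec_eq p i hi := by
    by_cases hiS : i ∈ S
    · rw [h.rec_eq (fun i => if i ∈ S then p i else 0) i (by simpa [hiS] using hi), Finset.sum_mul]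
      refine Finset.sum_congr rfl fun j hj => ?_
      have hji : j ≠ i := Finset.ne_of_mem_erase hj
      by_cases hjS : j ∈ S
      · have e1 : (fun k => if k ∈ S then (p - Pi.single i 1 - Pi.single j 1 : ι → ℕ) k else 0) =
            (fun k => if k ∈ S then p k else 0) - Pi.single i 1 - Pi.single j 1 := by
          funext k
          by_cases hk : k ∈ S
          · simp [hk]
          · have h1 : k ≠ i := fun h => hk (h ▸ hiS)
            simp [hk, h1]
        have e2 : (fun k => if k ∈ S then 0 else (p - Pi.single i 1 - Pi.single j 1 : ι → ℕ) k) =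
            fun k => if k ∈ S then 0 else p k := by
          funext k
          by_cases hk : k ∈ S
          · simp [hk]
          · have h1 : k ≠ i := fun h => hk (h ▸ hiS)
            have h2 : k ≠ j := fun h => hk (h ▸ hjS)
            simp [hk, h1, h2]
        simp only [e1, e2, _root_.blockMask, hiS, hjS, if_true]
        ring
      · simp [_root_.blockMask, hiS, hjS]
    · rw [h.rec_eq (fun i => if i ∈ S then 0 else p i) i (by simpa [hiS] using hi), Finset.mul_sum]
      refine Finset.sum_congr rfl fun j hj => ?_
      have hji : j ≠ i := Finset.ne_of_mem_erase hj
      by_cases hjS : j ∈ S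
      · simp [_root_.blockMask, hiS, hjS]
      · have e1 : (fun k => if k ∈ S then 0 else (p - Pi.single i 1 - Pi.single j 1 : ι → ℕ) k) =
            (fun k => if k ∈ S then 0 else p k) - Pi.single i 1 - Pi.single j 1 := by
          funext k
          by_cases hk : k ∈ S <;> simp [hk]
        have e2 : (fun k => if k ∈ S then (p - Pi.single i 1 - Pi.single j 1 : ι → ℕ) k else 0) =
            fun k => if k ∈ S then p k else 0 := by
          funext k
          by_cases hk : k ∈ S
          · have h1 : k ≠ i := fun h => hiS (h ▸ hk)
            have h2 : k ≠ j := fun h => hjS (h ▸ hk)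
            simp [hk, h1, h2]
          · simp [hk]
        simp only [e1, e2, _root_.blockMask, hiS, hjS, if_false]
        simp only [if_true]
        ring

end Diagrams

/-- Moments of Hermite polynomials of a standard Gaussian field satisfy the Hermite recursion. -/
lemma IsStdGaussianField.isHermiteMoment {T Ω : Type*} [MeasurableSpace T] [MeasurableSpace Ω]
    {P : Measure Ω} [IsProbabilityMeasure P] {Y : T → Ω → ℝ} (hY : IsStdGaussianField Y P)
    {ι : Type*} [Fintype ι] [DecidableEq ι] (a : ι → T) :
    IsHermiteMoment (fun i j => covKernel Y P (a i) (a j))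
      fun p => ∫ ω, ∏ i, (realHermite (p i)).eval (Y (a i) ω) ∂P where
  zero := by simp
  rec_eq p i hi := by
    obtain ⟨m, hm⟩ : ∃ m, p i = m + 1 := ⟨p i - 1, by omega⟩
    have := hY.integral_mul_prod_eq (a i) (realHermite m) (Finset.univ.erase i) a
      fun j => realHermite (p j)
    convert this using 1
    · congr 1; ext ω
      rw [← Finset.mul_prod_erase _ _ (Finset.mem_univ i), hm, realHermite.succ]
      simp
    · refine Finset.sum_congr rfl fun j hj => ?_
      have hji : j ≠ i := Finset.ne_of_mem_erase hj
      congr 1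
      rw [← integral_const_mul]
      congr 1; ext ω
      rw [← Finset.mul_prod_erase _ _ (Finset.mem_univ i), ← Finset.mul_prod_erase _ _ hj,
        realHermite.derivative_eq]
      have h1 : (p - Pi.single i 1 - Pi.single j 1 : ι → ℕ) i = m := by simp [hm, hji.symm]
      have h2 : (p - Pi.single i 1 - Pi.single j 1 : ι → ℕ) j = p j - 1 := by simp [hji]
      rw [h1, h2]
      have h3 : ∀ l ∈ (Finset.univ.erase i).erase j, (p - Pi.single i 1 - Pi.single j 1 : ι → ℕ) l = p l := by
        intro l hl
        simp only [Finset.mem_erase, Finset.mem_univ, and_true] at hl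
        simp [hl.1, hl.2]
      rw [Finset.prod_congr rfl fun l hl => by rw [h3 l hl]]
      simp only [Polynomial.eval_mul, Polynomial.eval_natCast]
      ring

/-! ### Bounding connected diagrams on four vertices by spanning trees. -/

/-- Weight of a spanning tree of four vertices, listed in the order in which the tree grows: the
second is joined to the first, the third to the second, and the last to `e`. -/
def treeWeight (k l m : ℕ) (u : Fin 4 → Fin 4 → ℝ) (π : Equiv.Perm (Fin 4)) (e : Fin 4) : ℝ :=
  u (π 0) (π 1) ^ k * u (π 1) (π 2) ^ l * u (π 3) (π e) ^ m

/-- Sum of the weights of spanning trees of four vertices with edge exponents `K`, `K - 1`, `1`. -/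
def treeSum (K : ℕ) (u : Fin 4 → Fin 4 → ℝ) : ℝ :=
  ∑ π : Equiv.Perm (Fin 4), ∑ e ∈ ({0, 1, 2} : Finset (Fin 4)),
    (treeWeight K (K - 1) 1 u π e + treeWeight K 1 (K - 1) u π e)

lemma treeWeight_nonneg {k l m : ℕ} {u : Fin 4 → Fin 4 → ℝ} (hu : ∀ i j, 0 ≤ u i j)
    (π : Equiv.Perm (Fin 4)) (e : Fin 4) : 0 ≤ treeWeight k l m u π e :=
  mul_nonneg (mul_nonneg (pow_nonneg (hu _ _) _) (pow_nonneg (hu _ _) _)) (pow_nonneg (hu _ _) _)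

lemma treeSum_nonneg {K : ℕ} {u : Fin 4 → Fin 4 → ℝ} (hu : ∀ i j, 0 ≤ u i j) : 0 ≤ treeSum K u :=
  Finset.sum_nonneg fun _ _ => Finset.sum_nonneg fun _ _ =>
    add_nonneg (treeWeight_nonneg hu _ _) (treeWeight_nonneg hu _ _)

/-- Moving an exponent from a smaller base to a larger one increases the product, and surplus powers
of x can be dropped as x ≤ 1. Hence only the tail sums of the exponents need comparison. -/
lemma pow_mul_pow_mul_pow_le {x y z : ℝ} (hz : 0 ≤ z) (hzy : z ≤ y) (hyx : y ≤ x) (hx : x ≤ 1)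
    {α β γ A B C : ℕ} (h1 : C ≤ γ) (h2 : B + C ≤ β + γ) (h3 : A + B + C ≤ α + β + γ) :
    x ^ α * y ^ β * z ^ γ ≤ x ^ A * y ^ B * z ^ C := by
  have hy : 0 ≤ y := hz.trans hzy
  have hx0 : 0 ≤ x := hy.trans hyx
  calc x ^ α * y ^ β * z ^ γ = x ^ α * y ^ β * z ^ (γ - C) * z ^ C := by
        rw [mul_assoc _ (z ^ (γ - C)), ← pow_add]; congr 2; omega
    _ ≤ x ^ α * y ^ β * y ^ (γ - C) * z ^ C := by gcongr
    _ = x ^ α * y ^ (β + (γ - C) - B) * y ^ B * z ^ C := by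
        rw [mul_assoc _ (y ^ β), ← pow_add, mul_assoc _ (y ^ (β + (γ - C) - B)), ← pow_add]
        congr 3; omega
    _ ≤ x ^ α * x ^ (β + (γ - C) - B) * y ^ B * z ^ C := by gcongr
    _ = x ^ (α + (β + (γ - C) - B)) * y ^ B * z ^ C := by rw [← pow_add]
    _ ≤ x ^ A * y ^ B * z ^ C := by
        have := pow_le_pow_of_le_one hx0 hx (m := A) (n := α + (β + (γ - C) - B)) (by omega)
        gcongr

lemma diagramMonomial_comp_perm {ι : Type*} [Fintype ι] [DecidableEq ι] (n : ι → ι → ℕ)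
    (u : ι → ι → ℝ) (π : Equiv.Perm ι) :
    diagramMonomial n u =
      diagramMonomial (fun i j => n (π i) (π j)) (fun i j => u (π i) (π j)) := by
  simp only [diagramMonomial]
  rw [← Equiv.prod_comp π]
  exact Finset.prod_congr rfl fun i _ => (Equiv.prod_comp π fun j => u (π i) j ^ n (π i) j).symm

/-- Bound of a diagram by a tree when the vertices are listed in the order of Prim's algorithm. -/
lemma diagramMonomial_le_of_sorted {K : ℕ} (hK : 1 ≤ K) {u : Fin 4 → Fin 4 → ℝ}
    (hu0 : ∀ i j, 0 ≤ u i j) (hu1 : ∀ i j, u i j ≤ 1) (hsymm : ∀ i j, u i j = u j i)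
    {n : Fin 4 → Fin 4 → ℕ} (hn : ∀ i, n i i = 0) (hdeg : ∀ i, K ≤ diagramDegree n i)
    (hcut : 1 ≤ n 0 2 + n 2 0 + n 0 3 + n 3 0 + n 1 2 + n 2 1 + n 1 3 + n 3 1)
    (hmax : ∀ i j, i ≠ j → u i j ≤ u 0 1)
    (h02 : u 0 2 ≤ u 1 2) (h03 : u 0 3 ≤ u 1 2) (h13 : u 1 3 ≤ u 1 2) :
    ∃ e ∈ ({0, 1, 2} : Finset (Fin 4)),
      diagramMonomial n u ≤ u 0 1 ^ K * u 1 2 ^ (K - 1) * u 3 e ^ 1 ∨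
      diagramMonomial n u ≤ u 0 1 ^ K * u 1 2 ^ 1 * u 3 e ^ (K - 1) := by
  have hd0 := hdeg 0
  have hd1 := hdeg 1
  have hd2 := hdeg 2
  have hd3 := hdeg 3
  simp only [diagramDegree, Fin.sum_univ_four, hn] at hd0 hd1 hd2 hd3
  have hmono : diagramMonomial n u = u 0 1 ^ (n 0 1 + n 1 0) * u 0 2 ^ (n 0 2 + n 2 0) *
      u 1 2 ^ (n 1 2 + n 2 1) * u 3 0 ^ (n 0 3 + n 3 0) * u 3 1 ^ (n 1 3 + n 3 1) *
      u 3 2 ^ (n 2 3 + n 3 2) := by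
    simp only [diagramMonomial, Fin.prod_univ_four, hn, pow_zero, pow_add]
    rw [hsymm 1 0, hsymm 2 0, hsymm 2 1, hsymm 0 3, hsymm 1 3, hsymm 2 3]
    ring
  obtain ⟨e, he, hemax⟩ := Finset.exists_max_image ({0, 1, 2} : Finset (Fin 4)) (u 3) (by simp)
  have he0 := hemax 0 (by simp)
  have he1 := hemax 1 (by simp)
  have he2 := hemax 2 (by simp)
  have hue : u 3 e ≤ u 0 1 := hmax 3 e (by rintro rfl; simp at he)
  have h12 : u 1 2 ≤ u 0 1 := hmax 1 2 (by simp)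
  refine ⟨e, he, ?_⟩
  rw [hmono]
  have p0 := hu0 0 1
  have p1 := hu0 0 2
  have p2 := hu0 1 2
  have p3 := hu0 3 0
  have p4 := hu0 3 1
  have p5 := hu0 3 2
  have p6 := hu0 3 e
  -- All edges are charged to the three tree edges. The tail sums come from the degrees: the total
  -- is at least 2K (half the sum of four degrees), and the two lighter tree edges absorb all edges
  -- at vertex 2 or 3, at least K. The lightest needs exponent 1: in the first case it carries all
  -- edges at vertex 3, in the second the edges of the cut between {0,1} and {2,3}.
  rcases le_total (u 3 e) (u 1 2) with h | h
  · left
    calc _ ≤ u 0 1 ^ (n 0 1 + n 1 0) * u 1 2 ^ (n 0 2 + n 2 0) *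
          u 1 2 ^ (n 1 2 + n 2 1) * u 3 e ^ (n 0 3 + n 3 0) * u 3 e ^ (n 1 3 + n 3 1) *
          u 3 e ^ (n 2 3 + n 3 2) := by gcongr
      _ = u 0 1 ^ (n 0 1 + n 1 0) * u 1 2 ^ (n 0 2 + n 2 0 + (n 1 2 + n 2 1)) *
          u 3 e ^ (n 0 3 + n 3 0 + (n 1 3 + n 3 1) + (n 2 3 + n 3 2)) := by
          simp only [pow_add]; ring
      _ ≤ _ := pow_mul_pow_mul_pow_le (hu0 _ _) h h12 (hu1 _ _) (by omega) (by omega) (by omega)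
  · right
    have h30 : u 3 0 ≤ u 1 2 := by rw [← hsymm]; exact h03
    have h31 : u 3 1 ≤ u 1 2 := by rw [← hsymm]; exact h13
    calc _ ≤ u 0 1 ^ (n 0 1 + n 1 0) * u 1 2 ^ (n 0 2 + n 2 0) *
          u 1 2 ^ (n 1 2 + n 2 1) * u 1 2 ^ (n 0 3 + n 3 0) * u 1 2 ^ (n 1 3 + n 3 1) *
          u 3 e ^ (n 2 3 + n 3 2) := by gcongr
      _ = u 0 1 ^ (n 0 1 + n 1 0) * u 3 e ^ (n 2 3 + n 3 2) *
          u 1 2 ^ (n 0 2 + n 2 0 + (n 1 2 + n 2 1) + (n 0 3 + n 3 0) + (n 1 3 + n 3 1)) := by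
          simp only [pow_add]; ring
      _ ≤ u 0 1 ^ K * u 3 e ^ (K - 1) * u 1 2 ^ 1 :=
          pow_mul_pow_mul_pow_le (hu0 _ _) h hue (hu1 _ _) (by omega) (by omega) (by omega)
      _ = _ := by ring

lemma exists_perm_fin_four : ∀ a b : Fin 4, a ≠ b → ∃ π : Equiv.Perm (Fin 4), π 0 = a ∧ π 1 = b := by
  intro a b hab
  refine ⟨Equiv.swap 0 a * Equiv.swap 1 (Equiv.swap 0 a b), ?_, ?_⟩
  · revert a b; decide
  · revert a b; decide

/-- A connected diagram on four vertices of degrees at least `K` is bounded by the tree sum. -/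
lemma diagramMonomial_le_treeSum {K : ℕ} (hK : 1 ≤ K) {u : Fin 4 → Fin 4 → ℝ}
    (hu0 : ∀ i j, 0 ≤ u i j) (hu1 : ∀ i j, u i j ≤ 1) (hsymm : ∀ i j, u i j = u j i)
    {n : Fin 4 → Fin 4 → ℕ} (hn : ∀ i, n i i = 0) (hdeg : ∀ i, K ≤ diagramDegree n i)
    (h01 : 1 ≤ n 0 1 + n 1 0) (h23 : 1 ≤ n 2 3 + n 3 2)
    (hcut : 1 ≤ n 0 2 + n 2 0 + n 0 3 + n 3 0 + n 1 2 + n 2 1 + n 1 3 + n 3 1) :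
    diagramMonomial n u ≤ treeSum K u := by
  -- Relabelling may move the pair {0,1} anywhere, so every cut into two pairs must be crossed. The
  -- cuts other than {0,1} against {2,3} are crossed by the edges joining 0 to 1 and 2 to 3.
  have hcut' : ∀ a b c d : Fin 4, a ≠ b → a ≠ c → a ≠ d → b ≠ c → b ≠ d → c ≠ d →
      1 ≤ n a c + n c a + n a d + n d a + n b c + n c b + n b d + n d b := by
    intro a b c d
    fin_cases a <;> fin_cases b <;> try exact fun h => absurd rfl h
    all_goals fin_cases c <;> try exact fun _ h => absurd rfl h
    all_goals try exact fun _ _ _ h => absurd rfl h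
    all_goals fin_cases d <;> try exact fun _ _ h => absurd rfl h
    all_goals try exact fun _ _ _ _ h => absurd rfl h
    all_goals try exact fun _ _ _ _ _ h => absurd rfl h
    all_goals intros; simp only [Fin.zero_eta, Fin.mk_one, Fin.reduceFinMk]; omega
  obtain ⟨⟨a, b⟩, hab, hmax⟩ := Finset.exists_max_image
    (Finset.univ.filter fun q : Fin 4 × Fin 4 => q.1 ≠ q.2) (fun q => u q.1 q.2) ⟨(0, 1), by simp⟩
  simp only [Finset.mem_filter, Finset.mem_univ, true_and] at hab hmax
  obtain ⟨π, rfl, rfl⟩ := exists_perm_fin_four a b hab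
  have hinj : ∀ (π : Equiv.Perm (Fin 4)) {i j : Fin 4}, i ≠ j → π i ≠ π j := fun π i j h =>
    π.injective.ne h
  have main : ∀ π : Equiv.Perm (Fin 4), (∀ q : Fin 4 × Fin 4, q.1 ≠ q.2 → u q.1 q.2 ≤ u (π 0) (π 1)) →
      u (π 0) (π 2) ≤ u (π 1) (π 2) → u (π 0) (π 3) ≤ u (π 1) (π 2) →
      u (π 1) (π 3) ≤ u (π 1) (π 2) → diagramMonomial n u ≤ treeSum K u := by
    intro π hm h1 h2 h3
    have hdeg' : ∀ i, K ≤ diagramDegree (fun i j => n (π i) (π j)) i := fun i => by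
      refine (hdeg (π i)).trans_eq ?_
      simp only [diagramDegree]
      exact (Equiv.sum_comp π fun j => n (π i) j + n j (π i)).symm
    obtain ⟨e, he, h⟩ := diagramMonomial_le_of_sorted hK (u := fun i j => u (π i) (π j))
      (fun _ _ => hu0 _ _) (fun _ _ => hu1 _ _) (fun _ _ => hsymm _ _)
      (n := fun i j => n (π i) (π j)) (fun _ => hn _) hdeg'
      (hcut' _ _ _ _ (hinj π (by decide)) (hinj π (by decide)) (hinj π (by decide))
        (hinj π (by decide)) (hinj π (by decide)) (hinj π (by decide)))
      (fun i j hij => hm (π i, π j) (hinj π hij)) h1 h2 h3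
    rw [← diagramMonomial_comp_perm] at h
    have hle : treeWeight K (K - 1) 1 u π e + treeWeight K 1 (K - 1) u π e ≤ treeSum K u := by
      have h1 := Finset.single_le_sum (f := fun e =>
        treeWeight K (K - 1) 1 u π e + treeWeight K 1 (K - 1) u π e) (fun e _ =>
          add_nonneg (treeWeight_nonneg hu0 π e) (treeWeight_nonneg hu0 π e)) he
      have h2 := Finset.single_le_sum (f := fun π => ∑ e ∈ ({0, 1, 2} : Finset (Fin 4)),
        (treeWeight K (K - 1) 1 u π e + treeWeight K 1 (K - 1) u π e)) (fun π _ =>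
          Finset.sum_nonneg fun e _ =>
          add_nonneg (treeWeight_nonneg hu0 π e) (treeWeight_nonneg hu0 π e)) (Finset.mem_univ π)
      exact h1.trans h2
    have p1 := treeWeight_nonneg (k := K) (l := K - 1) (m := 1) hu0 π e
    have p2 := treeWeight_nonneg (k := K) (l := 1) (m := K - 1) hu0 π e
    rcases h with h | h
    · exact h.trans (by simp only [treeWeight] at *; linarith)
    · exact h.trans (by simp only [treeWeight] at *; linarith)
  have hs : ∀ q : Fin 4 × Fin 4, q.1 ≠ q.2 → u q.1 q.2 ≤ u (π 1) (π 0) := fun q hq => by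
    rw [hsymm (π 1)]; exact hmax q hq
  -- After the heaviest edge, Prim's algorithm takes the heaviest of the four edges leaving it.
  -- Exchanging 0 with 1 and 2 with 3 brings that edge into position (1, 2).
  rcases le_total (u (π 0) (π 2)) (u (π 1) (π 2)) with A | A <;>
  rcases le_total (u (π 0) (π 3)) (u (π 1) (π 3)) with B | B
  · rcases le_total (u (π 1) (π 2)) (u (π 1) (π 3)) with C | C
    · exact main (π * Equiv.swap 2 3) hmax B (A.trans C) C
    · exact main π hmax A (B.trans C) C
  · rcases le_total (u (π 1) (π 2)) (u (π 0) (π 3)) with C | C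
    · exact main (π * (Equiv.swap 0 1 * Equiv.swap 2 3)) hs B C (A.trans C)
    · exact main π hmax A C (B.trans C)
  · rcases le_total (u (π 0) (π 2)) (u (π 1) (π 3)) with C | C
    · exact main (π * Equiv.swap 2 3) hmax B C (A.trans C)
    · exact main (π * Equiv.swap 0 1) hs A C (B.trans C)
  · rcases le_total (u (π 0) (π 2)) (u (π 0) (π 3)) with C | C
    · exact main (π * (Equiv.swap 0 1 * Equiv.swap 2 3)) hs B (A.trans C) C
    · exact main (π * Equiv.swap 0 1) hs A (B.trans C) C

/-- Elements of the diagram span vary little when the entries between the blocks `{0, 1}` and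
`{2, 3}` are put to zero. -/
lemma exists_abs_sub_blockMask_le {K : ℕ} (hK : 1 ≤ K) {p : Fin 4 → ℕ} (hp : ∀ i, K ≤ p i + 1)
    {W : (Fin 4 → Fin 4 → ℝ) → ℝ} (hW : W ∈ diagramSpan p) :
    ∃ C : ℝ, 0 ≤ C ∧ ∀ R : Fin 4 → Fin 4 → ℝ, (∀ i j, R i j = R j i) → (∀ i j, |R i j| ≤ 1) →
      |R 0 1 * R 2 3 * (W R - W (blockMask {0, 1} R))| ≤ C * treeSum K (fun i j => |R i j|) := by
  induction hW using Submodule.span_induction with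
  | mem m hm =>
    obtain ⟨n, h0, hd, rfl⟩ := hm
    refine ⟨1, zero_le_one, fun R hs h1 => ?_⟩
    have habs : ∀ n : Fin 4 → Fin 4 → ℕ,
        |diagramMonomial n R| = diagramMonomial n fun i j => |R i j| := fun n => by
      simp [diagramMonomial, Finset.abs_prod]
    have hT : 0 ≤ treeSum K fun i j => |R i j| := treeSum_nonneg fun _ _ => abs_nonneg _
    rw [one_mul]
    -- Without an edge across the cut masking changes nothing and the difference is zero; with one,
    -- the masked monomial vanishes and the other is a connected diagram.
    by_cases hc : n 0 2 + n 2 0 + n 0 3 + n 3 0 + n 1 2 + n 2 1 + n 1 3 + n 3 1 = 0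
    · have : diagramMonomial n (blockMask {0, 1} R) = diagramMonomial n R := by
        have e1 : n 0 2 = 0 := by omega
        have e2 : n 2 0 = 0 := by omega
        have e3 : n 0 3 = 0 := by omega
        have e4 : n 3 0 = 0 := by omega
        have e5 : n 1 2 = 0 := by omega
        have e6 : n 2 1 = 0 := by omega
        have e7 : n 1 3 = 0 := by omega
        have e8 : n 3 1 = 0 := by omega
        simp [diagramMonomial, Fin.prod_univ_four, blockMask, e1, e2, e3, e4, e5, e6, e7, e8]
      rw [this, sub_self, mul_zero, abs_zero]
      exact hT
    · have hz : diagramMonomial n (blockMask {0, 1} R) = 0 := by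
        simp only [diagramMonomial, Fin.prod_univ_four, blockMask]
        have : n 0 2 ≠ 0 ∨ n 2 0 ≠ 0 ∨ n 0 3 ≠ 0 ∨ n 3 0 ≠ 0 ∨ n 1 2 ≠ 0 ∨ n 2 1 ≠ 0 ∨
          n 1 3 ≠ 0 ∨ n 3 1 ≠ 0 := by omega
        rcases this with h | h | h | h | h | h | h | h <;> simp [h]
      -- The prefactor adds the edges joining 0 to 1 and 2 to 3. This raises every degree by one,
      -- from at least K - 1 to at least K.
      let n' : Fin 4 → Fin 4 → ℕ := fun i j =>
        n i j + (if i = 0 ∧ j = 1 then 1 else 0) + (if i = 2 ∧ j = 3 then 1 else 0)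
      have e : R 0 1 * R 2 3 * diagramMonomial n R = diagramMonomial n' R := by
        simp only [diagramMonomial, Fin.prod_univ_four, n']
        simp [pow_succ]
        ring
      rw [hz, sub_zero, e, habs]
      have hdeg : ∀ i, diagramDegree n' i = p i + 1 := by
        intro i
        rw [← hd i]
        fin_cases i <;> simp [diagramDegree, Fin.sum_univ_four, n'] <;> ring
      refine diagramMonomial_le_treeSum hK (fun _ _ => abs_nonneg _) (fun _ _ => h1 _ _)
        (fun i j => by rw [hs]) (fun i => ?_) (fun i => (hp i).trans_eq (hdeg i).symm) ?_ ?_ ?_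
      · fin_cases i <;> simp [n', h0]
      · simp [n']; omega
      · simp [n']; omega
      · simp [n']; omega
  | zero => exact ⟨0, le_rfl, fun R _ _ => by simp⟩
  | add f g _ _ hf hg =>
    obtain ⟨C1, h1, hf⟩ := hf
    obtain ⟨C2, h2, hg⟩ := hg
    refine ⟨C1 + C2, add_nonneg h1 h2, fun R hs h => ?_⟩
    have e : R 0 1 * R 2 3 * ((f + g) R - (f + g) (blockMask {0, 1} R)) =
      R 0 1 * R 2 3 * (f R - f (blockMask {0, 1} R)) +
      R 0 1 * R 2 3 * (g R - g (blockMask {0, 1} R)) := by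
      simp only [Pi.add_apply]; ring
    rw [e, add_mul]
    exact (abs_add_le _ _).trans (add_le_add (hf R hs h) (hg R hs h))
  | smul c f _ hf =>
    obtain ⟨C1, h1, hf⟩ := hf
    refine ⟨|c| * C1, mul_nonneg (abs_nonneg _) h1, fun R hs h => ?_⟩
    have e : R 0 1 * R 2 3 * ((c • f) R - (c • f) (blockMask {0, 1} R)) =
      c * (R 0 1 * R 2 3 * (f R - f (blockMask {0, 1} R))) := by
      simp only [Pi.smul_apply, smul_eq_mul]; ring
    rw [e, abs_mul, mul_assoc |c|]
    exact mul_le_mul_of_nonneg_left (hf R hs h) (abs_nonneg _)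

/-! ### Integrating tree weights over four points. -/

section TreeIntegral

variable {T : Type*} [MeasurableSpace T] {μ : Measure T} [IsFiniteMeasure μ]

/-- Four points as a family indexed by `Fin 4`. -/
def fourPoints (q : (T × T) × (T × T)) : Fin 4 → T := ![q.1.1, q.1.2, q.2.1, q.2.2]

lemma measurable_fourPoints : Measurable (fourPoints : (T × T) × (T × T) → Fin 4 → T) := by
  refine measurable_pi_lambda _ fun i => ?_
  fin_cases i <;> simp [fourPoints] <;> fun_prop

lemma measurePreserving_fourPoints :
    MeasurePreserving fourPoints ((μ.prod μ).prod (μ.prod μ)) (Measure.pi fun _ : Fin 4 => μ) := by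
  refine ⟨measurable_fourPoints, (Measure.pi_eq fun s hs => ?_).symm⟩
  rw [Measure.map_apply measurable_fourPoints (MeasurableSet.univ_pi hs)]
  have : fourPoints ⁻¹' Set.univ.pi s = (s 0 ×ˢ s 1) ×ˢ (s 2 ×ˢ s 3) := by
    ext q
    simp [fourPoints, Set.mem_pi, Fin.forall_fin_succ]
    tauto
  rw [this, Measure.prod_prod, Measure.prod_prod, Measure.prod_prod, Fin.prod_univ_four]
  ring

lemma measurePreserving_comp_perm {ι : Type*} [Fintype ι] (π : Equiv.Perm ι) :
    MeasurePreserving (fun v : ι → T => v ∘ π) (Measure.pi fun _ => μ) (Measure.pi fun _ => μ) := by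
  have hm : Measurable fun v : ι → T => v ∘ π := measurable_pi_lambda _ fun i => by
    simpa using measurable_pi_apply (π i)
  refine ⟨hm, (Measure.pi_eq fun s hs => ?_).symm⟩
  rw [Measure.map_apply hm (MeasurableSet.univ_pi hs)]
  have : (fun v : ι → T => v ∘ π) ⁻¹' Set.univ.pi s = Set.univ.pi fun i => s (π.symm i) := by
    ext v
    simp only [Set.mem_preimage, Set.mem_pi, Set.mem_univ, true_imp_iff, Function.comp]
    exact ⟨fun h i => by simpa using h (π.symm i), fun h i => by simpa using h (π i)⟩
  rw [this, Measure.pi_pi]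
  exact Equiv.prod_comp π.symm fun i => μ (s i)

variable {u : T → T → ℝ}

lemma integrable_of_measurable_comp_pow
    (hu : Measurable fun q : T × T => u q.1 q.2) (hu0 : ∀ x y, 0 ≤ u x y) (hu1 : ∀ x y, u x y ≤ 1)
    {S : Type*} [MeasurableSpace S] {Q : Measure S}
    [IsFiniteMeasure Q] {φ ψ : S → T} (hφ : Measurable φ) (hψ : Measurable ψ) (k : ℕ) :
    MemAllLp (fun s => u (φ s) (ψ s) ^ k) Q :=
  MemAllLp.of_bound ((hu.comp (hφ.prodMk hψ)).pow_const k) 1 fun s => by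
    rw [abs_of_nonneg (pow_nonneg (hu0 _ _) _)]
    exact pow_le_one₀ (hu0 _ _) (hu1 _ _)

/-- A tree is integrated leaf by leaf: after a permutation of the variables, vertex 3 occurs only in
its edge to `e`, and then vertex 2 only in its edge to 1. Each leaf costs a uniform bound on a
one-variable integral, and the root edge leaves the double integral. -/
lemma integral_treeWeight_le
    (hu : Measurable fun q : T × T => u q.1 q.2) (hu0 : ∀ x y, 0 ≤ u x y) (hu1 : ∀ x y, u x y ≤ 1)
    (hsymm : ∀ x y, u x y = u y x) {k l m : ℕ} {Ml Mm : ℝ}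
    (hl : ∀ x, ∫ y, u x y ^ l ∂μ ≤ Ml) (hm : ∀ x, ∫ y, u x y ^ m ∂μ ≤ Mm) (hMm : 0 ≤ Mm)
    (π : Equiv.Perm (Fin 4)) {e : Fin 4} (he : e ∈ ({0, 1, 2} : Finset (Fin 4))) :
    ∫ q, treeWeight k l m (fun i j => u (fourPoints q i) (fourPoints q j)) π e
        ∂((μ.prod μ).prod (μ.prod μ)) ≤
      (∫ q, u q.1 q.2 ^ k ∂(μ.prod μ)) * Ml * Mm := by
  let f : (Fin 4 → T) → ℝ := fun v => u (v 0) (v 1) ^ k * u (v 1) (v 2) ^ l * u (v 3) (v e) ^ m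
  have hpt : ∀ i j k, Measurable fun v : Fin 4 → T => u (v i) (v j) ^ k := fun i j k =>
    (hu.comp (f := fun v : Fin 4 → T => (v i, v j))
      ((measurable_pi_apply i).prodMk (measurable_pi_apply j))).pow_const k
  have hf : Measurable f := ((hpt _ _ _).mul (hpt _ _ _)).mul (hpt _ _ _)
  have e1 : ∫ q, treeWeight k l m (fun i j => u (fourPoints q i) (fourPoints q j)) π e
        ∂((μ.prod μ).prod (μ.prod μ)) = ∫ q, f (fourPoints q) ∂((μ.prod μ).prod (μ.prod μ)) := by
    have h1 := integral_map (measurable_fourPoints.aemeasurable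
      (μ := (μ.prod μ).prod (μ.prod μ))) hf.aestronglyMeasurable
    have hmp := (measurePreserving_comp_perm (μ := μ) π)
    have hf' : Measurable fun v : Fin 4 → T => f (v ∘ π) := hf.comp hmp.measurable
    have h2 := integral_map (measurable_fourPoints.aemeasurable
      (μ := (μ.prod μ).prod (μ.prod μ))) hf'.aestronglyMeasurable
    have h3 := integral_map (hmp.measurable.aemeasurable (μ := Measure.pi fun _ : Fin 4 => μ))
      (f := f) hf.aestronglyMeasurable
    rw [measurePreserving_fourPoints.map_eq] at h1 h2
    rw [hmp.map_eq] at h3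
    rw [← h1, h3, h2]
    rfl
  rw [e1]
  have hI : ∀ {S : Type _} [MeasurableSpace S] {Q : Measure S} [IsFiniteMeasure Q] {φ ψ : S → T},
      Measurable φ → Measurable ψ → ∀ k, MemAllLp (fun s => u (φ s) (ψ s) ^ k) Q :=
    fun hφ hψ k => integrable_of_measurable_comp_pow hu hu0 hu1 hφ hψ k
  have hsel : ∀ q : T × T, Measurable fun r : T × T => fourPoints (q, r) e := fun q =>
    (measurable_pi_apply e).comp (measurable_fourPoints.comp measurable_prodMk_left)
  -- Since `e` is not the last vertex, its position does not move while the last point is integrated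
  -- out.
  have hindep : ∀ (q : T × T) (z w w' : T), fourPoints (q, (z, w)) e = fourPoints (q, (z, w')) e := by
    intro q z w w'
    fin_cases he <;> simp [fourPoints]
  have hfi : Integrable (fun q : (T × T) × (T × T) => f (fourPoints q))
      ((μ.prod μ).prod (μ.prod μ)) := by
    have := fun i => (measurable_pi_apply (X := fun _ : Fin 4 => T) i).comp measurable_fourPoints
    exact (((hI (this 0) (this 1) k).mul (hI (this 1) (this 2) l)).mul
      (hI (this 3) (this e) m)).integrable
  rw [integral_prod _ hfi, mul_assoc, ← integral_mul_const]
  have hk : ∀ x y, 0 ≤ u x y ^ k := fun x y => pow_nonneg (hu0 _ _) _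
  refine integral_mono hfi.integral_prod_left
    ((hI measurable_fst measurable_snd k).integrable.mul_const _) fun q => ?_
  have hsec : Integrable (fun r : T × T => f (fourPoints (q, r))) (μ.prod μ) := by
    have h3 : Measurable fun r : T × T => fourPoints (q, r) 3 :=
      (measurable_pi_apply 3).comp (measurable_fourPoints.comp measurable_prodMk_left)
    exact (((MemAllLp.const (u q.1 q.2 ^ k)).mul (hI (measurable_const (a := q.2)) measurable_fst l)).mul
      (hI h3 (hsel q) m)).integrable
  dsimp only
  rw [integral_prod _ hsec]
  calc ∫ z, ∫ w, f (fourPoints (q, (z, w))) ∂μ ∂μ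
      ≤ ∫ z, u q.1 q.2 ^ k * u q.2 z ^ l * Mm ∂μ := by
        refine integral_mono hsec.integral_prod_left
          (((hI measurable_const measurable_id l).integrable.const_mul _).mul_const _) fun z => ?_
        have e2 : ∀ w, f (fourPoints (q, (z, w))) =
            u q.1 q.2 ^ k * u q.2 z ^ l * u (fourPoints (q, (z, z)) e) w ^ m := fun w => by
          simp only [f]
          rw [hsymm (fourPoints (q, (z, w)) 3), hindep q z w z]
          rfl
        simp only [e2]
        rw [integral_const_mul]
        exact mul_le_mul_of_nonneg_left (hm _) (mul_nonneg (hk _ _) (pow_nonneg (hu0 _ _) _))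
    _ = u q.1 q.2 ^ k * ((∫ z, u q.2 z ^ l ∂μ) * Mm) := by
        rw [integral_mul_const, integral_const_mul]; ring
    _ ≤ _ := by
        refine mul_le_mul_of_nonneg_left ?_ (hk _ _)
        exact mul_le_mul_of_nonneg_right (hl _) hMm

lemma integrable_treeWeight
    (hu : Measurable fun q : T × T => u q.1 q.2) (hu0 : ∀ x y, 0 ≤ u x y) (hu1 : ∀ x y, u x y ≤ 1)
    (k l m : ℕ) (π : Equiv.Perm (Fin 4)) (e : Fin 4) :
    Integrable (fun q => treeWeight k l m (fun i j => u (fourPoints q i) (fourPoints q j)) π e)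
      ((μ.prod μ).prod (μ.prod μ)) := by
  have := fun i => (measurable_pi_apply (X := fun _ : Fin 4 => T) i).comp measurable_fourPoints
  exact (((integrable_of_measurable_comp_pow hu hu0 hu1 (this (π 0)) (this (π 1)) k).mul
    (integrable_of_measurable_comp_pow hu hu0 hu1 (this (π 1)) (this (π 2)) l)).mul
    (integrable_of_measurable_comp_pow hu hu0 hu1 (this (π 3)) (this (π e)) m)).integrable

lemma integrable_treeSum
    (hu : Measurable fun q : T × T => u q.1 q.2) (hu0 : ∀ x y, 0 ≤ u x y) (hu1 : ∀ x y, u x y ≤ 1)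
    (K : ℕ) :
    Integrable (fun q => treeSum K (fun i j => u (fourPoints q i) (fourPoints q j)))
      ((μ.prod μ).prod (μ.prod μ)) :=
  integrable_finsetSum _ fun _ _ => integrable_finsetSum _ fun _ _ =>
    (integrable_treeWeight hu hu0 hu1 _ _ _ _ _).add (integrable_treeWeight hu hu0 hu1 _ _ _ _ _)

/-- Both orders of the exponents K - 1 and 1 give the same product of leaf bounds; 144 = 24 · 3 · 2
counts permutations, attachments of the last vertex and orders. -/
lemma integral_treeSum_le
    (hu : Measurable fun q : T × T => u q.1 q.2) (hu0 : ∀ x y, 0 ≤ u x y) (hu1 : ∀ x y, u x y ≤ 1)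
    (hsymm : ∀ x y, u x y = u y x) {K : ℕ} {M M' : ℝ}
    (h1 : ∀ x, ∫ y, u x y ∂μ ≤ M) (h2 : ∀ x, ∫ y, u x y ^ (K - 1) ∂μ ≤ M')
    (hM : 0 ≤ M) (hM' : 0 ≤ M') :
    ∫ q, treeSum K (fun i j => u (fourPoints q i) (fourPoints q j))
        ∂((μ.prod μ).prod (μ.prod μ)) ≤
      144 * ((∫ q, u q.1 q.2 ^ K ∂(μ.prod μ)) * (M * M')) := by
  have hi := fun k l m π e => integrable_treeWeight (μ := μ) hu hu0 hu1 k l m π e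
  have h1' : ∀ x, ∫ y, u x y ^ 1 ∂μ ≤ M := by simpa using h1
  have hadd : ∀ π e, Integrable (fun q =>
      treeWeight K (K - 1) 1 (fun i j => u (fourPoints q i) (fourPoints q j)) π e +
      treeWeight K 1 (K - 1) (fun i j => u (fourPoints q i) (fourPoints q j)) π e)
      ((μ.prod μ).prod (μ.prod μ)) := fun π e => (hi _ _ _ _ _).add (hi _ _ _ _ _)
  simp only [treeSum]
  rw [integral_finsetSum _ fun π _ => integrable_finsetSum _ fun e _ => hadd π e]
  calc _ ≤ ∑ π : Equiv.Perm (Fin 4), (6 : ℝ) * ((∫ q, u q.1 q.2 ^ K ∂(μ.prod μ)) * (M * M')) := by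
        refine Finset.sum_le_sum fun π _ => ?_
        rw [integral_finsetSum _ fun e _ => hadd π e]
        calc _ ≤ ∑ e ∈ ({0, 1, 2} : Finset (Fin 4)),
              (2 : ℝ) * ((∫ q, u q.1 q.2 ^ K ∂(μ.prod μ)) * (M * M')) := by
              refine Finset.sum_le_sum fun e he => ?_
              rw [integral_add (hi _ _ _ _ _) (hi _ _ _ _ _)]
              have a1 := integral_treeWeight_le hu hu0 hu1 hsymm (k := K) h2 h1' hM π he
              have a2 := integral_treeWeight_le hu hu0 hu1 hsymm (k := K) h1' h2 hM' π he
              linarith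
          _ = _ := by simp; ring
    _ = _ := by
        rw [Finset.sum_const, Finset.card_univ, Fintype.card_perm, Fintype.card_fin]
        simp [Nat.factorial]; ring

end TreeIntegral

/-! ### Second moments and the variance of the Stein functional. -/

section SecondMoment

variable {S Ω : Type*} [MeasurableSpace S] [MeasurableSpace Ω] {P : Measure Ω}
  [IsProbabilityMeasure P] {ν : Measure S} [IsFiniteMeasure ν] {B : S → Ω → ℝ}

/-- Second moment of the integral of a random field. -/
lemma integral_sq_integral (hB : Measurable fun p : S × Ω => B p.1 p.2)
    (h2 : ∀ s, MemLp (B s) 2 P) {C : ℝ} (hC : ∀ s, ∫ ω, B s ω ^ 2 ∂P ≤ C) :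
    ∫ ω, (∫ s, B s ω ∂ν) ^ 2 ∂P = ∫ q : S × S, ∫ ω, B q.1 ω * B q.2 ω ∂P ∂(ν.prod ν) := by
  have hm : Measurable fun p : (S × S) × Ω => B p.1.1 p.2 * B p.1.2 p.2 :=
    (hB.comp (by fun_prop : Measurable fun p : (S × S) × Ω => (p.1.1, p.2))).mul
      (hB.comp (by fun_prop : Measurable fun p : (S × S) × Ω => (p.1.2, p.2)))
  have hint : Integrable (fun p : (S × S) × Ω => B p.1.1 p.2 * B p.1.2 p.2)
      ((ν.prod ν).prod P) := by
    rw [integrable_prod_iff hm.aestronglyMeasurable]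
    refine ⟨.of_forall fun q => (h2 q.1).integrable_mul (h2 q.2), ?_⟩
    refine Integrable.of_bound (C := C) ?_ (.of_forall fun q => ?_)
    · exact (hm.norm.stronglyMeasurable.integral_prod_right (ν := P)).aestronglyMeasurable
    · rw [Real.norm_eq_abs, abs_of_nonneg (integral_nonneg fun _ => norm_nonneg _)]
      have i1 := (h2 q.1).integrable_sq
      have i2 := (h2 q.2).integrable_sq
      calc ∫ ω, ‖B q.1 ω * B q.2 ω‖ ∂P ≤ ∫ ω, (B q.1 ω ^ 2 + B q.2 ω ^ 2) / 2 ∂P := by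
            refine integral_mono ((h2 q.1).integrable_mul (h2 q.2)).norm ((i1.add i2).div_const 2)
              fun ω => ?_
            dsimp only
            rw [Real.norm_eq_abs, abs_mul]
            nlinarith [sq_nonneg (|B q.1 ω| - |B q.2 ω|), sq_abs (B q.1 ω), sq_abs (B q.2 ω)]
        _ = (∫ ω, B q.1 ω ^ 2 ∂P + ∫ ω, B q.2 ω ^ 2 ∂P) / 2 := by
            rw [integral_div, integral_add i1 i2]
        _ ≤ C := by linarith [hC q.1, hC q.2]
  rw [← integral_prod _ hint, integral_prod_symm _ hint]
  congr 1; ext ω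
  rw [sq, ← integral_prod_mul]

end SecondMoment

/-- A linear combination of Hermite polynomials. -/
noncomputable def hermiteSum (s : Finset ℕ) (a : ℕ → ℝ) : Polynomial ℝ :=
  ∑ m ∈ s, Polynomial.C (a m) * realHermite m

/-- A linear combination of Hermite polynomials with indices shifted by one. -/
noncomputable def hermiteShiftSum (s : Finset ℕ) (a : ℕ → ℝ) : Polynomial ℝ :=
  ∑ m ∈ s, Polynomial.C (a m) * realHermite (m + 1)

lemma eval_hermiteSum (s : Finset ℕ) (a : ℕ → ℝ) (x : ℝ) :
    (hermiteSum s a).eval x = ∑ m ∈ s, a m * (realHermite m).eval x := by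
  simp [hermiteSum, Polynomial.eval_finsetSum]

lemma eval_hermiteShiftSum (s : Finset ℕ) (a : ℕ → ℝ) (x : ℝ) :
    (hermiteShiftSum s a).eval x = ∑ m ∈ s, a m * (realHermite (m + 1)).eval x := by
  simp [hermiteShiftSum, Polynomial.eval_finsetSum]

/-- This is the form Xp - p' demanded by integration by parts, and the reason for indexing the
expansion by the shifted degree. -/
lemma hermiteShiftSum_eq (s : Finset ℕ) (a : ℕ → ℝ) :
    hermiteShiftSum s a =
      Polynomial.X * hermiteSum s a - Polynomial.derivative (hermiteSum s a) := by
  simp only [hermiteShiftSum, hermiteSum, Finset.mul_sum, Polynomial.derivative_sum,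
    ← Finset.sum_sub_distrib]
  refine Finset.sum_congr rfl fun m _ => ?_
  rw [realHermite.succ, Polynomial.derivative_C_mul]
  ring

lemma derivative_hermiteShiftSum (s : Finset ℕ) (a : ℕ → ℝ) :
    Polynomial.derivative (hermiteShiftSum s a) = hermiteSum s fun m => a m * (m + 1) := by
  simp only [hermiteShiftSum, hermiteSum, Polynomial.derivative_sum]
  refine Finset.sum_congr rfl fun m _ => ?_
  rw [Polynomial.derivative_C_mul, realHermite.derivative_succ]
  simp only [Polynomial.C_mul, Polynomial.C_add, Polynomial.C_1, Polynomial.C_eq_natCast]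
  ring

namespace IsStdGaussianField

section

variable {T Ω : Type*} [MeasurableSpace T] [MeasurableSpace Ω] {P : Measure Ω}
  {Y : T → Ω → ℝ} [IsProbabilityMeasure P]

/-- Gaussian integration by parts for two values of the field. -/
lemma integral_mul_eval_eq (hY : IsStdGaussianField Y P) (x y : T) (p q : Polynomial ℝ) :
    ∫ ω, (Polynomial.X * p - p.derivative).eval (Y x ω) * q.eval (Y y ω) ∂P =
      covKernel Y P x y * ∫ ω, p.eval (Y x ω) * q.derivative.eval (Y y ω) ∂P := by
  have := hY.integral_mul_prod_eq x p (Finset.univ : Finset Unit) (fun _ => y) fun _ => q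
  simpa using this

/-- Each integration by parts lowers both degrees by one and releases one factor of the covariance
and one factor of the factorial. -/
lemma integral_realHermite_mul (hY : IsStdGaussianField Y P) (x y : T) (k l : ℕ) :
    ∫ ω, (realHermite k).eval (Y x ω) * (realHermite l).eval (Y y ω) ∂P =
      if k = l then (k.factorial : ℝ) * covKernel Y P x y ^ k else 0 := by
  induction k generalizing l with
  | zero =>
    cases l with
    | zero => simp
    | succ l =>
      have := hY.integral_mul_eval_eq y x (realHermite l) 1
      rw [← realHermite.succ] at this
      simpa using this
  | succ k ih =>
    rw [realHermite.succ, hY.integral_mul_eval_eq]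
    cases l with
    | zero => simp
    | succ l =>
      rw [realHermite.derivative_succ]
      have e : ∀ ω, (realHermite k).eval (Y x ω) *
          (((l : Polynomial ℝ) + 1) * realHermite l).eval (Y y ω) =
          ((l : ℝ) + 1) * ((realHermite k).eval (Y x ω) * (realHermite l).eval (Y y ω)) := by
        intro ω; simp; ring
      simp only [e]
      rw [integral_const_mul, ih]
      by_cases hkl : k = l
      · subst hkl
        simp [Nat.factorial_succ]; ring
      · simp [hkl]

lemma integral_hermiteShiftSum_mul (hY : IsStdGaussianField Y P)
    (x y : T) (s : Finset ℕ) (a : ℕ → ℝ) :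
    ∫ ω, (hermiteShiftSum s a).eval (Y x ω) * (hermiteShiftSum s a).eval (Y y ω) ∂P =
      ∑ m ∈ s, a m ^ 2 * ((m + 1).factorial * covKernel Y P x y ^ (m + 1)) := by
  have hi : ∀ k l, Integrable (fun ω => (realHermite k).eval (Y x ω) *
      (realHermite l).eval (Y y ω)) P := fun k l =>
    (((hY.memAllLp x).polynomial _).mul ((hY.memAllLp y).polynomial _)).integrable
  simp only [eval_hermiteShiftSum, Finset.sum_mul_sum]
  rw [integral_finsetSum _ fun m _ => integrable_finsetSum _ fun n _ => by
    simpa [mul_mul_mul_comm] using (hi (m + 1) (n + 1)).const_mul (a m * a n)]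
  refine Finset.sum_congr rfl fun m hm => ?_
  rw [integral_finsetSum _ fun n _ => by
    simpa [mul_mul_mul_comm] using (hi (m + 1) (n + 1)).const_mul (a m * a n)]
  rw [Finset.sum_eq_single m]
  · simp only [mul_mul_mul_comm]
    rw [integral_const_mul, hY.integral_realHermite_mul]
    simp [sq]
  · intro n _ hn
    simp only [mul_mul_mul_comm]
    rw [integral_const_mul, hY.integral_realHermite_mul]
    simp [Ne.symm hn]
  · exact fun h => absurd hm h

end

section

variable {T Ω : Type*} [MeasurableSpace T] [MeasurableSpace Ω] {P : Measure Ω}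
  [IsProbabilityMeasure P]

/-- The fourfold moment and the product of the two twofold moments are values of the same diagram
polynomial, at the covariance matrix and at its masked version. The constant depends on the degrees
only, so it serves all fields at once. -/
lemma exists_abs_cov_realHermite_le (P : Measure Ω) [IsProbabilityMeasure P] {K : ℕ} (hK : 1 ≤ K)
    (p : Fin 4 → ℕ) (hp : ∀ i, K ≤ p i + 1) :
    ∃ C : ℝ, 0 ≤ C ∧ ∀ Y : T → Ω → ℝ, IsStdGaussianField Y P → ∀ z : Fin 4 → T,
      |covKernel Y P (z 0) (z 1) * covKernel Y P (z 2) (z 3) *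
        (∫ ω, ((realHermite (p 0)).eval (Y (z 0) ω) * (realHermite (p 1)).eval (Y (z 1) ω)) *
          ((realHermite (p 2)).eval (Y (z 2) ω) * (realHermite (p 3)).eval (Y (z 3) ω)) ∂P -
        (∫ ω, (realHermite (p 0)).eval (Y (z 0) ω) * (realHermite (p 1)).eval (Y (z 1) ω) ∂P) *
          ∫ ω, (realHermite (p 2)).eval (Y (z 2) ω) * (realHermite (p 3)).eval (Y (z 3) ω) ∂P)| ≤
      C * treeSum K (fun i j => |covKernel Y P (z i) (z j)|) := by
  obtain ⟨W, hW, hWe⟩ := exists_diagramSpan p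
  obtain ⟨C, hC, hCb⟩ := exists_abs_sub_blockMask_le hK hp hW
  refine ⟨C, hC, fun Y hY z => ?_⟩
  have hΛ := hY.isHermiteMoment z
  have h1 := hWe _ _ hΛ
  have h2 := hWe _ _ (hΛ.blockMask {0, 1})
  have := hCb (fun i j => covKernel Y P (z i) (z j)) (fun _ _ => covKernel_comm _ _ _ _)
    (fun _ _ => hY.abs_covKernel_le_one _ _)
  rw [← h1, ← h2] at this
  simpa [Fin.prod_univ_four, mul_assoc] using this

/-- The conditional variance functional of the Stein equation has small variance. -/
lemma exists_integral_sq_sub_le (P : Measure Ω) [IsProbabilityMeasure P] (μ : Measure T)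
    [IsFiniteMeasure μ] {K : ℕ} (hK : 1 ≤ K) (s : Finset ℕ) (hs : ∀ m ∈ s, K ≤ m + 1)
    (a b : ℕ → ℝ) :
    ∃ C : ℝ, 0 ≤ C ∧ ∀ Y : T → Ω → ℝ, IsStdGaussianField Y P → ∀ M M' : ℝ, 0 ≤ M → 0 ≤ M' →
      (∀ x, ∫ y, |covKernel Y P x y| ∂μ ≤ M) →
      (∀ x, ∫ y, |covKernel Y P x y| ^ (K - 1) ∂μ ≤ M') →
      ∫ ω, (∫ q, covKernel Y P q.1 q.2 * ((hermiteSum s a).eval (Y q.1 ω) *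
          (hermiteSum s b).eval (Y q.2 ω) - ∫ ω', (hermiteSum s a).eval (Y q.1 ω') *
          (hermiteSum s b).eval (Y q.2 ω') ∂P) ∂(μ.prod μ)) ^ 2 ∂P ≤
        C * ((∫ q, |covKernel Y P q.1 q.2| ^ K ∂(μ.prod μ)) * (M * M')) := by
  -- The constants are chosen before the field is introduced, so they will not depend on the step h;
  -- outside the index set the constant is 0 and the claim is void.
  have hcov : ∀ r : (ℕ × ℕ) × (ℕ × ℕ), ∃ C : ℝ, 0 ≤ C ∧ (r ∈ (s ×ˢ s) ×ˢ (s ×ˢ s) →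
      ∀ Y : T → Ω → ℝ, IsStdGaussianField Y P → ∀ z : Fin 4 → T,
      |covKernel Y P (z 0) (z 1) * covKernel Y P (z 2) (z 3) *
        (∫ ω, ((realHermite r.1.1).eval (Y (z 0) ω) * (realHermite r.1.2).eval (Y (z 1) ω)) *
          ((realHermite r.2.1).eval (Y (z 2) ω) * (realHermite r.2.2).eval (Y (z 3) ω)) ∂P -
        (∫ ω, (realHermite r.1.1).eval (Y (z 0) ω) * (realHermite r.1.2).eval (Y (z 1) ω) ∂P) *
          ∫ ω, (realHermite r.2.1).eval (Y (z 2) ω) * (realHermite r.2.2).eval (Y (z 3) ω) ∂P)| ≤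
      C * treeSum K (fun i j => |covKernel Y P (z i) (z j)|)) := by
    intro r
    by_cases hr : r ∈ (s ×ˢ s) ×ˢ (s ×ˢ s)
    · simp only [Finset.mem_product] at hr
      obtain ⟨C, hC, h⟩ := exists_abs_cov_realHermite_le (T := T) P hK
        ![r.1.1, r.1.2, r.2.1, r.2.2] (fun i => by
          fin_cases i
          · exact hs _ hr.1.1
          · exact hs _ hr.1.2
          · exact hs _ hr.2.1
          · exact hs _ hr.2.2)
      exact ⟨C, hC, fun _ => h⟩
    · exact ⟨0, le_rfl, fun h => absurd h hr⟩
  choose Cf hCf0 hCf using hcov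
  let c : ℕ × ℕ → ℝ := fun r => a r.1 * b r.2
  refine ⟨144 * ∑ r ∈ (s ×ˢ s) ×ˢ (s ×ˢ s), |c r.1 * c r.2| * Cf r, by
    refine mul_nonneg (by norm_num) (Finset.sum_nonneg fun r _ => ?_)
    exact mul_nonneg (abs_nonneg _) (hCf0 r), fun Y hY M M' hM hM' h1 h2 => ?_⟩
  set C := ∑ r ∈ (s ×ˢ s) ×ˢ (s ×ˢ s), |c r.1 * c r.2| * Cf r with hC
  let h : ℕ × ℕ → T × T → Ω → ℝ := fun r q ω =>
    (realHermite r.1).eval (Y q.1 ω) * (realHermite r.2).eval (Y q.2 ω)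
  let A : T × T → Ω → ℝ := fun q ω =>
    (hermiteSum s a).eval (Y q.1 ω) * (hermiteSum s b).eval (Y q.2 ω)
  let mA : T × T → ℝ := fun q => ∫ ω, A q ω ∂P
  let B : T × T → Ω → ℝ := fun q ω => covKernel Y P q.1 q.2 * (A q ω - mA q)
  have hpol : ∀ x (p : Polynomial ℝ), MemAllLp (fun ω => p.eval (Y x ω)) P := fun x p =>
    (hY.memAllLp x).polynomial p
  have hh : ∀ r q, MemAllLp (h r q) P := fun r q => (hpol _ _).mul (hpol _ _)
  have hA : ∀ q, MemAllLp (A q) P := fun q => (hpol _ _).mul (hpol _ _)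
  have hAh : ∀ q ω, A q ω = ∑ r ∈ s ×ˢ s, c r * h r q ω := fun q ω => by
    simp only [A, eval_hermiteSum, Finset.sum_mul_sum, Finset.sum_product, c, h]
    exact Finset.sum_congr rfl fun i _ => Finset.sum_congr rfl fun j _ => by ring
  have hmA : ∀ q, mA q = ∑ r ∈ s ×ˢ s, c r * ∫ ω, h r q ω ∂P := fun q => by
    simp only [mA, hAh]
    rw [integral_finsetSum _ fun r _ => (hh r q).integrable.const_mul _]
    simp only [integral_const_mul]
  have hAA : ∀ q q', ∫ ω, A q ω * A q' ω ∂P =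
      ∑ r ∈ (s ×ˢ s) ×ˢ (s ×ˢ s), c r.1 * c r.2 * ∫ ω, h r.1 q ω * h r.2 q' ω ∂P := fun q q' => by
    have e : ∀ ω, A q ω * A q' ω =
        ∑ r ∈ (s ×ˢ s) ×ˢ (s ×ˢ s), c r.1 * c r.2 * (h r.1 q ω * h r.2 q' ω) := fun ω => by
      rw [hAh, hAh, Finset.sum_mul_sum, ← Finset.sum_product']
      exact Finset.sum_congr rfl fun r _ => by ring
    simp only [e]
    rw [integral_finsetSum _ fun r _ => ((hh r.1 q).mul (hh r.2 q')).integrable.const_mul _]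
    simp only [integral_const_mul]
  have hmm : ∀ q q', mA q * mA q' = ∑ r ∈ (s ×ˢ s) ×ˢ (s ×ˢ s),
      c r.1 * c r.2 * ((∫ ω, h r.1 q ω ∂P) * ∫ ω, h r.2 q' ω ∂P) := fun q q' => by
    rw [hmA, hmA, Finset.sum_mul_sum, ← Finset.sum_product']
    exact Finset.sum_congr rfl fun r _ => by ring
  have hBB : ∀ w : (T × T) × (T × T), ∫ ω, B w.1 ω * B w.2 ω ∂P ≤
      C * treeSum K (fun i j => |covKernel Y P (fourPoints w i) (fourPoints w j)|) := by
    intro w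
    have e : ∫ ω, B w.1 ω * B w.2 ω ∂P = covKernel Y P w.1.1 w.1.2 * covKernel Y P w.2.1 w.2.2 *
        (∫ ω, A w.1 ω * A w.2 ω ∂P - mA w.1 * mA w.2) := by
      have e1 : ∀ ω, B w.1 ω * B w.2 ω = covKernel Y P w.1.1 w.1.2 * covKernel Y P w.2.1 w.2.2 *
          (A w.1 ω * A w.2 ω - mA w.2 * A w.1 ω - mA w.1 * A w.2 ω + mA w.1 * mA w.2) := fun ω => by
        simp only [B]; ring
      have i1 := ((hA w.1).mul (hA w.2)).integrable
      have i2 := (hA w.1).integrable.const_mul (mA w.2)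
      have i3 := (hA w.2).integrable.const_mul (mA w.1)
      have i4 : Integrable (fun ω => A w.1 ω * A w.2 ω - mA w.2 * A w.1 ω) P := i1.sub i2
      have i5 : Integrable (fun ω => A w.1 ω * A w.2 ω - mA w.2 * A w.1 ω - mA w.1 * A w.2 ω) P :=
        i4.sub i3
      simp only [e1]
      rw [integral_const_mul, integral_add i5 (integrable_const _), integral_sub i4 i3,
        integral_sub i1 i2, integral_const_mul, integral_const_mul, integral_const]
      simp only [mA, probReal_univ, one_smul]
      ring
    rw [e, hAA, hmm, ← Finset.sum_sub_distrib, Finset.mul_sum, hC, Finset.sum_mul]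
    refine Finset.sum_le_sum fun r hr => ?_
    have hb := hCf r hr Y hY (fourPoints w)
    refine (le_abs_self _).trans ?_
    calc _ = |c r.1 * c r.2| * |covKernel Y P w.1.1 w.1.2 * covKernel Y P w.2.1 w.2.2 *
          (∫ ω, h r.1 w.1 ω * h r.2 w.2 ω ∂P - (∫ ω, h r.1 w.1 ω ∂P) * ∫ ω, h r.2 w.2 ω ∂P)| := by
          rw [← abs_mul]; congr 1; ring
      _ ≤ _ := by
          rw [mul_assoc |_|]
          exact mul_le_mul_of_nonneg_left hb (abs_nonneg _)
  have hAm : Measurable fun p : (T × T) × Ω => A p.1 p.2 :=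
    (((hermiteSum s a).continuous.measurable.comp (hY.measurable.comp
      (by fun_prop : Measurable fun p : (T × T) × Ω => (p.1.1, p.2)))).mul
    ((hermiteSum s b).continuous.measurable.comp (hY.measurable.comp
      (by fun_prop : Measurable fun p : (T × T) × Ω => (p.1.2, p.2)))))
  have hmAm : Measurable mA := (hAm.stronglyMeasurable.integral_prod_right (ν := P)).measurable
  have hBm : Measurable fun p : (T × T) × Ω => B p.1 p.2 :=
    (hY.measurable_covKernel.comp measurable_fst).mul (hAm.sub (hmAm.comp measurable_fst))
  have hB2 : ∀ q, MemLp (B q) 2 P := fun q =>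
    ((MemAllLp.const _).mul ((hA q).sub (MemAllLp.const _))) 2 (by simp)
  -- Only uniformity in `q` matters here: this crude bound licenses Fubini and does not enter the
  -- final constant.
  have hBC : ∀ q, ∫ ω, B q ω ^ 2 ∂P ≤ (∫ u, ((hermiteSum s a).eval u) ^ 4 ∂(gaussianReal 0 1) +
      ∫ u, ((hermiteSum s b).eval u) ^ 4 ∂(gaussianReal 0 1)) / 2 := by
    intro q
    have iA2 : Integrable (fun ω => A q ω ^ 2) P := by
      simpa [sq] using ((hA q).mul (hA q)).integrable
    have hfour : ∀ x (p : Polynomial ℝ), Integrable (fun ω => p.eval (Y x ω) ^ 4) P ∧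
        ∫ ω, p.eval (Y x ω) ^ 4 ∂P = ∫ u, p.eval u ^ 4 ∂(gaussianReal 0 1) := fun x p => by
      refine ⟨(hpol x (p ^ 4)).integrable.congr (.of_forall fun ω => Polynomial.eval_pow 4), ?_⟩
      exact hY.integral_comp x (f := fun u => p.eval u ^ 4)
        (p.continuous.pow 4).aestronglyMeasurable
    have s1 : ∫ ω, B q ω ^ 2 ∂P ≤ ∫ ω, (A q ω - mA q) ^ 2 ∂P := by
      refine integral_mono (hB2 q).integrable_sq
        (((hA q).sub (MemAllLp.const (mA q))) 2 (by simp)).integrable_sq fun ω => ?_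
      simp only [B, mul_pow]
      have : covKernel Y P q.1 q.2 ^ 2 ≤ 1 := by
        rw [← sq_abs]; exact pow_le_one₀ (abs_nonneg _) (hY.abs_covKernel_le_one _ _)
      nlinarith [sq_nonneg (A q ω - mA q)]
    have s2 : ∫ ω, (A q ω - mA q) ^ 2 ∂P ≤ ∫ ω, A q ω ^ 2 ∂P := by
      have e : ∀ ω, (A q ω - mA q) ^ 2 = A q ω ^ 2 - 2 * mA q * A q ω + mA q ^ 2 := fun ω => by ring
      have i1 : Integrable (fun ω => A q ω ^ 2 - 2 * mA q * A q ω) P :=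
        iA2.sub ((hA q).integrable.const_mul _)
      simp only [e]
      rw [integral_add i1 (integrable_const _), integral_sub iA2
        ((hA q).integrable.const_mul _), integral_const_mul, integral_const]
      simp only [probReal_univ, one_smul]
      have : ∫ ω, A q ω ∂P = mA q := rfl
      rw [this]
      nlinarith [sq_nonneg (mA q)]
    have s3 : ∫ ω, A q ω ^ 2 ∂P ≤ ∫ ω, (((hermiteSum s a).eval (Y q.1 ω)) ^ 4 +
        ((hermiteSum s b).eval (Y q.2 ω)) ^ 4) / 2 ∂P := by
      refine integral_mono iA2 (((hfour _ _).1.add (hfour _ _).1).div_const 2) fun ω => ?_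
      simp only [A]
      nlinarith [sq_nonneg (((hermiteSum s a).eval (Y q.1 ω)) ^ 2 -
        ((hermiteSum s b).eval (Y q.2 ω)) ^ 2)]
    refine s1.trans (s2.trans (s3.trans_eq ?_))
    rw [integral_div, integral_add (hfour _ _).1 (hfour _ _).1, (hfour _ _).2, (hfour _ _).2]
  have hu := hY.measurable_covKernel.abs
  have hu1 : ∀ x y, |covKernel Y P x y| ≤ 1 := hY.abs_covKernel_le_one
  have e0 : ∫ ω, (∫ q, B q ω ∂(μ.prod μ)) ^ 2 ∂P =
      ∫ w : (T × T) × (T × T), ∫ ω, B w.1 ω * B w.2 ω ∂P ∂((μ.prod μ).prod (μ.prod μ)) :=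
    integral_sq_integral hBm hB2 hBC
  have hti := integrable_treeSum (μ := μ) hu (fun _ _ => abs_nonneg _) hu1 K
  have hBBi : Integrable (fun w : (T × T) × (T × T) => ∫ ω, B w.1 ω * B w.2 ω ∂P)
      ((μ.prod μ).prod (μ.prod μ)) := by
    have hm : Measurable fun p : ((T × T) × (T × T)) × Ω => B p.1.1 p.2 * B p.1.2 p.2 :=
      (hBm.comp (by fun_prop : Measurable fun p : ((T × T) × (T × T)) × Ω => (p.1.1, p.2))).mul
      (hBm.comp (by fun_prop : Measurable fun p : ((T × T) × (T × T)) × Ω => (p.1.2, p.2)))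
    set D := (∫ u, ((hermiteSum s a).eval u) ^ 4 ∂(gaussianReal 0 1) +
      ∫ u, ((hermiteSum s b).eval u) ^ 4 ∂(gaussianReal 0 1)) / 2
    refine Integrable.of_bound (C := D)
      (hm.stronglyMeasurable.integral_prod_right (ν := P)).aestronglyMeasurable
      (.of_forall fun w => ?_)
    have i1 := (hB2 w.1).integrable_sq
    have i2 := (hB2 w.2).integrable_sq
    calc ‖∫ ω, B w.1 ω * B w.2 ω ∂P‖ ≤ ∫ ω, ‖B w.1 ω * B w.2 ω‖ ∂P := norm_integral_le_integral_norm _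
      _ ≤ ∫ ω, (B w.1 ω ^ 2 + B w.2 ω ^ 2) / 2 ∂P := by
          refine integral_mono ((hB2 w.1).integrable_mul (hB2 w.2)).norm ((i1.add i2).div_const 2)
            fun ω => ?_
          dsimp only
          rw [Real.norm_eq_abs, abs_mul]
          nlinarith [sq_nonneg (|B w.1 ω| - |B w.2 ω|), sq_abs (B w.1 ω), sq_abs (B w.2 ω)]
      _ = (∫ ω, B w.1 ω ^ 2 ∂P + ∫ ω, B w.2 ω ^ 2 ∂P) / 2 := by
          rw [integral_div, integral_add i1 i2]
      _ ≤ D := by linarith [hBC w.1, hBC w.2]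
  have hC0 : 0 ≤ C := Finset.sum_nonneg fun r _ => mul_nonneg (abs_nonneg _) (hCf0 r)
  calc _ = ∫ ω, (∫ q, B q ω ∂(μ.prod μ)) ^ 2 ∂P := rfl
    _ ≤ ∫ w, C * treeSum K (fun i j => |covKernel Y P (fourPoints w i) (fourPoints w j)|)
          ∂((μ.prod μ).prod (μ.prod μ)) := by
        rw [e0]
        exact integral_mono hBBi (hti.const_mul _) hBB
    _ ≤ C * (144 * ((∫ q, |covKernel Y P q.1 q.2| ^ K ∂(μ.prod μ)) * (M * M'))) := by
        rw [integral_const_mul]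
        refine mul_le_mul_of_nonneg_left ?_ hC0
        exact integral_treeSum_le hu (fun _ _ => abs_nonneg _) hu1
          (fun x y => by rw [covKernel_comm]) h1 h2 hM hM'
    _ = _ := by ring

end

end IsStdGaussianField

/-! ### The Stein equation for the characteristic function. -/

lemma integral_abs_le_sqrt {Ω : Type*} [MeasurableSpace Ω] {P : Measure Ω} [IsProbabilityMeasure P]
    {X : Ω → ℝ} (hX : MemLp X 2 P) : ∫ ω, |X ω| ∂P ≤ √(∫ ω, X ω ^ 2 ∂P) := by
  refine Real.le_sqrt_of_sq_le ?_
  have := sq_integral_le (μ := P) (hX.integrable (by norm_num)).abs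
    (by simpa using hX.integrable_sq)
  simpa using this

namespace IsStdGaussianField

variable {T Ω : Type*} [MeasurableSpace T] [MeasurableSpace Ω] {P : Measure Ω}
  {Y : T → Ω → ℝ}

lemma comp {S : Type*} [MeasurableSpace S] (hY : IsStdGaussianField Y P) {φ : S → T}
    (hφ : Measurable φ) : IsStdGaussianField (fun s => Y (φ s)) P where
  isGaussianProcess := hY.isGaussianProcess.comp_right φ
  hasLaw s := hY.hasLaw (φ s)
  measurable := hY.measurable.comp ((hφ.comp measurable_fst).prodMk measurable_snd)

variable [IsProbabilityMeasure P]

lemma integral_sq_integral_comp (hY : IsStdGaussianField Y P)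
    (μ : Measure T) [IsFiniteMeasure μ] {f : ℝ → ℝ} (hf : Measurable f)
    (hf2 : MemLp f 2 (gaussianReal 0 1)) :
    ∫ ω, (∫ x, f (Y x ω) ∂μ) ^ 2 ∂P =
      ∫ q : T × T, ∫ ω, f (Y q.1 ω) * f (Y q.2 ω) ∂P ∂(μ.prod μ) := by
  refine integral_sq_integral (B := fun x ω => f (Y x ω)) (hf.comp hY.measurable) (fun x => ?_)
    (C := ∫ u, f u ^ 2 ∂(gaussianReal 0 1)) fun x => ?_
  · have := hf2
    rw [← (hY.hasLaw x).map_eq] at this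
    exact this.comp_of_map (hY.measurable_apply x).aemeasurable
  · exact (hY.integral_comp x (f := fun u => f u ^ 2) (hf.pow_const 2).aestronglyMeasurable).le

/-- Integrating the pointwise identity `integral_mul_cexp_eq` over x and exchanging integrals gives
E[F e^{itF}] = it E[Γ e^{itF}], which becomes a differential equation for the characteristic
function of F. -/
lemma integral_mul_cexp_eq_integral_prod (hY : IsStdGaussianField Y P)
    (μ : Measure T) [IsFiniteMeasure μ] (p g : Polynomial ℝ)
    (hg : g = Polynomial.X * p - Polynomial.derivative p) (t : ℝ) :
    ∫ ω, ((∫ x, g.eval (Y x ω) ∂μ : ℝ) : ℂ) *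
        Complex.exp (((t * ∫ y, g.eval (Y y ω) ∂μ : ℝ) : ℂ) * Complex.I) ∂P =
      t * Complex.I * ∫ ω, ((∫ q, covKernel Y P q.1 q.2 * (p.eval (Y q.1 ω) *
        (Polynomial.derivative g).eval (Y q.2 ω)) ∂(μ.prod μ) : ℝ) : ℂ) *
        Complex.exp (((t * ∫ y, g.eval (Y y ω) ∂μ : ℝ) : ℂ) * Complex.I) ∂P := by
  set e : Ω → ℂ := fun ω => Complex.exp (((t * ∫ y, g.eval (Y y ω) ∂μ : ℝ) : ℂ) * Complex.I) with he
  have hem : AEStronglyMeasurable e P := by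
    have := (hY.memLp_integral_polynomial μ g).aestronglyMeasurable
    exact Complex.continuous_exp.comp_aestronglyMeasurable
      ((Complex.continuous_ofReal.comp_aestronglyMeasurable (this.const_mul t)).mul_const Complex.I)
  have he1 : ∀ ω, ‖e ω‖ ≤ 1 := fun ω => (Complex.norm_exp_ofReal_mul_I _).le
  have hfub : ∀ {S : Type _} [MeasurableSpace S] (ν : Measure S) [IsFiniteMeasure ν] (B : S → Ω → ℝ),
      Integrable (fun z : S × Ω => B z.1 z.2) (ν.prod P) →
      ∫ ω, ((∫ s, B s ω ∂ν : ℝ) : ℂ) * e ω ∂P = ∫ s, ∫ ω, (B s ω : ℂ) * e ω ∂P ∂ν := by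
    intro S _ ν _ B hB
    have hi : Integrable (fun z : S × Ω => (B z.1 z.2 : ℂ) * e z.2) (ν.prod P) :=
      hB.ofReal.mul_bdd (c := 1) hem.comp_snd (.of_forall fun z => he1 _)
    rw [← integral_prod _ hi, integral_prod_symm _ hi]
    congr 1; ext ω
    dsimp only
    rw [integral_mul_const, integral_complex_ofReal]
  have hY2 := (hY.comp (measurable_fst (α := T) (β := T))).memAllLp_prod (μ.prod μ)
  have hY2' := (hY.comp (measurable_snd (α := T) (β := T))).memAllLp_prod (μ.prod μ)
  have hρ : MemAllLp (fun z : (T × T) × Ω => covKernel Y P z.1.1 z.1.2) ((μ.prod μ).prod P) :=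
    hY.memAllLp_covKernel_comp (by fun_prop) (by fun_prop)
  have hΓi : Integrable (fun z : (T × T) × Ω => covKernel Y P z.1.1 z.1.2 *
      (p.eval (Y z.1.1 z.2) * (Polynomial.derivative g).eval (Y z.1.2 z.2))) ((μ.prod μ).prod P) :=
    (hρ.mul ((hY2.polynomial p).mul (hY2'.polynomial _))).integrable
  rw [hfub μ (fun x ω => g.eval (Y x ω)) ((hY.memAllLp_prod μ).polynomial g).integrable,
    hfub (μ.prod μ) (fun q ω => covKernel Y P q.1 q.2 * (p.eval (Y q.1 ω) *
        (Polynomial.derivative g).eval (Y q.2 ω))) hΓi]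
  have hi3 : Integrable (fun q : T × T => ∫ ω, ((covKernel Y P q.1 q.2 * (p.eval (Y q.1 ω) *
        (Polynomial.derivative g).eval (Y q.2 ω)) : ℝ) : ℂ) * e ω ∂P) (μ.prod μ) := by
    have : Integrable (fun z : (T × T) × Ω => ((covKernel Y P z.1.1 z.1.2 * (p.eval (Y z.1.1 z.2) *
        (Polynomial.derivative g).eval (Y z.1.2 z.2)) : ℝ) : ℂ) * e z.2) ((μ.prod μ).prod P) :=
      hΓi.ofReal.mul_bdd (c := 1) hem.comp_snd (.of_forall fun z => he1 _)
    exact this.integral_prod_left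
  rw [integral_prod _ hi3, ← integral_const_mul]
  congr 1; ext x
  have h1 := hY.integral_mul_cexp_eq μ x p g t
  have h2 : ∫ ω, ((g.eval (Y x ω) : ℝ) : ℂ) * e ω ∂P =
      ∫ ω, ((Y x ω * p.eval (Y x ω) - (Polynomial.derivative p).eval (Y x ω) : ℝ) : ℂ) * e ω ∂P := by
    congr 1; ext ω
    have : g.eval (Y x ω) = Y x ω * p.eval (Y x ω) - (Polynomial.derivative p).eval (Y x ω) := by
      rw [hg]; simp
    rw [this]
  rw [h2, h1]
  have hxi : Integrable (fun z : T × Ω => covKernel Y P x z.1 * (p.eval (Y x z.2) *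
      (Polynomial.derivative g).eval (Y z.1 z.2))) (μ.prod P) :=
    ((hY.memAllLp_covKernel_comp measurable_const measurable_fst).mul
      (MemAllLp.mul (fun r hr => (((hY.memAllLp x).polynomial p) r hr).comp_snd μ)
      ((hY.memAllLp_prod μ).polynomial _))).integrable
  rw [← hfub μ (fun y ω => covKernel Y P x y * (p.eval (Y x ω) *
    (Polynomial.derivative g).eval (Y y ω))) hxi, ← integral_const_mul]
  congr 1; ext ω
  have h4 : ∫ y, covKernel Y P x y * (p.eval (Y x ω) * (Polynomial.derivative g).eval (Y y ω)) ∂μ =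
      p.eval (Y x ω) * ∫ y, covKernel Y P x y * (Polynomial.derivative g).eval (Y y ω) ∂μ := by
    rw [← integral_const_mul]
    congr 1; ext y; ring
  rw [h4]
  ring

/-- Distance between the characteristic function of an integral functional and that of a normal
variable, in terms of the fluctuation of the functional in the Stein equation. -/
lemma norm_integral_cexp_sub_le (hY : IsStdGaussianField Y P)
    (μ : Measure T) [IsFiniteMeasure μ] (p g : Polynomial ℝ)
    (hg : g = Polynomial.X * p - Polynomial.derivative p) {V Δ : ℝ}
    (hV : V = ∫ ω, (∫ x, g.eval (Y x ω) ∂μ) ^ 2 ∂P)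
    (hΔ : Δ = ∫ ω, (∫ q, covKernel Y P q.1 q.2 * (p.eval (Y q.1 ω) *
        (Polynomial.derivative g).eval (Y q.2 ω) - ∫ ω', p.eval (Y q.1 ω') *
        (Polynomial.derivative g).eval (Y q.2 ω') ∂P) ∂(μ.prod μ)) ^ 2 ∂P) (t : ℝ) :
    ‖∫ ω, Complex.exp (((t * ∫ y, g.eval (Y y ω) ∂μ : ℝ) : ℂ) * Complex.I) ∂P -
      Complex.exp ((-(V * t ^ 2 / 2) : ℝ) : ℂ)‖ ≤ t ^ 2 * √Δ := by
  set F : Ω → ℝ := fun ω => ∫ y, g.eval (Y y ω) ∂μ with hF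
  set A : T × T → Ω → ℝ := fun q ω => p.eval (Y q.1 ω) * (Polynomial.derivative g).eval (Y q.2 ω)
  set Γ : Ω → ℝ := fun ω => ∫ q, covKernel Y P q.1 q.2 * A q ω ∂(μ.prod μ) with hΓ
  have hFL : MemLp F 2 P := hY.memLp_integral_polynomial μ g
  have hF1 : Integrable F P := hFL.integrable (by norm_num)
  have hY2 := (hY.comp (measurable_fst (α := T) (β := T))).memAllLp_prod (μ.prod μ)
  have hY2' := (hY.comp (measurable_snd (α := T) (β := T))).memAllLp_prod (μ.prod μ)
  have hρ : MemAllLp (fun z : (T × T) × Ω => covKernel Y P z.1.1 z.1.2) ((μ.prod μ).prod P) :=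
    hY.memAllLp_covKernel_comp (by fun_prop) (by fun_prop)
  have hΓL : MemAllLp (fun z : (T × T) × Ω => covKernel Y P z.1.1 z.1.2 * A z.1 z.2)
      ((μ.prod μ).prod P) := hρ.mul ((hY2.polynomial p).mul (hY2'.polynomial _))
  have hΓ2 : MemLp Γ 2 P := memLp_two_integral (hΓL 2 (by simp))
  -- One more integration by parts, at two points, identifies V with the mean of `Γ`, so Δ is the
  -- variance of `Γ`.
  have hVq : V = ∫ q, covKernel Y P q.1 q.2 * ∫ ω', A q ω' ∂P ∂(μ.prod μ) := by
    rw [hV, hY.integral_sq_integral_comp μ g.continuous.measurable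
      ((memAllLp_id_gaussianReal.polynomial g) 2 (by simp))]
    congr 1; ext q
    conv_lhs => enter [2, ω, 1]; rw [hg]
    exact hY.integral_mul_eval_eq q.1 q.2 p g
  have hmi : Integrable (fun q : T × T => covKernel Y P q.1 q.2 * ∫ ω', A q ω' ∂P) (μ.prod μ) := by
    have := hΓL.integrable.integral_prod_left
    simpa [integral_const_mul] using this
  have hsub : ∀ᵐ ω ∂P, Γ ω - V = ∫ q, covKernel Y P q.1 q.2 * (A q ω - ∫ ω', A q ω' ∂P) ∂(μ.prod μ) := by
    filter_upwards [Integrable.prod_left_ae hΓL.integrable] with ω hω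
    rw [hVq, hΓ]
    dsimp only
    rw [← integral_sub hω hmi]
    congr 1; ext q; ring
  have hΔ' : ∫ ω, (Γ ω - V) ^ 2 ∂P = Δ := by
    rw [hΔ]
    refine integral_congr_ae ?_
    filter_upwards [hsub] with ω hω
    rw [hω]
  let e : ℝ → Ω → ℂ := fun s ω => Complex.exp (((s * F ω : ℝ) : ℂ) * Complex.I)
  let ψ : ℝ → ℂ := fun s => ∫ ω, e s ω ∂P
  have hem : ∀ s, AEStronglyMeasurable (e s) P := fun s =>
    Complex.continuous_exp.comp_aestronglyMeasurable
      ((Complex.continuous_ofReal.comp_aestronglyMeasurable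
        (hFL.aestronglyMeasurable.const_mul s)).mul_const Complex.I)
  have he1 : ∀ s ω, ‖e s ω‖ = 1 := fun s ω => Complex.norm_exp_ofReal_mul_I _
  have hei : ∀ s, Integrable (e s) P := fun s =>
    Integrable.of_bound (hem s) 1 (.of_forall fun ω => (he1 s ω).le)
  have hXe : ∀ s (X : Ω → ℝ), Integrable X P → Integrable (fun ω => (X ω : ℂ) * e s ω) P :=
    fun s X hX => hX.ofReal.mul_bdd (c := 1) (hem s) (.of_forall fun ω => (he1 s ω).le)
  have hψd : ∀ s, HasDerivAt ψ (∫ ω, e s ω * ((F ω : ℂ) * Complex.I) ∂P) s := by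
    intro s
    have hd : ∀ r ω, HasDerivAt (fun r => e r ω) (e r ω * ((F ω : ℂ) * Complex.I)) r := by
      intro r ω
      have h1 : HasDerivAt (fun r : ℝ => r * F ω) (F ω) r := by
        simpa using (hasDerivAt_id r).mul_const (F ω)
      exact (h1.ofReal_comp.mul_const Complex.I).cexp
    refine (hasDerivAt_integral_of_dominated_loc_of_deriv_le (bound := fun ω => |F ω|)
      (F := fun r ω => e r ω) (F' := fun r ω => e r ω * ((F ω : ℂ) * Complex.I)) univ_mem
      (.of_forall hem) (hei s) ?_ ?_ hF1.abs (.of_forall fun ω r _ => hd r ω)).2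
    · exact (hem s).mul ((Complex.continuous_ofReal.comp_aestronglyMeasurable
        hFL.aestronglyMeasurable).mul_const Complex.I)
    · refine .of_forall fun ω r _ => ?_
      simp [he1]
  have hψ' : ∀ s, ∫ ω, e s ω * ((F ω : ℂ) * Complex.I) ∂P = -(s : ℂ) * ∫ ω, (Γ ω : ℂ) * e s ω ∂P := by
    intro s
    have h1 := hY.integral_mul_cexp_eq_integral_prod μ p g hg s
    have h2 : ∫ ω, e s ω * ((F ω : ℂ) * Complex.I) ∂P = Complex.I * ∫ ω, (F ω : ℂ) * e s ω ∂P := by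
      rw [← integral_const_mul]
      congr 1; ext ω; ring
    rw [h2]
    have h3 : ∫ ω, (F ω : ℂ) * e s ω ∂P = s * Complex.I * ∫ ω, (Γ ω : ℂ) * e s ω ∂P := h1
    rw [h3]
    linear_combination (s : ℂ) * (∫ ω, (Γ ω : ℂ) * e s ω ∂P) * Complex.I_mul_I
  have hΓV : ∀ s, ‖∫ ω, (Γ ω : ℂ) * e s ω ∂P - V * ψ s‖ ≤ √Δ := by
    intro s
    have h1 : ∫ ω, (Γ ω : ℂ) * e s ω ∂P - V * ψ s = ∫ ω, ((Γ ω - V : ℝ) : ℂ) * e s ω ∂P := by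
      rw [← integral_const_mul, ← integral_sub (hXe s Γ (hΓ2.integrable (by norm_num)))
        ((hei s).const_mul _)]
      congr 1; ext ω; push_cast; ring
    have h2 : MemLp (fun ω => Γ ω - V) 2 P := hΓ2.sub (memLp_const V)
    rw [h1, ← hΔ']
    refine (norm_integral_le_integral_norm _).trans (Eq.trans_le ?_ (integral_abs_le_sqrt h2))
    congr 1; ext ω
    rw [norm_mul, he1, mul_one, Complex.norm_real, Real.norm_eq_abs]
  -- Integrating factor for ψ' = -sVψ + error: θ would be constant if `Γ` were equal to its mean.
  let θ : ℝ → ℂ := fun s => ψ s * Complex.exp ((V * s ^ 2 / 2 : ℝ) : ℂ)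
  have hθ : ∀ s : ℝ, HasDerivAt θ (-(s : ℂ) * (∫ ω, (Γ ω : ℂ) * e s ω ∂P - V * ψ s) *
      Complex.exp ((V * s ^ 2 / 2 : ℝ) : ℂ)) s := by
    intro s
    have h1 : HasDerivAt (fun r : ℝ => V * r ^ 2 / 2) (V * s) s := by
      have := ((hasDerivAt_pow 2 s).const_mul V).div_const 2
      refine this.congr_deriv ?_
      simp; ring
    have h2 := (hψd s).mul h1.ofReal_comp.cexp
    rw [hψ'] at h2
    refine h2.congr_deriv ?_
    push_cast; ring
  have hV0 : 0 ≤ V := by rw [hV]; exact integral_nonneg fun _ => sq_nonneg _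
  have hbound : ∀ s ∈ Set.Icc (-|t|) |t|, ‖-(s : ℂ) * (∫ ω, (Γ ω : ℂ) * e s ω ∂P - V * ψ s) *
      Complex.exp ((V * s ^ 2 / 2 : ℝ) : ℂ)‖ ≤ |t| * √Δ * Real.exp (V * t ^ 2 / 2) := by
    intro s hs
    have hst : |s| ≤ |t| := abs_le.2 hs
    rw [norm_mul, norm_mul, norm_neg, Complex.norm_real, Real.norm_eq_abs, Complex.norm_exp_ofReal]
    have : s ^ 2 ≤ t ^ 2 := sq_le_sq.2 hst
    gcongr
    exact hΓV s
  have hmv := (convex_Icc (-|t|) |t|).norm_image_sub_le_of_norm_hasDerivWithin_le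
    (fun s _ => (hθ s).hasDerivWithinAt) hbound
    (show (0 : ℝ) ∈ Set.Icc (-|t|) |t| from ⟨by simp, abs_nonneg t⟩)
    (show t ∈ Set.Icc (-|t|) |t| from ⟨neg_abs_le t, le_abs_self t⟩)
  have hθ0 : θ 0 = 1 := by simp [θ, ψ, e]
  have hfin : ψ t - Complex.exp ((-(V * t ^ 2 / 2) : ℝ) : ℂ) =
      (θ t - θ 0) * Complex.exp ((-(V * t ^ 2 / 2) : ℝ) : ℂ) := by
    rw [hθ0]
    simp only [θ]
    rw [sub_mul, mul_assoc, ← Complex.exp_add, ← Complex.ofReal_add]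
    simp
  change ‖ψ t - _‖ ≤ _
  rw [hfin, norm_mul, Complex.norm_exp_ofReal]
  calc _ ≤ |t| * √Δ * Real.exp (V * t ^ 2 / 2) * ‖t - 0‖ * Real.exp (-(V * t ^ 2 / 2)) := by
        gcongr
    _ = t ^ 2 * √Δ * (Real.exp (V * t ^ 2 / 2) * Real.exp (-(V * t ^ 2 / 2))) := by
        rw [sub_zero, Real.norm_eq_abs, ← sq_abs t]; ring
    _ = t ^ 2 * √Δ := by rw [← Real.exp_add]; simp

end IsStdGaussianField

/-! ### Hermite expansions in the Gaussian L² space. -/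

section HermiteBasis

lemma memLp_two_exp_abs_gaussianReal (t : ℝ) :
    MemLp (fun x => Real.exp |t * x|) 2 (gaussianReal 0 1) := by
  have h : ∀ s : ℝ, MemLp (fun x => Real.exp (s * x)) 2 (gaussianReal 0 1) := by
    intro s
    rw [memLp_two_iff_integrable_sq (by fun_prop)]
    refine (integrable_exp_mul_gaussianReal (μ := 0) (v := 1) (2 * s)).congr (.of_forall fun x => ?_)
    dsimp only
    rw [← Real.exp_nat_mul]
    congr 1; push_cast; ring
  refine ((h t).add (h (-t))).mono (by fun_prop) (.of_forall fun x => ?_)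
  simp only [Pi.add_apply, Real.norm_eq_abs, Real.abs_exp]
  rw [abs_of_pos (add_pos (Real.exp_pos (t * x)) (Real.exp_pos (-t * x)))]
  rcases abs_cases (t * x) with ⟨h, _⟩ | ⟨h, _⟩ <;> rw [h]
  · linarith [Real.exp_pos (-t * x)]
  · rw [neg_mul]; linarith [Real.exp_pos (t * x)]

/-- Expanding e^{itx} termwise, which is allowed because |g| e^{|tx|} is a product of two L²
functions, shows that g dγ has zero Fourier transform. The densities g⁺ and g⁻ then give finite
measures with equal characteristic functions, hence are equal, and so both vanish. -/
lemma ae_eq_zero_of_integral_mul_pow_eq_zero {g : ℝ → ℝ} (hg : MemLp g 2 (gaussianReal 0 1))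
    (h : ∀ n : ℕ, ∫ x, g x * x ^ n ∂(gaussianReal 0 1) = 0) : g =ᵐ[gaussianReal 0 1] 0 := by
  set γ := gaussianReal 0 1 with hγ
  have hgi : Integrable g γ := hg.integrable (by norm_num)
  have hchar : ∀ t : ℝ, ∫ x, (g x : ℂ) * Complex.exp (t * x * Complex.I) ∂γ = 0 := by
    intro t
    have hs := hasSum_integral_of_dominated_convergence (μ := γ)
      (F := fun (n : ℕ) x => (g x : ℂ) * ((t * x * Complex.I) ^ n / n.factorial))
      (f := fun x => (g x : ℂ) * Complex.exp (t * x * Complex.I))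
      (fun n x => |g x| * (|t * x| ^ n / n.factorial))
      (fun n => (Complex.continuous_ofReal.comp_aestronglyMeasurable hg.1).mul
        (by fun_prop : Measurable fun x : ℝ => (t * x * Complex.I : ℂ) ^ n / n.factorial).aestronglyMeasurable)
      (fun n => .of_forall fun x => by simp [mul_pow])
      (.of_forall fun x => (Real.summable_pow_div_factorial _).mul_left _) ?_
      (.of_forall fun x => HasSum.mul_left _ ?_)
    · refine (hs.unique ?_)
      have : ∀ n : ℕ, ∫ x, (g x : ℂ) * ((t * x * Complex.I) ^ n / n.factorial) ∂γ = 0 := by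
        intro n
        have e : ∀ x : ℝ, (g x : ℂ) * ((t * x * Complex.I) ^ n / n.factorial) =
            (t * Complex.I) ^ n / n.factorial * ((g x * x ^ n : ℝ) : ℂ) := by
          intro x; push_cast; ring
        simp only [e]
        rw [integral_const_mul, integral_complex_ofReal, h n]
        simp
      simp only [this]
      exact hasSum_zero
    · have e : ∀ x, ∑' n : ℕ, |g x| * (|t * x| ^ n / n.factorial) = |g x| * Real.exp |t * x| := by
        intro x
        rw [tsum_mul_left, Real.exp_eq_exp_ℝ, NormedSpace.exp_eq_tsum_div]
      simp only [e]
      exact (hg.abs).integrable_mul (memLp_two_exp_abs_gaussianReal t)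
    · rw [Complex.exp_eq_exp_ℂ]
      exact NormedSpace.expSeries_div_hasSum_exp _
  have key : γ.withDensity (fun x => ENNReal.ofReal (g x)) =
      γ.withDensity (fun x => ENNReal.ofReal (-g x)) := by
    have hf1 : IsFiniteMeasure (γ.withDensity fun x => ENNReal.ofReal (g x)) :=
      isFiniteMeasure_withDensity_ofReal hgi.2
    have hf2 : IsFiniteMeasure (γ.withDensity fun x => ENNReal.ofReal (-g x)) :=
      isFiniteMeasure_withDensity_ofReal hgi.neg.2
    refine Measure.ext_of_charFun (funext fun t => ?_)
    have hwd : ∀ u : ℝ → ℝ, AEMeasurable u γ →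
        charFun (γ.withDensity fun x => ENNReal.ofReal (u x)) t =
        ∫ x, ((max (u x) 0 : ℝ) : ℂ) * Complex.exp (t * x * Complex.I) ∂γ := by
      intro u hu
      rw [charFun_apply_real, integral_withDensity_eq_integral_toReal_smul₀ hu.ennreal_ofReal
        (.of_forall fun _ => ENNReal.ofReal_lt_top)]
      rfl
    have hie : ∀ u : ℝ → ℝ, Integrable u γ →
        Integrable (fun x => (u x : ℂ) * Complex.exp (t * x * Complex.I)) γ := fun u hu =>
      hu.ofReal.mul_bdd (c := 1)
        (by fun_prop : Measurable fun x : ℝ => Complex.exp (t * x * Complex.I)).aestronglyMeasurable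
        (.of_forall fun x => by
          rw [← Complex.ofReal_mul, Complex.norm_exp_ofReal_mul_I])
    rw [hwd _ hgi.aemeasurable, hwd (fun x => -g x) hgi.neg.aemeasurable, ← sub_eq_zero,
      ← integral_sub (hie _ hgi.pos_part) (hie _ hgi.neg_part), ← hchar t]
    congr 1; ext x
    rw [← sub_mul, ← Complex.ofReal_sub]
    congr 2
    exact posPart_sub_negPart (g x)
  have hfin : ∫⁻ x, ENNReal.ofReal (g x) ∂γ ≠ ⊤ := hgi.lintegral_lt_top.ne
  rw [withDensity_eq_iff hgi.aemeasurable.ennreal_ofReal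
    (AEMeasurable.ennreal_ofReal (f := fun x => -g x) hgi.neg.aemeasurable) hfin] at key
  filter_upwards [key] with x hx
  rcases lt_trichotomy (g x) 0 with h | h | h
  · rw [ENNReal.ofReal_of_nonpos h.le] at hx
    have := ENNReal.ofReal_eq_zero.1 hx.symm
    simp only [Pi.zero_apply]; linarith
  · exact h
  · have h2 : ENNReal.ofReal (-g x) = 0 := ENNReal.ofReal_of_nonpos (by linarith)
    rw [h2] at hx
    have := ENNReal.ofReal_eq_zero.1 hx
    simp only [Pi.zero_apply]; linarith

lemma memLp_two_realHermite (n : ℕ) :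
    MemLp (fun x => (realHermite n).eval x) 2 (gaussianReal 0 1) :=
  (memAllLp_id_gaussianReal.polynomial (realHermite n)) 2 (by simp)

/-- Hermite polynomials are monic of each degree, so the power moments vanish successively. -/
lemma ae_eq_zero_of_integral_mul_realHermite_eq_zero {g : ℝ → ℝ} (hg : MemLp g 2 (gaussianReal 0 1))
    (h : ∀ n : ℕ, ∫ x, g x * (realHermite n).eval x ∂(gaussianReal 0 1) = 0) :
    g =ᵐ[gaussianReal 0 1] 0 := by
  refine ae_eq_zero_of_integral_mul_pow_eq_zero hg fun n => ?_
  have hi : ∀ m : ℕ, Integrable (fun x => g x * x ^ m) (gaussianReal 0 1) := fun m => by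
    have := (memAllLp_id_gaussianReal.polynomial (Polynomial.X ^ m)) 2 (by simp)
    exact hg.integrable_mul (by simpa using this)
  induction n using Nat.strong_induction_on with
  | _ n ih =>
    have h1 := h n
    rw [(realHermite.monic n).as_sum, realHermite.natDegree_eq] at h1
    simp only [Polynomial.eval_add, Polynomial.eval_pow, Polynomial.eval_X,
      Polynomial.eval_finsetSum, Polynomial.eval_mul, Polynomial.eval_C, mul_add,
      Finset.mul_sum] at h1
    have e : ∀ (x : ℝ) (i : ℕ), g x * ((realHermite n).coeff i * x ^ i) =
      (realHermite n).coeff i * (g x * x ^ i) := fun x i => by ring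
    simp only [e] at h1
    rw [integral_add (hi n) (integrable_finsetSum _ fun i _ => (hi i).const_mul _),
      integral_finsetSum _ fun i _ => (hi i).const_mul _] at h1
    rw [Finset.sum_eq_zero fun i hi => by
      rw [integral_const_mul, ih i (Finset.mem_range.1 hi), mul_zero]] at h1
    simpa using h1

/-- The identity on the Gaussian line is a field with a single point, so orthogonality of the
Hermite polynomials becomes the case of covariance 1 of the general formula. -/
lemma isStdGaussianField_id :
    IsStdGaussianField (fun (_ : Unit) (x : ℝ) => x) (gaussianReal 0 1) where
  isGaussianProcess := ⟨fun I => (HasGaussianLaw.map (X := (id : ℝ → ℝ)) IsGaussian.hasGaussianLaw_id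
    (ContinuousLinearMap.pi fun _ : I => ContinuousLinearMap.id ℝ ℝ))⟩
  hasLaw _ := ⟨aemeasurable_id, Measure.map_id⟩
  measurable := measurable_snd

lemma integral_realHermite_mul_realHermite (k l : ℕ) :
    ∫ x, (realHermite k).eval x * (realHermite l).eval x ∂(gaussianReal 0 1) =
      if k = l then (k.factorial : ℝ) else 0 := by
  have h := isStdGaussianField_id.integral_realHermite_mul () () k l
  have h1 := isStdGaussianField_id.covKernel_self ()
  rw [h1] at h
  simpa using h

/-- The coefficients of a function in the Hermite expansion. -/
noncomputable def hermiteCoeff (f : ℝ → ℝ) (k : ℕ) : ℝ :=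
  (∫ x, f x * (realHermite k).eval x ∂(gaussianReal 0 1)) / k.factorial

/-- The remainder of order `N` in the Hermite expansion of a function. -/
noncomputable def hermiteRemainder (f : ℝ → ℝ) (N : ℕ) (x : ℝ) : ℝ :=
  f x - ∑ k ∈ Finset.range N, hermiteCoeff f k * (realHermite k).eval x

lemma inner_toLp_two {Ω : Type*} [MeasurableSpace Ω] {P : Measure Ω} {u v : Ω → ℝ}
    (hu : MemLp u 2 P) (hv : MemLp v 2 P) :
    inner ℝ (hu.toLp u) (hv.toLp v) = ∫ ω, u ω * v ω ∂P := by
  rw [L2.inner_def]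
  refine integral_congr_ae ?_
  filter_upwards [hu.coeFn_toLp, hv.coeFn_toLp] with ω h1 h2
  rw [h1, h2, real_inner_eq_re_inner]
  simp [mul_comm]

lemma norm_toLp_two_sq {Ω : Type*} [MeasurableSpace Ω] {P : Measure Ω} {u : Ω → ℝ}
    (hu : MemLp u 2 P) : ‖hu.toLp u‖ ^ 2 = ∫ ω, u ω ^ 2 ∂P := by
  rw [← real_inner_self_eq_norm_sq, inner_toLp_two hu hu]
  simp only [sq]

lemma memLp_two_hermiteRemainder {f : ℝ → ℝ} (hf : MemLp f 2 (gaussianReal 0 1)) (N : ℕ) :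
    MemLp (hermiteRemainder f N) 2 (gaussianReal 0 1) :=
  hf.sub (memLp_finsetSum _ fun k _ => (memLp_two_realHermite k).const_mul _)

/-- The Hermite polynomials divided by √k! are orthonormal, and nothing but zero is orthogonal to
all of them, so they form a Hilbert basis whose partial sums are the ones subtracted in the
remainder. -/
lemma tendsto_integral_sq_hermiteRemainder {f : ℝ → ℝ} (hf : MemLp f 2 (gaussianReal 0 1)) :
    Tendsto (fun N => ∫ x, hermiteRemainder f N x ^ 2 ∂(gaussianReal 0 1)) atTop (𝓝 0) := by
  set γ := gaussianReal 0 1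
  let H : ℕ → Lp ℝ 2 γ := fun k => (memLp_two_realHermite k).toLp _
  have hHH : ∀ k l, inner ℝ (H k) (H l) = if k = l then (k.factorial : ℝ) else 0 := fun k l => by
    rw [inner_toLp_two, integral_realHermite_mul_realHermite]
  let v : ℕ → Lp ℝ 2 γ := fun k => (√(k.factorial : ℝ))⁻¹ • H k
  have hsq : ∀ k : ℕ, √(k.factorial : ℝ) * √(k.factorial : ℝ) = k.factorial := fun k =>
    Real.mul_self_sqrt (Nat.cast_nonneg _)
  have hsq0 : ∀ k : ℕ, √(k.factorial : ℝ) ≠ 0 := fun k =>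
    (Real.sqrt_pos.2 (Nat.cast_pos.2 k.factorial_pos)).ne'
  have hv : Orthonormal ℝ v := by
    rw [orthonormal_iff_ite]
    intro k l
    simp only [v, inner_smul_left, inner_smul_right, hHH]
    by_cases hkl : k = l
    · subst hkl
      have := hsq k
      have := hsq0 k
      simp only [if_true, map_inv₀, RCLike.conj_to_real]
      field_simp
      linarith [hsq k]
    · simp [hkl]
  have hsp : (Submodule.span ℝ (Set.range v))ᗮ = ⊥ := by
    rw [Submodule.eq_bot_iff]
    intro g hg
    have hgk : ∀ k, inner ℝ (H k) g = 0 := by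
      intro k
      have := (Submodule.mem_orthogonal _ g).1 hg (v k) (Submodule.subset_span ⟨k, rfl⟩)
      simpa [v, inner_smul_left, hsq0 k] using this
    have hg0 := ae_eq_zero_of_integral_mul_realHermite_eq_zero (Lp.memLp g) fun k => by
      have h := hgk k
      rw [← Lp.toLp_coeFn g (Lp.memLp g), inner_toLp_two] at h
      simpa [mul_comm] using h
    exact (Lp.eq_zero_iff_ae_eq_zero).2 hg0
  let B := HilbertBasis.mkOfOrthogonalEqBot hv hsp
  have hB := (B.hasSum_repr (hf.toLp f)).tendsto_sum_nat
  have hterm : ∀ k, B.repr (hf.toLp f) k • B k = hermiteCoeff f k • H k := by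
    intro k
    have hBk : B k = v k := by simp [B]
    rw [B.repr_apply_apply, hBk]
    simp only [v, inner_smul_left, smul_smul]
    congr 1
    rw [real_inner_comm, inner_toLp_two hf, hermiteCoeff]
    simp only [RCLike.conj_to_real]
    calc _ = (∫ ω, f ω * (realHermite k).eval ω ∂γ) / (√(k.factorial : ℝ) * √(k.factorial : ℝ)) := by
          field_simp
      _ = _ := by rw [hsq k]
  simp only [hterm] at hB
  have h0 : Tendsto (fun N => ‖hf.toLp f - ∑ k ∈ Finset.range N, hermiteCoeff f k • H k‖ ^ 2)
      atTop (𝓝 0) := by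
    have := ((hB.const_sub (hf.toLp f)).norm).pow 2
    simpa using this
  refine h0.congr fun N => ?_
  rw [← norm_toLp_two_sq (memLp_two_hermiteRemainder hf N)]
  congr 2
  have hsum : ∑ k ∈ Finset.range N, hermiteCoeff f k • H k =
      (memLp_finsetSum (Finset.range N) fun k _ =>
        (memLp_two_realHermite k).const_mul (hermiteCoeff f k)).toLp _ := by
    induction N with
    | zero => simp
    | succ N ih =>
      rw [Finset.sum_range_succ, ih, ← MemLp.toLp_const_smul, ← MemLp.toLp_add]
      refine MemLp.toLp_congr _ _ (.of_forall fun x => ?_)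
      simp [Finset.sum_range_succ]
  rw [hsum, ← MemLp.toLp_sub]
  rfl

lemma IsStdGaussianField.integral_sum_realHermite_mul {T Ω : Type*} [MeasurableSpace T]
    [MeasurableSpace Ω] {P : Measure Ω} [IsProbabilityMeasure P] {Y : T → Ω → ℝ}
    (hY : IsStdGaussianField Y P) (x y : T) (s : Finset ℕ) (a : ℕ → ℝ) :
    ∫ ω, (∑ k ∈ s, a k * (realHermite k).eval (Y x ω)) *
        (∑ k ∈ s, a k * (realHermite k).eval (Y y ω)) ∂P =
      ∑ k ∈ s, a k ^ 2 * (k.factorial * covKernel Y P x y ^ k) := by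
  have hi : ∀ k l, Integrable (fun ω => (a k * (realHermite k).eval (Y x ω)) *
      (a l * (realHermite l).eval (Y y ω))) P := fun k l =>
    (((MemAllLp.const (a k)).mul ((hY.memAllLp x).polynomial _)).mul
      ((MemAllLp.const (a l)).mul ((hY.memAllLp y).polynomial _))).integrable
  simp only [Finset.sum_mul_sum]
  rw [integral_finsetSum _ fun k _ => integrable_finsetSum _ fun l _ => hi k l]
  refine Finset.sum_congr rfl fun k hk => ?_
  rw [integral_finsetSum _ fun l _ => hi k l]
  simp only [mul_mul_mul_comm, integral_const_mul, hY.integral_realHermite_mul]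
  simp [hk, sq]

/-- The covariance of the Hermite remainders at two correlated normal variables. -/
lemma IsStdGaussianField.abs_integral_hermiteRemainder_mul_le {T Ω : Type*} [MeasurableSpace T]
    [MeasurableSpace Ω] {P : Measure Ω} [IsProbabilityMeasure P] {Y : T → Ω → ℝ}
    (hY : IsStdGaussianField Y P) {f : ℝ → ℝ} (hf : MemLp f 2 (gaussianReal 0 1)) (N : ℕ) (x y : T) :
    |∫ ω, hermiteRemainder f N (Y x ω) * hermiteRemainder f N (Y y ω) ∂P| ≤
      |covKernel Y P x y| ^ N * ∫ u, hermiteRemainder f N u ^ 2 ∂(gaussianReal 0 1) := by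
  set γ := gaussianReal 0 1 with hγ
  set R := hermiteRemainder f N
  have hmp : ∀ z, MeasurePreserving (Y z) P γ := fun z => ⟨hY.measurable_apply z, (hY.hasLaw z).map_eq⟩
  -- Truncations of the remainder. For them both sides are explicit sums over k ≥ N, where |ρ|^k ≤
  -- |ρ|^N term by term.
  let p : ℕ → Polynomial ℝ := fun M => ∑ k ∈ Finset.Ico N M, Polynomial.C (hermiteCoeff f k) * realHermite k
  have hpe : ∀ M u, (p M).eval u = ∑ k ∈ Finset.Ico N M, hermiteCoeff f k * (realHermite k).eval u := by
    intro M u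
    simp [p, Polynomial.eval_finsetSum]
  have hp2 : ∀ M, MemLp (fun u => (p M).eval u) 2 γ := fun M =>
    (memAllLp_id_gaussianReal.polynomial (p M)) 2 (by simp)
  have hR2 : MemLp R 2 γ := memLp_two_hermiteRemainder hf N
  have hlim : Tendsto (fun M => (hp2 M).toLp _) atTop (𝓝 (hR2.toLp R)) := by
    rw [tendsto_iff_norm_sub_tendsto_zero]
    have h := (tendsto_integral_sq_hermiteRemainder hf).sqrt
    rw [Real.sqrt_zero] at h
    refine h.congr' ?_
    filter_upwards [eventually_ge_atTop N] with M hM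
    rw [← MemLp.toLp_sub, ← Real.sqrt_sq (norm_nonneg _), norm_toLp_two_sq]
    congr 2; ext u
    simp only [Pi.sub_apply, hpe, R, hermiteRemainder]
    rw [← Finset.sum_range_add_sum_Ico _ hM]
    ring
  -- Composition with each value of the field is an isometry from L²(γ) to L²(P), so the covariance
  -- is a continuous function of g and the inequality passes to the limit M → ∞.
  have hbil : ∀ g : ℝ → ℝ, ∀ hg : MemLp g 2 γ,
      inner ℝ (Lp.compMeasurePreserving (Y x) (hmp x) (hg.toLp g))
        (Lp.compMeasurePreserving (Y y) (hmp y) (hg.toLp g)) = ∫ ω, g (Y x ω) * g (Y y ω) ∂P := by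
    intro g hg
    rw [Lp.toLp_compMeasurePreserving, Lp.toLp_compMeasurePreserving, inner_toLp_two]
    rfl
  have hl1 : Tendsto (fun M => ∫ ω, (p M).eval (Y x ω) * (p M).eval (Y y ω) ∂P) atTop
      (𝓝 (∫ ω, R (Y x ω) * R (Y y ω) ∂P)) := by
    rw [← hbil R hR2]
    simp only [← fun M => hbil _ (hp2 M)]
    exact ((Lp.isometry_compMeasurePreserving (hmp x)).continuous.tendsto _ |>.comp hlim).inner
      ((Lp.isometry_compMeasurePreserving (hmp y)).continuous.tendsto _ |>.comp hlim)
  have hl2 : Tendsto (fun M => ∫ u, (p M).eval u ^ 2 ∂γ) atTop (𝓝 (∫ u, R u ^ 2 ∂γ)) := by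
    rw [← norm_toLp_two_sq hR2]
    simp only [← fun M => norm_toLp_two_sq (hp2 M)]
    exact hlim.norm.pow 2
  refine le_of_tendsto_of_tendsto' hl1.abs (hl2.const_mul _) fun M => ?_
  have e2 : ∫ u, (p M).eval u ^ 2 ∂γ =
      ∑ k ∈ Finset.Ico N M, hermiteCoeff f k ^ 2 * k.factorial := by
    have := isStdGaussianField_id.integral_sum_realHermite_mul () () (Finset.Ico N M) (hermiteCoeff f)
    rw [isStdGaussianField_id.covKernel_self] at this
    simpa [sq, hpe] using this
  simp only [hpe] at e2 ⊢
  rw [e2, hY.integral_sum_realHermite_mul, Finset.mul_sum]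
  refine (Finset.abs_sum_le_sum_abs _ _).trans (Finset.sum_le_sum fun k hk => ?_)
  rw [abs_mul, abs_mul, abs_pow (covKernel Y P x y), abs_of_nonneg (sq_nonneg (hermiteCoeff f k)),
    Nat.abs_cast]
  have := pow_le_pow_of_le_one (abs_nonneg (covKernel Y P x y)) (hY.abs_covKernel_le_one x y)
    (Finset.mem_Ico.1 hk).1
  have h0 : 0 ≤ hermiteCoeff f k ^ 2 * k.factorial := by positivity
  nlinarith

lemma hermiteCoeff_eq_zero_of_odd {f : ℝ → ℝ} (hf : ∀ x, f (-x) = f x) {k : ℕ} (hk : Odd k) :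
    hermiteCoeff f k = 0 := by
  have hmp : MeasurePreserving (fun x : ℝ => -x) (gaussianReal 0 1) (gaussianReal 0 1) :=
    ⟨measurable_neg, by simpa using gaussianReal_map_neg (μ := 0) (v := 1)⟩
  have h := hmp.integral_comp (MeasurableEquiv.neg ℝ).measurableEmbedding
    fun x => f x * (realHermite k).eval x
  simp only [hf, realHermite.eval_neg, hk.neg_one_pow] at h
  have h2 : ∫ x, f x * (realHermite k).eval x ∂(gaussianReal 0 1) = 0 := by
    have e : ∀ x, f x * (-1 * (realHermite k).eval x) = -(f x * (realHermite k).eval x) := fun x => by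
      ring
    simp only [e, integral_neg] at h
    linarith
  rw [hermiteCoeff, h2, zero_div]

/-- Otherwise every remainder of order at least 1 is f minus its mean, while the remainders tend to
zero in L². -/
lemma exists_hermiteCoeff_ne_zero {f : ℝ → ℝ} (hf : MemLp f 2 (gaussianReal 0 1))
    (hfconst : ¬ ∃ c : ℝ, f =ᵐ[gaussianReal 0 1] fun _ => c) :
    ∃ k, 1 ≤ k ∧ hermiteCoeff f k ≠ 0 := by
  by_contra! h
  refine hfconst ⟨hermiteCoeff f 0, ?_⟩
  have hr : ∀ N, 1 ≤ N → hermiteRemainder f N = fun x => f x - hermiteCoeff f 0 := by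
    intro N hN
    ext x
    rw [hermiteRemainder, Finset.sum_eq_single 0]
    · simp
    · intro k _ hk
      rw [h k (Nat.one_le_iff_ne_zero.2 hk), zero_mul]
    · intro h0; simp at h0; omega
  have h0 : ∫ x, (f x - hermiteCoeff f 0) ^ 2 ∂(gaussianReal 0 1) = 0 := by
    refine tendsto_nhds_unique ?_ (tendsto_integral_sq_hermiteRemainder hf)
    refine tendsto_const_nhds.congr' ?_
    filter_upwards [eventually_ge_atTop 1] with N hN
    rw [hr N hN]
  have hm : MemLp (fun x => f x - hermiteCoeff f 0) 2 (gaussianReal 0 1) := hf.sub (memLp_const _)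
  rw [integral_eq_zero_iff_of_nonneg (fun _ => sq_nonneg _) hm.integrable_sq] at h0
  filter_upwards [h0] with x hx
  have : f x - hermiteCoeff f 0 = 0 := by simpa using hx
  linarith

/-- The Hermite rank of a symmetric function is a positive even number. -/
lemma exists_hermiteRank {f : ℝ → ℝ} (hf : MemLp f 2 (gaussianReal 0 1)) (hfsymm : ∀ x, f (-x) = f x)
    (hfconst : ¬ ∃ c : ℝ, f =ᵐ[gaussianReal 0 1] fun _ => c) :
    ∃ K, 2 ≤ K ∧ Even K ∧ hermiteCoeff f K ≠ 0 ∧ ∀ k, 1 ≤ k → k < K → hermiteCoeff f k = 0 := by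
  classical
  have h := exists_hermiteCoeff_ne_zero hf hfconst
  refine ⟨Nat.find h, ?_, ?_, (Nat.find_spec h).2, fun k hk hlt => ?_⟩
  · have h1 := Nat.find_spec h
    by_contra hlt
    have : Nat.find h = 1 := by omega
    exact h1.2 (hermiteCoeff_eq_zero_of_odd hfsymm (by rw [this]; exact odd_one))
  · by_contra hodd
    exact (Nat.find_spec h).2 (hermiteCoeff_eq_zero_of_odd hfsymm (Nat.not_even_iff_odd.1 hodd))
  · by_contra hne
    exact Nat.find_min h hlt ⟨hk, hne⟩

lemma hermiteCoeff_zero (f : ℝ → ℝ) : hermiteCoeff f 0 = ∫ x, f x ∂(gaussianReal 0 1) := by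
  simp [hermiteCoeff]

lemma hermiteCoeff_congr {f g : ℝ → ℝ} (h : f =ᵐ[gaussianReal 0 1] g) (k : ℕ) :
    hermiteCoeff f k = hermiteCoeff g k := by
  rw [hermiteCoeff, hermiteCoeff]
  congr 1
  refine integral_congr_ae ?_
  filter_upwards [h] with x hx
  rw [hx]

end HermiteBasis

/-! ### Contraction for a concave variance function. -/

/-- The correlation at lag `s` of the increments of step `h` of a process with stationary
increments and increment variance function `φ`. -/
noncomputable def incrementCorr (φ : ℝ → ℝ) (h s : ℝ) : ℝ :=
  (φ (s + h) + φ (s - h) - 2 * φ s) / (2 * φ h)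

lemma Measurable.incrementCorr {φ : ℝ → ℝ} (hφ : Measurable φ) (h : ℝ) :
    Measurable (incrementCorr φ h) := by
  unfold _root_.incrementCorr
  fun_prop

/-- Chebyshev's integral inequality: (x - y)(x^k - y^k) ≥ 0 for nonnegative x, y, integrated over
the square [0,c]². -/
lemma integral_mul_integral_pow_le {u : ℝ → ℝ} {c : ℝ} (hc : 0 ≤ c) (k : ℕ)
    (hu : ∀ s ∈ Set.Icc 0 c, 0 ≤ u s)
    (hi : ∀ j : ℕ, IntervalIntegrable (fun s => u s ^ j) volume 0 c) :
    (∫ s in (0)..c, u s) * (∫ s in (0)..c, u s ^ k) ≤ c * ∫ s in (0)..c, u s ^ (k + 1) := by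
  have hi1 : IntervalIntegrable u volume 0 c := by simpa using hi 1
  have hpt : ∀ x y : ℝ, 0 ≤ x → 0 ≤ y → x * y ^ k + y * x ^ k ≤ x ^ (k + 1) + y ^ (k + 1) := by
    intro x y hx hy
    have : 0 ≤ (x - y) * (x ^ k - y ^ k) := by
      rcases le_total x y with h | h
      · exact mul_nonneg_of_nonpos_of_nonpos (by linarith) (by linarith [pow_le_pow_left₀ hx h k])
      · exact mul_nonneg (by linarith) (by linarith [pow_le_pow_left₀ hy h k])
    linear_combination this
  set A := ∫ s in (0)..c, u s
  set B := ∫ s in (0)..c, u s ^ k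
  set E := ∫ s in (0)..c, u s ^ (k + 1)
  have h1 : ∀ t ∈ Set.Icc 0 c, A * u t ^ k + u t * B ≤ E + c * u t ^ (k + 1) := by
    intro t ht
    have e1 : A * u t ^ k + u t * B = ∫ s in (0)..c, (u s * u t ^ k + u t * u s ^ k) := by
      rw [intervalIntegral.integral_add (hi1.mul_const _) ((hi k).const_mul _),
        intervalIntegral.integral_mul_const, intervalIntegral.integral_const_mul]
    have e2 : E + c * u t ^ (k + 1) = ∫ s in (0)..c, (u s ^ (k + 1) + u t ^ (k + 1)) := by
      rw [intervalIntegral.integral_add (hi _) (by simp), intervalIntegral.integral_const]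
      simp [E]
    rw [e1, e2]
    exact intervalIntegral.integral_mono_on hc ((hi1.mul_const _).add ((hi k).const_mul _))
      ((hi _).add (by simp)) fun s hs => hpt _ _ (hu s hs) (hu t ht)
  have h2 := intervalIntegral.integral_mono_on hc (((hi k).const_mul A).add (hi1.mul_const B))
    ((intervalIntegrable_const (c := E)).add ((hi (k + 1)).const_mul c)) h1
  rw [intervalIntegral.integral_add ((hi k).const_mul A) (hi1.mul_const B),
    intervalIntegral.integral_add (by simp) ((hi _).const_mul c),
    intervalIntegral.integral_const_mul, intervalIntegral.integral_mul_const,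
    intervalIntegral.integral_const_mul, intervalIntegral.integral_const] at h2
  simp only [sub_zero, smul_eq_mul] at h2
  linarith

section Concave

variable {φ : ℝ → ℝ}

/-- The points t and s + h are convex combinations of s and t + h with interchanged weights; adding
the two concavity inequalities gives the claim. -/
lemma ConcaveOn.sub_le_sub_shift (hφ : ConcaveOn ℝ (Set.Ici 0) φ)
    {s t h : ℝ} (hs : 0 ≤ s) (hst : s ≤ t) (hh : 0 < h) :
    φ (t + h) - φ t ≤ φ (s + h) - φ s := by
  have hd : 0 < t + h - s := by linarith
  set w := h / (t + h - s) with hw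
  have hw0 : 0 ≤ w := by positivity
  have hw1 : 0 ≤ 1 - w := by
    rw [hw, sub_nonneg, div_le_one hd]; linarith
  have hwd : w * (t + h - s) = h := div_mul_cancel₀ _ hd.ne'
  have h1 := hφ.2 (show s ∈ Set.Ici 0 from hs) (show t + h ∈ Set.Ici 0 by simp; linarith)
    hw0 hw1 (by ring)
  have h2 := hφ.2 (show s ∈ Set.Ici 0 from hs) (show t + h ∈ Set.Ici 0 by simp; linarith)
    hw1 hw0 (by ring)
  simp only [smul_eq_mul] at h1 h2
  rw [show w * s + (1 - w) * (t + h) = t by linear_combination -hwd] at h1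
  rw [show (1 - w) * s + w * (t + h) = s + h by linear_combination hwd] at h2
  linarith

/-- A strict decrease with slope -m persists by concavity, so at distance (φ y + 1)/m beyond y the
value would be at most -1. -/
lemma ConcaveOn.monotoneOn_of_nonneg (hφ : ConcaveOn ℝ (Set.Ici 0) φ) (h0 : ∀ s, 0 ≤ φ s)
    : MonotoneOn φ (Set.Ici 0) := by
  intro x hx y hy hxy
  by_contra! hlt
  have hne : x < y := lt_of_le_of_ne hxy fun h => by rw [h] at hlt; exact lt_irrefl _ hlt
  set m := (φ x - φ y) / (y - x) with hm
  have hm0 : 0 < m := div_pos (by linarith) (by linarith)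
  have hz : y < y + (φ y + 1) / m := by
    have := h0 y
    have : 0 < (φ y + 1) / m := by positivity
    linarith
  have hs := hφ.slope_anti_adjacent hx (show y + (φ y + 1) / m ∈ Set.Ici 0 from hy.out.trans hz.le) hne hz
  rw [add_sub_cancel_left, div_le_iff₀ (by linarith)] at hs
  have : (φ y - φ x) / (y - x) * ((φ y + 1) / m) = -(φ y + 1) := by
    have : (φ y - φ x) / (y - x) = -m := by rw [hm]; ring
    rw [this]; field_simp
  linarith [h0 (y + (φ y + 1) / m)]

/-- Beyond x monotonicity applies; before x the graph lies above the chord from the origin. -/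
lemma ConcaveOn.pos_of_exists_ne_zero (hφ : ConcaveOn ℝ (Set.Ici 0) φ) (h0 : ∀ s, 0 ≤ φ s)
    (hzero : φ 0 = 0) (hne : ∃ x, 0 < x ∧ φ x ≠ 0) {h : ℝ}
    (hh : 0 < h) : 0 < φ h := by
  obtain ⟨x, hx, hφx⟩ := hne
  have hxpos : 0 < φ x := lt_of_le_of_ne (h0 x) hφx.symm
  rcases le_total x h with hle | hle
  · exact hxpos.trans_le (hφ.monotoneOn_of_nonneg h0 hx.le hh.le hle)
  · have h1 := hφ.2 (show (0 : ℝ) ∈ Set.Ici 0 from Set.self_mem_Ici) (show x ∈ Set.Ici 0 from hx.le)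
      (show 0 ≤ 1 - h / x by rw [sub_nonneg, div_le_one hx]; exact hle) (show 0 ≤ h / x by positivity)
      (by ring)
    simp only [smul_eq_mul, hzero, mul_zero, zero_add] at h1
    rw [div_mul_cancel₀ _ hx.ne'] at h1
    exact lt_of_lt_of_le (by positivity) h1

end Concave

lemma intervalIntegrable_abs_incrementCorr_pow {φ : ℝ → ℝ} (hφm : Measurable φ) {h : ℝ}
    (hb : ∀ s, |incrementCorr φ h s| ≤ 1) (j : ℕ) (a b : ℝ) :
    IntervalIntegrable (fun s => |incrementCorr φ h s| ^ j) volume a b := by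
  refine (intervalIntegrable_const (c := (1 : ℝ))).mono_fun
    (((hφm.incrementCorr h).abs.pow_const j).aestronglyMeasurable) (.of_forall fun s => ?_)
  dsimp only
  rw [Real.norm_of_nonneg (by positivity), norm_one]
  exact pow_le_one₀ (abs_nonneg _) (hb s)

section ConcaveBound

variable {φ : ℝ → ℝ} {h : ℝ}

/-- For a concave variance function, the correlation is comparable, in every mean, with the
normalized increments of the variance function near zero. -/
lemma ConcaveOn.integral_abs_incrementCorr_pow_le (hφ : ConcaveOn ℝ (Set.Ici 0) φ)
    (h0 : ∀ s, 0 ≤ φ s) (hφm : Measurable φ) (heven : ∀ s, φ (-s) = φ s)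
    (hh : 0 < h) (hφh : 0 < φ h) (hb : ∀ s, |incrementCorr φ h s| ≤ 1) {L : ℝ} (hL : h ≤ L)
    {j : ℕ} (hj : 1 ≤ j) :
    ∫ s in (0)..L, |incrementCorr φ h s| ^ j ≤
      (2 ^ j + 3) * ∫ s in (0)..(h / 2), ((φ (s + h) - φ s) / (2 * φ h)) ^ j := by
  set ρ := incrementCorr φ h with hρ
  set D : ℝ → ℝ := fun s => (φ (s + h) - φ s) / (2 * φ h) with hD
  have hmono := hφ.monotoneOn_of_nonneg h0
  have hDanti : ∀ s t, 0 ≤ s → s ≤ t → D t ≤ D s := fun s t hs hst => by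
    have := hφ.sub_le_sub_shift hs hst hh
    simp only [hD]; gcongr
  have hD0 : ∀ s, 0 ≤ s → 0 ≤ D s := fun s hs => by
    have := hmono (show s ∈ Set.Ici 0 from hs) (show s + h ∈ Set.Ici 0 by simp; linarith) (by linarith)
    exact div_nonneg (by linarith) (by linarith)
  have hDi : ∀ a b, 0 ≤ a → 0 ≤ b → IntervalIntegrable (fun s => D s ^ j) volume a b := by
    intro a b ha hb'
    refine AntitoneOn.intervalIntegrable fun s hs t ht hst => ?_
    have hs0 : 0 ≤ s := (le_min ha hb').trans hs.1
    exact pow_le_pow_left₀ (hD0 t (hs0.trans hst)) (hDanti s t hs0 hst) j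
  have hρi := intervalIntegrable_abs_incrementCorr_pow hφm hb j
  -- the three ranges of the lag
  have hA : ∀ s, 0 ≤ s → s ≤ h / 2 → |ρ s| ≤ 2 * D s := by
    intro s hs hsh
    have e : ρ s = D s + (φ (h - s) - φ s) / (2 * φ h) := by
      simp only [hρ, hD, incrementCorr]
      rw [show s - h = -(h - s) by ring, heven]; ring
    have h1 : φ s ≤ φ (h - s) := hmono (show s ∈ Set.Ici 0 from hs)
      (show h - s ∈ Set.Ici 0 by simp; linarith) (by linarith)
    have h2 : φ (h - s) ≤ φ (s + h) := hmono
      (show h - s ∈ Set.Ici 0 by simp; linarith) (show s + h ∈ Set.Ici 0 by simp; linarith) (by linarith)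
    have h3 : 0 ≤ (φ (h - s) - φ s) / (2 * φ h) := div_nonneg (by linarith) (by linarith)
    have h4 : (φ (h - s) - φ s) / (2 * φ h) ≤ D s := by simp only [hD]; gcongr
    rw [e, abs_of_nonneg (by linarith [hD0 s hs])]
    linarith
  have hB : ∀ s, h / 2 ≤ s → s ≤ h → |ρ s| ≤ D (h - s) := by
    intro s hs hsh
    have e : ρ s = D s - (φ s - φ (h - s)) / (2 * φ h) := by
      simp only [hρ, hD, incrementCorr]
      rw [show s - h = -(h - s) by ring, heven]; ring
    have h1 : φ (h - s) ≤ φ s := hmono (show h - s ∈ Set.Ici 0 by simp; linarith)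
      (show s ∈ Set.Ici 0 by simp; linarith) (by linarith)
    have h2 : φ s ≤ φ (h - s + h) := hmono
      (show s ∈ Set.Ici 0 by simp; linarith) (show h - s + h ∈ Set.Ici 0 by simp; linarith) (by linarith)
    have h3 : 0 ≤ (φ s - φ (h - s)) / (2 * φ h) := div_nonneg (by linarith) (by linarith)
    have h4 : (φ s - φ (h - s)) / (2 * φ h) ≤ D (h - s) := by simp only [hD]; gcongr
    have h5 := hDanti (h - s) s (by linarith) (by linarith)
    rw [e, abs_le]
    constructor <;> linarith [hD0 s (by linarith)]
  -- Beyond h the correlation is the nonpositive difference D(s) - D(s-h), and (x-y)^j ≤ x^j - y^j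
  -- makes the integral telescope to at most that of D^j over [0, h].
  have hC : ∀ s, h ≤ s → |ρ s| ^ j ≤ D (s - h) ^ j - D s ^ j := by
    intro s hs
    have e : ρ s = D s - D (s - h) := by
      simp only [hρ, hD, incrementCorr]
      rw [sub_add_cancel]; ring
    have h1 := hDanti (s - h) s (by linarith) (by linarith)
    have h2 := hD0 s (by linarith)
    rw [e, abs_sub_comm, abs_of_nonneg (by linarith)]
    have := pow_add_pow_le (show 0 ≤ D (s - h) - D s by linarith) h2 (by omega : j ≠ 0)
    rw [sub_add_cancel] at this
    linarith
  set A := ∫ s in (0)..(h / 2), D s ^ j with hAdef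
  have hhalf : ∫ s in (h / 2)..h, D s ^ j ≤ A := by
    have : ∫ s in (h / 2)..h, D s ^ j = ∫ s in (0)..(h / 2), D (s + h / 2) ^ j := by
      rw [intervalIntegral.integral_comp_add_right (fun s => D s ^ j)]
      congr 1 <;> ring
    rw [this]
    refine intervalIntegral.integral_mono_on (by linarith) ?_ (hDi _ _ le_rfl (by linarith)) fun s hs => ?_
    · refine AntitoneOn.intervalIntegrable fun s hs t ht hst => ?_
      have hs0 : 0 ≤ s := (le_min le_rfl (by linarith)).trans hs.1
      exact pow_le_pow_left₀ (hD0 _ (by linarith)) (hDanti _ _ (by linarith) (by linarith)) j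
    · exact pow_le_pow_left₀ (hD0 _ (by linarith [hs.1])) (hDanti _ _ hs.1 (by linarith)) j
  have i1 : ∫ s in (0)..(h / 2), |ρ s| ^ j ≤ 2 ^ j * A := by
    rw [hAdef, ← intervalIntegral.integral_const_mul]
    refine intervalIntegral.integral_mono_on (by linarith) (hρi _ _)
      ((hDi _ _ le_rfl (by linarith)).const_mul _) fun s hs => ?_
    rw [← mul_pow]
    exact pow_le_pow_left₀ (abs_nonneg _) (hA s hs.1 hs.2) j
  have i2 : ∫ s in (h / 2)..h, |ρ s| ^ j ≤ A := by
    have : A = ∫ s in (h / 2)..h, D (h - s) ^ j := by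
      rw [intervalIntegral.integral_comp_sub_left (fun s => D s ^ j)]
      rw [hAdef]; congr 1 <;> ring
    rw [this]
    refine intervalIntegral.integral_mono_on (by linarith) (hρi _ _) ?_ fun s hs =>
      pow_le_pow_left₀ (abs_nonneg _) (hB s hs.1 hs.2) j
    have := (hDi (h - h / 2) (h - h) (by linarith) (by linarith)).comp_sub_left h
    simpa using this
  have i3 : ∫ s in h..L, |ρ s| ^ j ≤ 2 * A := by
    have e1 : ∫ s in h..L, D (s - h) ^ j = ∫ s in (0)..(L - h), D s ^ j := by
      rw [intervalIntegral.integral_comp_sub_right (fun s => D s ^ j), sub_self]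
    have ii : IntervalIntegrable (fun s => D (s - h) ^ j) volume h L := by
      have := (hDi (h - h) (L - h) (by simp) (by linarith)).comp_sub_right h
      simpa using this
    have l1 := intervalIntegral.integral_mono_on hL (hρi h L) (ii.sub (hDi h L hh.le (by linarith)))
      fun s hs => hC s hs.1
    rw [intervalIntegral.integral_sub ii (hDi h L hh.le (by linarith)), e1] at l1
    have l2 : ∫ s in (0)..(L - h), D s ^ j ≤ ∫ s in (0)..L, D s ^ j := by
      rw [← intervalIntegral.integral_add_adjacent_intervals
        (hDi 0 (L - h) le_rfl (by linarith)) (hDi (L - h) L (by linarith) (by linarith))]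
      have : 0 ≤ ∫ s in (L - h)..L, D s ^ j := intervalIntegral.integral_nonneg (by linarith)
        fun s hs => pow_nonneg (hD0 s (by linarith [hs.1])) j
      linarith
    have l3 := intervalIntegral.integral_add_adjacent_intervals
        (hDi 0 h le_rfl hh.le) (hDi h L hh.le (by linarith))
    have l4 := intervalIntegral.integral_add_adjacent_intervals
        (hDi 0 (h / 2) le_rfl (by linarith)) (hDi (h / 2) h (by linarith) (by linarith))
    linarith
  -- The ranges [0, h/2], [h/2, h] and [h, L] contribute 2^j, 1 and 2 times `A`, whence the constant
  -- 2^j + 3.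
  have s1 := intervalIntegral.integral_add_adjacent_intervals (hρi 0 (h / 2)) (hρi (h / 2) h)
  have s2 := intervalIntegral.integral_add_adjacent_intervals (hρi 0 h) (hρi h L)
  change ∫ s in (0)..L, |ρ s| ^ j ≤ _
  linarith

/-- The contraction estimate for a concave variance function. -/
lemma ConcaveOn.integral_abs_incrementCorr_mul_le (hφ : ConcaveOn ℝ (Set.Ici 0) φ)
    (h0 : ∀ s, 0 ≤ φ s) (hφm : Measurable φ) (heven : ∀ s, φ (-s) = φ s)
    (hh : 0 < h) (hφh : 0 < φ h) (hb : ∀ s, |incrementCorr φ h s| ≤ 1) {L : ℝ} (hL : h ≤ L)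
    {K : ℕ} (hK : 2 ≤ K) :
    (∫ s in (0)..L, |incrementCorr φ h s|) * (∫ s in (0)..L, |incrementCorr φ h s| ^ (K - 1)) ≤
      (5 * (2 ^ (K - 1) + 3) / 2 * h) * ∫ s in (0)..(L / 2), |incrementCorr φ h s| ^ K := by
  set D : ℝ → ℝ := fun s => (φ (s + h) - φ s) / (2 * φ h) with hD
  have hmono := hφ.monotoneOn_of_nonneg h0
  have hDanti : ∀ s t, 0 ≤ s → s ≤ t → D t ≤ D s := fun s t hs hst => by
    have := hφ.sub_le_sub_shift hs hst hh
    simp only [hD]; gcongr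
  have hD0 : ∀ s, 0 ≤ s → 0 ≤ D s := fun s hs => by
    have := hmono (show s ∈ Set.Ici 0 from hs) (show s + h ∈ Set.Ici 0 by simp; linarith) (by linarith)
    exact div_nonneg (by linarith) (by linarith)
  have hDi : ∀ j : ℕ, IntervalIntegrable (fun s => D s ^ j) volume 0 (h / 2) := by
    intro j
    refine AntitoneOn.intervalIntegrable fun s hs t ht hst => ?_
    have hs0 : 0 ≤ s := (le_min le_rfl (by linarith)).trans hs.1
    exact pow_le_pow_left₀ (hD0 t (hs0.trans hst)) (hDanti s t hs0 hst) j
  -- Below h/2 the second part of the correlation is nonnegative, so `D` is also a lower bound; this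
  -- returns from D^K to |ρ|^K.
  have hA : ∀ s, 0 ≤ s → s ≤ h / 2 → D s ≤ |incrementCorr φ h s| := by
    intro s hs hsh
    have e : incrementCorr φ h s = D s + (φ (h - s) - φ s) / (2 * φ h) := by
      simp only [hD, incrementCorr]
      rw [show s - h = -(h - s) by ring, heven]; ring
    have h1 : φ s ≤ φ (h - s) := hmono (show s ∈ Set.Ici 0 from hs)
      (show h - s ∈ Set.Ici 0 by simp; linarith) (by linarith)
    have h3 : 0 ≤ (φ (h - s) - φ s) / (2 * φ h) := div_nonneg (by linarith) (by linarith)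
    refine le_trans ?_ (le_abs_self _)
    linarith
  have hlow : ∫ s in (0)..(h / 2), D s ^ K ≤ ∫ s in (0)..(L / 2), |incrementCorr φ h s| ^ K := by
    have hi := intervalIntegrable_abs_incrementCorr_pow hφm hb K
    rw [← intervalIntegral.integral_add_adjacent_intervals (hi 0 (h / 2)) (hi (h / 2) (L / 2))]
    have l1 := intervalIntegral.integral_mono_on (by linarith) (hDi K) (hi 0 (h / 2))
      fun s hs => pow_le_pow_left₀ (hD0 s hs.1) (hA s hs.1 hs.2) K
    have l2 : 0 ≤ ∫ s in (h / 2)..(L / 2), |incrementCorr φ h s| ^ K :=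
      intervalIntegral.integral_nonneg (by linarith) fun s _ => by positivity
    linarith
  have c1 := hφ.integral_abs_incrementCorr_pow_le h0 hφm heven hh hφh hb hL (le_refl 1)
  have c2 := hφ.integral_abs_incrementCorr_pow_le h0 hφm heven hh hφh hb hL
    (show 1 ≤ K - 1 by omega)
  simp only [pow_one] at c1
  -- Chebyshev on an interval of length h/2 is the source of the small factor h.
  have c3 := integral_mul_integral_pow_le (u := D) (c := h / 2) (by linarith) (K - 1)
    (fun s hs => hD0 s hs.1) hDi
  rw [show K - 1 + 1 = K by omega] at c3
  have n1 : 0 ≤ ∫ s in (0)..(h / 2), D s := intervalIntegral.integral_nonneg (by linarith)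
    fun s hs => hD0 s hs.1
  have n2 : 0 ≤ ∫ s in (0)..L, |incrementCorr φ h s| ^ (K - 1) :=
    intervalIntegral.integral_nonneg (by linarith) fun s _ => by positivity
  calc _ ≤ ((2 + 3) * ∫ s in (0)..(h / 2), D s) *
        ((2 ^ (K - 1) + 3) * ∫ s in (0)..(h / 2), D s ^ (K - 1)) :=
        mul_le_mul c1 c2 n2 (by positivity)
    _ = 5 * (2 ^ (K - 1) + 3) * ((∫ s in (0)..(h / 2), D s) * ∫ s in (0)..(h / 2), D s ^ (K - 1)) := by
        ring
    _ ≤ 5 * (2 ^ (K - 1) + 3) * (h / 2 * ∫ s in (0)..(L / 2), |incrementCorr φ h s| ^ K) := by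
        refine mul_le_mul_of_nonneg_left (c3.trans ?_) (by positivity)
        exact mul_le_mul_of_nonneg_left hlow (by linarith)
    _ = _ := by ring

end ConcaveBound

/-! ### Contraction for a power variance function. -/

section Power

/-- Second differences of a power function. -/
lemma second_difference_rpow_bounds {r : ℝ} (hr1 : 1 < r) (hr2 : r ≤ 2) {u : ℝ} (hu : 2 ≤ u) :
    r * (r - 1) / 3 * u ^ (r - 2) ≤ ((u + 1) ^ r + (u - 1) ^ r - 2 * u ^ r) / 2 ∧
      ((u + 1) ^ r + (u - 1) ^ r - 2 * u ^ r) / 2 ≤ r * (r - 1) * u ^ (r - 2) := by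
  have hrr : 0 < r * (r - 1) := mul_pos (by linarith) (by linarith)
  -- A quadratic correction makes ±(1+x)^r convex near 0; midpoint convexity at ±x then bounds the
  -- symmetric second difference, from both sides according to the sign of A.
  have hconv : ∀ A B : ℝ, (∀ x : ℝ, -(1 / 2) < x → x < 1 / 2 →
      0 ≤ A * (r * (r - 1) * (1 + x) ^ (r - 2)) + 2 * B) →
      ConvexOn ℝ (Set.Icc (-(1 / 2)) (1 / 2)) fun x : ℝ => A * (1 + x) ^ r + B * x ^ 2 := by
    intro A B hAB
    have hd : ∀ (s x : ℝ), x ∈ Set.Ioo (-(1 / 2) : ℝ) (1 / 2) →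
        HasDerivAt (fun x : ℝ => (1 + x) ^ s) (s * (1 + x) ^ (s - 1)) x := by
      intro s x hx
      have h1 : HasDerivAt (fun x : ℝ => 1 + x) 1 x := by simpa using (hasDerivAt_id x).const_add 1
      have := h1.rpow_const (p := s) (Or.inl (by linarith [hx.1]))
      simpa using this
    have hcont : ContinuousOn (fun x : ℝ => A * (1 + x) ^ r + B * x ^ 2)
        (Set.Icc (-(1 / 2)) (1 / 2)) := by
      refine Continuous.continuousOn ?_
      have : Continuous fun x : ℝ => (1 + x) ^ r :=
        (continuous_const.add continuous_id).rpow_const fun _ => Or.inr (by linarith)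
      fun_prop
    refine convexOn_of_hasDerivWithinAt2_nonneg (convex_Icc _ _) hcont
      (f' := fun x => A * (r * (1 + x) ^ (r - 1)) + B * (2 * x))
      (f'' := fun x => A * (r * ((r - 1) * (1 + x) ^ (r - 1 - 1))) + B * (2 * 1)) ?_ ?_ ?_
    · intro x hx
      rw [interior_Icc] at hx
      refine HasDerivAt.hasDerivWithinAt ?_
      refine ((hd r x hx).const_mul A).add (HasDerivAt.const_mul B ?_)
      simpa using hasDerivAt_pow 2 x
    · intro x hx
      rw [interior_Icc] at hx
      refine HasDerivAt.hasDerivWithinAt ?_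
      exact (((hd (r - 1) x hx).const_mul r).const_mul A).add
        (((hasDerivAt_id x).const_mul 2).const_mul B)
    · intro x hx
      rw [interior_Icc] at hx
      have := hAB x hx.1 hx.2
      rw [show r - 1 - 1 = r - 2 by ring]
      linarith
  have hsym : ∀ A B : ℝ, (∀ x : ℝ, -(1 / 2) < x → x < 1 / 2 →
      0 ≤ A * (r * (r - 1) * (1 + x) ^ (r - 2)) + 2 * B) → ∀ x : ℝ, 0 ≤ x → x ≤ 1 / 2 →
      0 ≤ A * ((1 + x) ^ r + (1 - x) ^ r - 2) + 2 * B * x ^ 2 := by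
    intro A B hAB x hx hx2
    have := (hconv A B hAB).2 (show x ∈ Set.Icc (-(1 / 2) : ℝ) (1 / 2) from ⟨by linarith, hx2⟩)
      (show -x ∈ Set.Icc (-(1 / 2) : ℝ) (1 / 2) from ⟨by linarith, by linarith⟩)
      (show (0 : ℝ) ≤ 1 / 2 by norm_num) (show (0 : ℝ) ≤ 1 / 2 by norm_num) (by norm_num)
    simp only [smul_eq_mul] at this
    rw [show 1 / 2 * x + 1 / 2 * -x = 0 by ring] at this
    simp only [add_zero, Real.one_rpow, even_two, Even.neg_pow, ← sub_eq_add_neg] at this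
    nlinarith
  have hx0 : 0 ≤ 1 / u := by positivity
  have hx2 : 1 / u ≤ 1 / 2 := one_div_le_one_div_of_le (by norm_num) hu
  -- As |x| < 1/2 and -1 ≤ r - 2 ≤ 0, the factor (1+x)^{r-2} lies between 2/3 and 2; these two
  -- values fix B here and in the upper bound.
  have hlo := hsym 1 (-(r * (r - 1) / 3)) (fun x h1 h2 => by
    have : (2 / 3 : ℝ) ≤ (1 + x) ^ (r - 2) := by
      calc (2 / 3 : ℝ) = (3 / 2 : ℝ) ^ (-1 : ℝ) := by rw [Real.rpow_neg_one]; norm_num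
        _ ≤ (3 / 2 : ℝ) ^ (r - 2) := Real.rpow_le_rpow_of_exponent_le (by norm_num) (by linarith)
        _ ≤ _ := Real.rpow_le_rpow_of_nonpos (by linarith) (by linarith) (by linarith)
    nlinarith) (1 / u) hx0 hx2
  have hhi := hsym (-1) (r * (r - 1)) (fun x h1 h2 => by
    have : (1 + x) ^ (r - 2) ≤ 2 := by
      calc (1 + x) ^ (r - 2) ≤ (1 / 2 : ℝ) ^ (r - 2) :=
            Real.rpow_le_rpow_of_nonpos (by norm_num) (by linarith) (by linarith)
        _ ≤ (1 / 2 : ℝ) ^ (-1 : ℝ) :=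
            Real.rpow_le_rpow_of_exponent_ge (by norm_num) (by norm_num) (by linarith)
        _ = 2 := by rw [Real.rpow_neg_one]; norm_num
    nlinarith) (1 / u) hx0 hx2
  have hu0 : 0 < u := by linarith
  have e : (u + 1) ^ r + (u - 1) ^ r - 2 * u ^ r =
      u ^ r * ((1 + 1 / u) ^ r + (1 - 1 / u) ^ r - 2) := by
    rw [mul_sub, mul_add, ← Real.mul_rpow hu0.le (by positivity),
      ← Real.mul_rpow hu0.le (by linarith)]
    rw [mul_add, mul_sub, mul_one, mul_one_div_cancel hu0.ne']
    ring
  have e2 : u ^ (r - 2) = u ^ r * (1 / u) ^ 2 := by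
    rw [Real.rpow_sub hu0, Real.rpow_two]; ring
  have hur : 0 < u ^ r := Real.rpow_pos_of_pos hu0 r
  rw [e, e2]
  constructor
  · nlinarith
  · nlinarith

variable {q : ℝ → ℝ} {c p : ℝ}

lemma intervalIntegrable_abs_pow_of_abs_le_one (hq : Measurable q) (hq1 : ∀ u, |q u| ≤ 1) (j : ℕ)
    (a b : ℝ) : IntervalIntegrable (fun u => |q u| ^ j) volume a b := by
  refine (intervalIntegrable_const (c := (1 : ℝ))).mono_fun
    ((hq.abs.pow_const j).aestronglyMeasurable) (.of_forall fun s => ?_)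
  dsimp only
  rw [Real.norm_of_nonneg (by positivity), norm_one]
  exact pow_le_one₀ (abs_nonneg _) (hq1 s)

lemma integral_abs_pow_le_two_add (hq : Measurable q) (hq1 : ∀ u, |q u| ≤ 1) (j : ℕ) {v : ℝ → ℝ} {X : ℝ}
    (hX : 2 ≤ X) (hv : IntervalIntegrable v volume 2 X) (hqv : ∀ u ∈ Set.Icc 2 X, |q u| ^ j ≤ v u) :
    ∫ u in (0)..X, |q u| ^ j ≤ 2 + ∫ u in (2)..X, v u := by
  have hi := intervalIntegrable_abs_pow_of_abs_le_one hq hq1 j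
  rw [← intervalIntegral.integral_add_adjacent_intervals (hi 0 2) (hi 2 X)]
  have h1 := intervalIntegral.integral_mono_on hX (hi 2 X) hv hqv
  have h2 := intervalIntegral.integral_mono_on (by norm_num) (hi 0 2) (intervalIntegrable_const (c := 1))
    fun u _ => pow_le_one₀ (abs_nonneg _) (hq1 u)
  simp only [intervalIntegral.integral_const, smul_eq_mul] at h2
  linarith

lemma integral_abs_le_rpow (hq : Measurable q) (hq1 : ∀ u, |q u| ≤ 1) (hp1 : p < 1)
    (hup : ∀ u, 2 ≤ u → |q u| ≤ u ^ (-p)) {X : ℝ} (hX : 2 ≤ X) :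
    ∫ u in (0)..X, |q u| ≤ (2 + 1 / (1 - p)) * X ^ (1 - p) := by
  have hi : IntervalIntegrable (fun u : ℝ => u ^ (-p)) volume 2 X :=
    intervalIntegral.intervalIntegrable_rpow' (by linarith)
  have h := integral_abs_pow_le_two_add hq hq1 1 hX hi fun u hu => by simpa using hup u hu.1
  simp only [pow_one] at h
  rw [integral_rpow (Or.inl (by linarith)), show -p + 1 = 1 - p by ring] at h
  have h1 : (1 : ℝ) ≤ X ^ (1 - p) := Real.one_le_rpow (by linarith) (by linarith)
  have h2 : (0 : ℝ) ≤ 2 ^ (1 - p) := by positivity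
  have h3 : (X ^ (1 - p) - 2 ^ (1 - p)) / (1 - p) ≤ X ^ (1 - p) / (1 - p) := by
    have : 0 < 1 - p := by linarith
    gcongr; linarith
  calc _ ≤ 2 * X ^ (1 - p) + X ^ (1 - p) / (1 - p) := by linarith
    _ = _ := by ring

/-- The left side is of order at most X^{2-2p}, while ∫q² is at least of order X^{1-2p} log X: for p
≥ 1/2, u^{1-2p} ≥ X^{1-2p} on the range, which leaves ∫ du/u. At p = 1/2 the logarithm is the whole
gain. -/
lemma integral_mul_integral_le_of_rpow_sq (hq : Measurable q) (hq1 : ∀ u, |q u| ≤ 1) (hc : 0 < c)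
    (hp : 1 / 2 ≤ p) (hp1 : p < 1) (hlo : ∀ u, 2 ≤ u → c * u ^ (-p) ≤ |q u|)
    (hup : ∀ u, 2 ≤ u → |q u| ≤ u ^ (-p)) {X : ℝ} (hX : 8 ≤ X) :
    (∫ u in (0)..X, |q u|) * (∫ u in (0)..X, |q u|) ≤
      X * ((2 + 1 / (1 - p)) ^ 2 / (c ^ 2 * Real.log (X / 4))) * ∫ u in (0)..(X / 2), |q u| ^ 2 := by
  have hX0 : 0 < X := by linarith
  have hA := integral_abs_le_rpow hq hq1 hp1 hup (show 2 ≤ X by linarith)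
  have hA0 : 0 ≤ ∫ u in (0)..X, |q u| := intervalIntegral.integral_nonneg hX0.le fun _ _ => abs_nonneg _
  have hlog : 0 < Real.log (X / 4) := Real.log_pos (by linarith)
  have hi := intervalIntegrable_abs_pow_of_abs_le_one hq hq1 2
  have hlow : c ^ 2 * X ^ (1 - 2 * p) * Real.log (X / 4) ≤ ∫ u in (0)..(X / 2), |q u| ^ 2 := by
    have h1 : c ^ 2 * X ^ (1 - 2 * p) * Real.log (X / 4) =
        ∫ u in (2)..(X / 2), c ^ 2 * X ^ (1 - 2 * p) * u⁻¹ := by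
      rw [intervalIntegral.integral_const_mul, integral_inv_of_pos (by norm_num) (by linarith)]
      congr 2; ring
    rw [h1, ← intervalIntegral.integral_add_adjacent_intervals (hi 0 2) (hi 2 (X / 2))]
    have h2 : 0 ≤ ∫ u in (0)..2, |q u| ^ 2 :=
      intervalIntegral.integral_nonneg (by norm_num) fun _ _ => by positivity
    have h3 : ∫ u in (2)..(X / 2), c ^ 2 * X ^ (1 - 2 * p) * u⁻¹ ≤ ∫ u in (2)..(X / 2), |q u| ^ 2 := by
      refine intervalIntegral.integral_mono_on (by linarith) ?_ (hi _ _) fun u hu => ?_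
      · refine (intervalIntegral.intervalIntegrable_inv (fun u hu => ?_) continuousOn_id).const_mul _
        rw [Set.uIcc_of_le (by linarith)] at hu
        exact (show (0 : ℝ) < u by linarith [hu.1]).ne'
      · have hu0 : 0 < u := by linarith [hu.1]
        have h4 : X ^ (1 - 2 * p) ≤ u ^ (1 - 2 * p) :=
          Real.rpow_le_rpow_of_nonpos hu0 (by linarith [hu.2]) (by linarith)
        calc c ^ 2 * X ^ (1 - 2 * p) * u⁻¹ ≤ c ^ 2 * u ^ (1 - 2 * p) * u⁻¹ := by gcongr
          _ = (c * u ^ (-p)) ^ 2 := by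
            rw [show 1 - 2 * p = -p + -p + 1 by ring, Real.rpow_add hu0, Real.rpow_add hu0,
              Real.rpow_one]
            field_simp
          _ ≤ |q u| ^ 2 := pow_le_pow_left₀ (by positivity) (hlo u hu.1) 2
    linarith
  calc _ ≤ ((2 + 1 / (1 - p)) * X ^ (1 - p)) * ((2 + 1 / (1 - p)) * X ^ (1 - p)) :=
        mul_le_mul hA hA hA0 (hA0.trans hA)
    _ = X * ((2 + 1 / (1 - p)) ^ 2 / (c ^ 2 * Real.log (X / 4))) *
        (c ^ 2 * X ^ (1 - 2 * p) * Real.log (X / 4)) := by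
        have : X ^ (1 - p) * X ^ (1 - p) = X * X ^ (1 - 2 * p) := by
          rw [← Real.rpow_add hX0, mul_comm X, ← Real.rpow_add_one hX0.ne']
          congr 1; ring
        calc _ = (2 + 1 / (1 - p)) ^ 2 * (X ^ (1 - p) * X ^ (1 - p)) := by ring
          _ = (2 + 1 / (1 - p)) ^ 2 * (X * X ^ (1 - 2 * p)) := by rw [this]
          _ = _ := by
            generalize 2 + 1 / (1 - p) = B
            field_simp
    _ ≤ _ := by
        refine mul_le_mul_of_nonneg_left hlow ?_
        positivity

/-- For K - 1 ≥ 3 and p ≥ 1/2, |q|^{K-1} is dominated by the integrable tail u^{-3/2}, so the second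
factor stays bounded. The left side is O(X^{1-p}), and a positive constant already bounds ∫|q|^K
from below. -/
lemma integral_mul_integral_le_of_rpow_pow (hq : Measurable q) (hq1 : ∀ u, |q u| ≤ 1) (hc : 0 < c)
    (hp : 1 / 2 ≤ p) (hp1 : p < 1) (hlo : ∀ u, 2 ≤ u → c * u ^ (-p) ≤ |q u|)
    (hup : ∀ u, 2 ≤ u → |q u| ≤ u ^ (-p)) {K : ℕ} (hK : 4 ≤ K) {X : ℝ} (hX : 8 ≤ X) :
    (∫ u in (0)..X, |q u|) * (∫ u in (0)..X, |q u| ^ (K - 1)) ≤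
      X * (4 * (2 + 1 / (1 - p)) / (2 * (c * 4 ^ (-p)) ^ K) * X ^ (-p)) *
        ∫ u in (0)..(X / 2), |q u| ^ K := by
  have hX0 : 0 < X := by linarith
  have hA := integral_abs_le_rpow hq hq1 hp1 hup (show 2 ≤ X by linarith)
  have hA0 : 0 ≤ ∫ u in (0)..X, |q u| := intervalIntegral.integral_nonneg hX0.le fun _ _ => abs_nonneg _
  have hB0 : 0 ≤ ∫ u in (0)..X, |q u| ^ (K - 1) :=
    intervalIntegral.integral_nonneg hX0.le fun _ _ => by positivity
  have hB : ∫ u in (0)..X, |q u| ^ (K - 1) ≤ 4 := by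
    have hi : IntervalIntegrable (fun u : ℝ => u ^ (-(3 / 2) : ℝ)) volume 2 X := by
      refine intervalIntegral.intervalIntegrable_rpow (Or.inr ?_)
      rw [Set.uIcc_of_le (by linarith)]
      exact fun h => by linarith [h.1]
    have h := integral_abs_pow_le_two_add hq hq1 (K - 1) (show 2 ≤ X by linarith) hi fun u hu => by
      have hu0 : 0 < u := by linarith [hu.1]
      calc |q u| ^ (K - 1) ≤ |q u| ^ 3 :=
            pow_le_pow_of_le_one (abs_nonneg _) (hq1 u) (by omega)
        _ ≤ (u ^ (-(1 / 2) : ℝ)) ^ 3 := by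
            refine pow_le_pow_left₀ (abs_nonneg _) ((hup u hu.1).trans ?_) 3
            exact Real.rpow_le_rpow_of_exponent_le (by linarith [hu.1]) (by linarith)
        _ = u ^ (-(3 / 2) : ℝ) := by
            rw [← Real.rpow_natCast, ← Real.rpow_mul hu0.le]; norm_num
    rw [integral_rpow (Or.inr ⟨by norm_num, by
      rw [Set.uIcc_of_le (by linarith)]
      exact fun h => by linarith [h.1]⟩)] at h
    have h1 : (0 : ℝ) ≤ X ^ (-(3 / 2) + 1 : ℝ) := by positivity
    have h2 : (2 : ℝ) ^ (-(3 / 2) + 1 : ℝ) ≤ 1 :=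
      Real.rpow_le_one_of_one_le_of_nonpos (by norm_num) (by norm_num)
    have h3 : (X ^ (-(3 / 2) + 1 : ℝ) - 2 ^ (-(3 / 2) + 1 : ℝ)) / (-(3 / 2) + 1 : ℝ) ≤ 2 := by
      rw [div_le_iff_of_neg (by norm_num)]
      linarith
    linarith
  have hi := intervalIntegrable_abs_pow_of_abs_le_one hq hq1 K
  -- The piece [2, 4] suffices; X ≥ 8 puts it inside the range of integration.
  have hlow : 2 * (c * 4 ^ (-p)) ^ K ≤ ∫ u in (0)..(X / 2), |q u| ^ K := by
    rw [← intervalIntegral.integral_add_adjacent_intervals (hi 0 2) (hi 2 (X / 2)),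
      ← intervalIntegral.integral_add_adjacent_intervals (hi 2 4) (hi 4 (X / 2))]
    have h2 : 0 ≤ ∫ u in (0)..2, |q u| ^ K :=
      intervalIntegral.integral_nonneg (by norm_num) fun _ _ => by positivity
    have h3 : 0 ≤ ∫ u in (4)..(X / 2), |q u| ^ K :=
      intervalIntegral.integral_nonneg (by linarith) fun _ _ => by positivity
    have h4 := intervalIntegral.integral_mono_on (by norm_num)
      (intervalIntegrable_const (c := (c * 4 ^ (-p)) ^ K)) (hi 2 4) fun u hu => by
        refine pow_le_pow_left₀ (by positivity) (le_trans ?_ (hlo u hu.1)) K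
        have : (4 : ℝ) ^ (-p) ≤ u ^ (-p) :=
          Real.rpow_le_rpow_of_nonpos (by linarith [hu.1]) hu.2 (by linarith)
        gcongr
    simp only [intervalIntegral.integral_const, smul_eq_mul] at h4
    linarith
  have hd : 0 < (c * (4 : ℝ) ^ (-p)) ^ K := by positivity
  have h1p : 0 < 1 - p := by linarith
  calc _ ≤ ((2 + 1 / (1 - p)) * X ^ (1 - p)) * 4 := mul_le_mul hA hB hB0 (hA0.trans hA)
    _ = X * (4 * (2 + 1 / (1 - p)) / (2 * (c * 4 ^ (-p)) ^ K) * X ^ (-p)) *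
        (2 * (c * 4 ^ (-p)) ^ K) := by
        have : X ^ (1 - p) = X * X ^ (-p) := by
          rw [mul_comm, ← Real.rpow_add_one hX0.ne']; congr 1; ring
        rw [this]
        field_simp
    _ ≤ _ := by
        refine mul_le_mul_of_nonneg_left hlow ?_
        positivity

lemma exists_tendsto_integral_mul_integral_le (hq : Measurable q) (hq1 : ∀ u, |q u| ≤ 1) (hc : 0 < c)
    (hp : 1 / 2 ≤ p) (hp1 : p < 1) (hlo : ∀ u, 2 ≤ u → c * u ^ (-p) ≤ |q u|)
    (hup : ∀ u, 2 ≤ u → |q u| ≤ u ^ (-p)) {K : ℕ} (hK : 2 ≤ K) (hKe : Even K) :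
    ∃ η : ℝ → ℝ, Tendsto η atTop (𝓝 0) ∧ ∀ X, 8 ≤ X →
      (∫ u in (0)..X, |q u|) * (∫ u in (0)..X, |q u| ^ (K - 1)) ≤
        X * η X * ∫ u in (0)..(X / 2), |q u| ^ K := by
  rcases eq_or_lt_of_le hK with rfl | hK2
  · refine ⟨fun X => (2 + 1 / (1 - p)) ^ 2 / (c ^ 2 * Real.log (X / 4)), ?_, fun X hX => ?_⟩
    rotate_left
    · simpa using integral_mul_integral_le_of_rpow_sq hq hq1 hc hp hp1 hlo hup hX
    · refine Tendsto.const_div_atTop (Tendsto.const_mul_atTop (by positivity) ?_) _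
      exact Real.tendsto_log_atTop.comp (tendsto_id.atTop_div_const (by norm_num))
  -- Evenness skips K = 3, for which |q|^{K-1} is not integrable at infinity when p = 1/2.
  · have hK4 : 4 ≤ K := by
      obtain ⟨m, rfl⟩ := hKe
      omega
    refine ⟨_, ?_, fun X hX => integral_mul_integral_le_of_rpow_pow hq hq1 hc hp hp1 hlo hup hK4 hX⟩
    simpa using (tendsto_rpow_neg_atTop (show 0 < p by linarith)).const_mul
      (4 * (2 + 1 / (1 - p)) / (2 * (c * 4 ^ (-p)) ^ K))

end Power

/-- The contraction estimate for a power variance function. -/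
lemma exists_tendsto_integral_incrementCorr_mul_le_of_rpow {φ : ℝ → ℝ} (hφm : Measurable φ)
    (heven : ∀ s, φ (-s) = φ s) {r : ℝ} (hr1 : 1 < r) (hr2 : r ≤ 3 / 2) (hφ : ∀ h, 0 ≤ h → φ h = h ^ r)
    (hb : ∀ s, |incrementCorr φ 1 s| ≤ 1) {L : ℝ} (hL : 0 < L) {K : ℕ} (hK : 2 ≤ K) (hKe : Even K) :
    ∃ ε : ℝ → ℝ, Tendsto ε (𝓝[>] 0) (𝓝 0) ∧ ∀ᶠ h in 𝓝[>] 0,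
      (∫ s in (0)..L, |incrementCorr φ h s|) * (∫ s in (0)..L, |incrementCorr φ h s| ^ (K - 1)) ≤
        ε h * ∫ s in (0)..(L / 2), |incrementCorr φ h s| ^ K := by
  have habs : ∀ s, φ s = |s| ^ r := fun s => by
    rcases abs_cases s with ⟨h, h'⟩ | ⟨h, h'⟩ <;> rw [h]
    · exact hφ s h'
    · rw [← heven]; exact hφ _ (by linarith)
  have hrr : 0 < r * (r - 1) := mul_pos (by linarith) (by linarith)
  have hq : ∀ u, 2 ≤ u → incrementCorr φ 1 u = ((u + 1) ^ r + (u - 1) ^ r - 2 * u ^ r) / 2 := by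
    intro u hu
    rw [incrementCorr, hφ _ (by linarith), hφ _ (by linarith), hφ _ (by linarith),
      hφ 1 (by norm_num), Real.one_rpow, mul_one]
  -- Self-similarity: h → 0 on a fixed interval amounts to step 1 on an interval of length X = L/h.
  have hscale : ∀ h, 0 < h → ∀ s, incrementCorr φ h s = incrementCorr φ 1 (s / h) := by
    intro h hh s
    have hhr : 0 < h ^ r := Real.rpow_pos_of_pos hh r
    have key : ∀ v, φ v = h ^ r * φ (v / h) := fun v => by
      rw [habs, habs, abs_div, abs_of_pos hh, Real.div_rpow (abs_nonneg _) hh.le]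
      field_simp
    rw [incrementCorr, incrementCorr, key (s + h), key (s - h), key s, key h, div_self hh.ne',
      add_div, sub_div, div_self hh.ne']
    have : φ 1 = 1 := by rw [hφ 1 (by norm_num), Real.one_rpow]
    rw [this]
    field_simp
  obtain ⟨η, hη, hηb⟩ := exists_tendsto_integral_mul_integral_le (q := incrementCorr φ 1)
    (c := r * (r - 1) / 3) (p := 2 - r) (hφm.incrementCorr 1) hb (by positivity) (by linarith)
    (by linarith)
    (fun u hu => by
      rw [hq u hu, neg_sub]
      exact (second_difference_rpow_bounds hr1 (by linarith) hu).1.trans (le_abs_self _))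
    (fun u hu => by
      have h := second_difference_rpow_bounds hr1 (by linarith : r ≤ 2) hu
      have hu' : 0 < u ^ (r - 2) := Real.rpow_pos_of_pos (by linarith) _
      rw [hq u hu, neg_sub, abs_of_nonneg (le_trans (by positivity) h.1)]
      refine h.2.trans ?_
      have : r * (r - 1) ≤ 1 := by nlinarith
      nlinarith) hK hKe
  -- Rescaling gives h² on the left and h on the right; with X = L/h the factor h · X is L.
  refine ⟨fun h => L * η (L / h), ?_, ?_⟩
  · have : Tendsto (fun h : ℝ => L / h) (𝓝[>] 0) atTop := by
      simpa [div_eq_mul_inv] using tendsto_inv_nhdsGT_zero.const_mul_atTop hL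
    simpa using (hη.comp this).const_mul L
  · have h8 : ∀ᶠ h : ℝ in 𝓝[>] 0, h < L / 8 := by
      filter_upwards [Ioo_mem_nhdsGT (show (0 : ℝ) < L / 8 by positivity)] with h hh using hh.2
    filter_upwards [h8, self_mem_nhdsWithin] with h hlt hpos
    have hh : (0 : ℝ) < h := hpos
    have hX : 8 ≤ L / h := by rw [le_div_iff₀ hh]; linarith
    have e : ∀ (j : ℕ) (M : ℝ), ∫ s in (0)..M, |incrementCorr φ h s| ^ j =
        h * ∫ u in (0)..(M / h), |incrementCorr φ 1 u| ^ j := by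
      intro j M
      simp only [hscale h hh]
      rw [intervalIntegral.integral_comp_div (fun u => |incrementCorr φ 1 u| ^ j) hh.ne', zero_div,
        smul_eq_mul]
    have e1 := e 1 L
    simp only [pow_one] at e1
    rw [e1, e, e]
    have := hηb (L / h) hX
    rw [div_right_comm] at this
    calc _ = h ^ 2 * ((∫ u in (0)..(L / h), |incrementCorr φ 1 u|) *
          ∫ u in (0)..(L / h), |incrementCorr φ 1 u| ^ (K - 1)) := by ring
      _ ≤ h ^ 2 * (L / h * η (L / h) * ∫ u in (0)..(L / 2 / h), |incrementCorr φ 1 u| ^ K) := by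
          gcongr
      _ = _ := by field_simp

/-! ### From polynomials to square integrable functions. -/

/-- Changing the vector and changing the normalization cost ‖x - y‖/‖y‖ each. The case x = 0 is
included, so the full functional need not be known to have positive variance. -/
lemma norm_inv_norm_smul_sub_le {E : Type*} [NormedAddCommGroup E] [NormedSpace ℝ E] (x : E) {y : E}
    (hy : y ≠ 0) : ‖‖x‖⁻¹ • x - ‖y‖⁻¹ • y‖ ≤ 2 * ‖x - y‖ / ‖y‖ := by
  have hy0 : 0 < ‖y‖ := norm_pos_iff.2 hy
  have h2 : ‖(‖x‖⁻¹ - ‖y‖⁻¹) • x‖ ≤ ‖x - y‖ / ‖y‖ := by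
    rcases eq_or_ne x 0 with rfl | hx
    · simp; positivity
    · have hx0 : 0 < ‖x‖ := norm_pos_iff.2 hx
      have : (‖x‖⁻¹ - ‖y‖⁻¹) * ‖x‖ = (‖y‖ - ‖x‖) / ‖y‖ := by field_simp
      calc ‖(‖x‖⁻¹ - ‖y‖⁻¹) • x‖ = |(‖x‖⁻¹ - ‖y‖⁻¹) * ‖x‖| := by
            rw [norm_smul, abs_mul, Real.norm_eq_abs, abs_of_pos hx0]
        _ ≤ ‖x - y‖ / ‖y‖ := by
            rw [this, abs_div, abs_of_pos hy0, norm_sub_rev]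
            gcongr
            exact abs_norm_sub_norm_le y x
  have h1 : ‖‖y‖⁻¹ • (x - y)‖ = ‖x - y‖ / ‖y‖ := by
    rw [norm_smul, norm_inv, norm_norm]; ring
  calc ‖‖x‖⁻¹ • x - ‖y‖⁻¹ • y‖ = ‖(‖x‖⁻¹ - ‖y‖⁻¹) • x + ‖y‖⁻¹ • (x - y)‖ := by
        congr 1; module
    _ ≤ ‖x - y‖ / ‖y‖ + ‖x - y‖ / ‖y‖ := (norm_add_le _ _).trans (add_le_add h2 h1.le)
    _ = _ := by ring

/-- Characteristic functions of standardized square integrable variables. -/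
lemma norm_integral_cexp_sub_le_of_memLp {Ω : Type*} [MeasurableSpace Ω] {P : Measure Ω}
    [IsProbabilityMeasure P] {X Z : Ω → ℝ} (hX : MemLp X 2 P) (hZ : MemLp Z 2 P)
    (hZ0 : 0 < ∫ ω, Z ω ^ 2 ∂P) (t : ℝ) :
    ‖∫ ω, Complex.exp (((t * (X ω / √(∫ ω, X ω ^ 2 ∂P)) : ℝ) : ℂ) * Complex.I) ∂P -
      ∫ ω, Complex.exp (((t * (Z ω / √(∫ ω, Z ω ^ 2 ∂P)) : ℝ) : ℂ) * Complex.I) ∂P‖ ≤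
      2 * |t| * √(∫ ω, (X ω - Z ω) ^ 2 ∂P) / √(∫ ω, Z ω ^ 2 ∂P) := by
  set v := √(∫ ω, X ω ^ 2 ∂P)
  set w := √(∫ ω, Z ω ^ 2 ∂P) with hw
  have hn : ∀ {U : Ω → ℝ} (hU : MemLp U 2 P), ‖hU.toLp U‖ = √(∫ ω, U ω ^ 2 ∂P) := fun hU => by
    rw [← norm_toLp_two_sq hU, Real.sqrt_sq (norm_nonneg _)]
  have hw0 : 0 < w := Real.sqrt_pos.2 hZ0
  have hD : MemLp (fun ω => X ω / v - Z ω / w) 2 P := by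
    have := (hX.const_mul v⁻¹).sub (hZ.const_mul w⁻¹)
    refine this.congr_norm (by exact (by simpa [div_eq_inv_mul] using! this.1)) (.of_forall fun ω => ?_)
    simp [div_eq_inv_mul]
  have hexp : ∀ {U : Ω → ℝ}, AEStronglyMeasurable U P →
      Integrable (fun ω => Complex.exp (((t * U ω : ℝ) : ℂ) * Complex.I)) P := fun {U} hU =>
    Integrable.of_bound (Complex.continuous_exp.comp_aestronglyMeasurable
      ((Complex.continuous_ofReal.comp_aestronglyMeasurable (hU.const_mul t)).mul_const Complex.I)) 1
      (.of_forall fun ω => (Complex.norm_exp_ofReal_mul_I _).le)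
  have hXv : AEStronglyMeasurable (fun ω => X ω / v) P := by
    simpa [div_eq_inv_mul] using hX.1.const_mul v⁻¹
  have hZw : AEStronglyMeasurable (fun ω => Z ω / w) P := by
    simpa [div_eq_inv_mul] using hZ.1.const_mul w⁻¹
  rw [← integral_sub (hexp hXv) (hexp hZw)]
  have hpt : ∀ ω, ‖Complex.exp (((t * (X ω / v) : ℝ) : ℂ) * Complex.I) -
      Complex.exp (((t * (Z ω / w) : ℝ) : ℂ) * Complex.I)‖ ≤ |t| * |X ω / v - Z ω / w| := by
    intro ω
    have e : Complex.exp (((t * (X ω / v) : ℝ) : ℂ) * Complex.I) -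
      Complex.exp (((t * (Z ω / w) : ℝ) : ℂ) * Complex.I) =
      Complex.exp (((t * (Z ω / w) : ℝ) : ℂ) * Complex.I) *
        (Complex.exp (Complex.I * ((t * (X ω / v - Z ω / w) : ℝ) : ℂ)) - 1) := by
      rw [mul_sub, ← Complex.exp_add, mul_one]
      congr 2; push_cast; ring
    rw [e, norm_mul, Complex.norm_exp_ofReal_mul_I, one_mul, ← abs_mul]
    exact Real.norm_exp_I_mul_ofReal_sub_one_le
  have hle : ∫ ω, |X ω / v - Z ω / w| ∂P ≤ 2 * √(∫ ω, (X ω - Z ω) ^ 2 ∂P) / w := by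
    refine (integral_abs_le_sqrt hD).trans ?_
    rw [← hn hD]
    have e : hD.toLp _ = ‖hX.toLp X‖⁻¹ • hX.toLp X - ‖hZ.toLp Z‖⁻¹ • hZ.toLp Z := by
      rw [hn, hn, ← MemLp.toLp_const_smul, ← MemLp.toLp_const_smul, ← MemLp.toLp_sub]
      refine MemLp.toLp_congr _ _ (.of_forall fun ω => ?_)
      simp [div_eq_inv_mul, v, w]
    have h := norm_inv_norm_smul_sub_le (hX.toLp X) (y := hZ.toLp Z) (by
      rw [← norm_pos_iff, hn]; exact hw0)
    rw [e]
    refine h.trans_eq ?_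
    rw [hn hZ, ← MemLp.toLp_sub, hn (hX.sub hZ)]
    rfl
  calc _ ≤ ∫ ω, |t| * |X ω / v - Z ω / w| ∂P :=
        norm_integral_le_of_norm_le ((hD.integrable (by norm_num)).abs.const_mul _) (.of_forall hpt)
    _ ≤ |t| * (2 * √(∫ ω, (X ω - Z ω) ^ 2 ∂P) / w) := by
        rw [integral_const_mul]; gcongr
    _ = _ := by ring

namespace IsStdGaussianField

variable {T Ω : Type*} [MeasurableSpace T] [MeasurableSpace Ω] {P : Measure Ω}
  {Y : T → Ω → ℝ} [IsProbabilityMeasure P]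

lemma integrable_covKernel_pow (hY : IsStdGaussianField Y P) (ν : Measure (T × T)) [IsFiniteMeasure ν]
    (k : ℕ) : Integrable (fun q : T × T => covKernel Y P q.1 q.2 ^ k) ν := by
  refine Integrable.of_bound (C := 1) (hY.measurable_covKernel.pow_const k).aestronglyMeasurable
    (.of_forall fun q => ?_)
  rw [norm_pow, Real.norm_eq_abs]
  exact pow_le_one₀ (abs_nonneg _) (hY.abs_covKernel_le_one _ _)

/-- Times k! it is the second moment of the integral of the k-th Hermite polynomial of the field. -/
lemma integral_covKernel_pow_nonneg (hY : IsStdGaussianField Y P) (μ : Measure T) [IsFiniteMeasure μ]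
    (k : ℕ) : 0 ≤ ∫ q, covKernel Y P q.1 q.2 ^ k ∂(μ.prod μ) := by
  have h := hY.integral_sq_integral_comp μ (realHermite k).continuous.measurable
    (memLp_two_realHermite k)
  simp only [hY.integral_realHermite_mul, if_true] at h
  rw [integral_const_mul] at h
  have h0 : 0 ≤ (k.factorial : ℝ) * ∫ q, covKernel Y P q.1 q.2 ^ k ∂(μ.prod μ) := by
    rw [← h]; exact integral_nonneg fun _ => sq_nonneg _
  exact nonneg_of_mul_nonneg_right h0 (Nat.cast_pos.2 k.factorial_pos)

/-- By orthogonality the second moment is a sum of nonnegative contributions of the separate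
degrees, of which one is kept. -/
lemma le_integral_sq_hermiteShiftSum (hY : IsStdGaussianField Y P) (μ : Measure T) [IsFiniteMeasure μ]
    (s : Finset ℕ) (a : ℕ → ℝ) {m : ℕ} (hm : m ∈ s) :
    a m ^ 2 * (m + 1).factorial * ∫ q, covKernel Y P q.1 q.2 ^ (m + 1) ∂(μ.prod μ) ≤
      ∫ ω, (∫ x, (hermiteShiftSum s a).eval (Y x ω) ∂μ) ^ 2 ∂P := by
  rw [hY.integral_sq_integral_comp μ (hermiteShiftSum s a).continuous.measurable
    ((memAllLp_id_gaussianReal.polynomial _) 2 (by simp))]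
  simp only [hY.integral_hermiteShiftSum_mul]
  rw [integral_finsetSum _ fun k _ => ((hY.integrable_covKernel_pow _ _).const_mul _).const_mul _]
  simp only [integral_const_mul]
  have := Finset.single_le_sum (f := fun k => a k ^ 2 * ((k + 1).factorial *
    ∫ q, covKernel Y P q.1 q.2 ^ (k + 1) ∂(μ.prod μ))) (fun k _ =>
      mul_nonneg (sq_nonneg _) (mul_nonneg (Nat.cast_nonneg _) (hY.integral_covKernel_pow_nonneg μ _))) hm
  simpa [mul_assoc] using this

/-- The covariance of the remainders carries |ρ|^N, at most |ρ|^K. The scale thus stays at the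
exponent K of the leading term while N grows. -/
lemma integral_sq_hermiteRemainder_le (hY : IsStdGaussianField Y P) (μ : Measure T)
    [IsFiniteMeasure μ] {f : ℝ → ℝ} (hfm : Measurable f) (hf : MemLp f 2 (gaussianReal 0 1))
    {K N : ℕ} (hKN : K ≤ N) :
    ∫ ω, (∫ x, hermiteRemainder f N (Y x ω) ∂μ) ^ 2 ∂P ≤
      (∫ u, hermiteRemainder f N u ^ 2 ∂(gaussianReal 0 1)) *
        ∫ q, |covKernel Y P q.1 q.2| ^ K ∂(μ.prod μ) := by
  have hm : Measurable (hermiteRemainder f N) :=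
    hfm.sub (Finset.measurable_fun_sum _ fun k _ => (realHermite k).continuous.measurable.const_mul _)
  rw [hY.integral_sq_integral_comp μ hm (memLp_two_hermiteRemainder hf N), ← integral_const_mul]
  refine (le_abs_self _).trans ?_
  rw [← Real.norm_eq_abs]
  refine norm_integral_le_of_norm_le ?_ (.of_forall fun q => ?_)
  · have := (hY.integrable_covKernel_pow (μ.prod μ) K).abs
    simp only [abs_pow] at this
    exact this.const_mul _
  · refine (hY.abs_integral_hermiteRemainder_mul_le hf N q.1 q.2).trans ?_
    rw [mul_comm]
    refine mul_le_mul_of_nonneg_left ?_ (integral_nonneg fun _ => sq_nonneg _)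
    exact pow_le_pow_of_le_one (abs_nonneg _) (hY.abs_covKernel_le_one _ _) hKN

end IsStdGaussianField

/-- Splitting of a function into Hermite polynomials of degree at least `K` and a remainder. -/
lemma sub_hermiteCoeff_zero_eq {f : ℝ → ℝ} {K : ℕ} (hK0 : ∀ k, 1 ≤ k → k < K → hermiteCoeff f k = 0)
    (n : ℕ) (x : ℝ) :
    f x - hermiteCoeff f 0 =
      (hermiteShiftSum ((Finset.range n).filter fun m => K ≤ m + 1)
        fun m => hermiteCoeff f (m + 1)).eval x + hermiteRemainder f (n + 1) x := by
  rw [hermiteRemainder, eval_hermiteShiftSum, Finset.sum_range_succ']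
  have : ∑ m ∈ (Finset.range n).filter fun m => K ≤ m + 1,
      hermiteCoeff f (m + 1) * (realHermite (m + 1)).eval x =
      ∑ m ∈ Finset.range n, hermiteCoeff f (m + 1) * (realHermite (m + 1)).eval x := by
    refine Finset.sum_filter_of_ne fun m _ hne => ?_
    by_contra! hlt
    rw [hK0 (m + 1) (by omega) hlt, zero_mul] at hne
    exact hne rfl
  rw [this]
  simp
  ring

/-- Quantitative central limit theorem for a functional of a stationary Gaussian field. -/
lemma exists_norm_integral_cexp_sub_le {T Ω : Type*} [MeasurableSpace T] [MeasurableSpace Ω]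
    (P : Measure Ω) [IsProbabilityMeasure P] (μ : Measure T) [IsFiniteMeasure μ] {f : ℝ → ℝ}
    (hfm : Measurable f) (hf : MemLp f 2 (gaussianReal 0 1)) {K : ℕ} (hK : 1 ≤ K) (hKe : Even K)
    (hK0 : ∀ k, 1 ≤ k → k < K → hermiteCoeff f k = 0) {n : ℕ}
    (hn : K ≤ n) {c : ℝ} (hc : 0 < c) (hcK : c ^ 2 = hermiteCoeff f K ^ 2 * K.factorial) :
    ∃ C : ℝ, 0 ≤ C ∧ ∀ Y : T → Ω → ℝ, IsStdGaussianField Y P → ∀ M M' ε : ℝ, 0 ≤ M → 0 ≤ M' →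
      (∀ x, ∫ y, |covKernel Y P x y| ∂μ ≤ M) →
      (∀ x, ∫ y, |covKernel Y P x y| ^ (K - 1) ∂μ ≤ M') →
      0 < ∫ q, |covKernel Y P q.1 q.2| ^ K ∂(μ.prod μ) →
      M * M' ≤ ε * ∫ q, |covKernel Y P q.1 q.2| ^ K ∂(μ.prod μ) → ∀ t : ℝ,
      ‖∫ ω, Complex.exp (((t * ((∫ x, (f (Y x ω) - hermiteCoeff f 0) ∂μ) /
          √(∫ ω, (∫ x, (f (Y x ω) - hermiteCoeff f 0) ∂μ) ^ 2 ∂P)) : ℝ) : ℂ) * Complex.I) ∂P -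
        Complex.exp ((-(t ^ 2 / 2) : ℝ) : ℂ)‖ ≤
      2 * |t| * √(∫ u, hermiteRemainder f (n + 1) u ^ 2 ∂(gaussianReal 0 1)) / c +
        t ^ 2 * √(C * ε) / c ^ 2 := by
  set s := (Finset.range n).filter fun m => K ≤ m + 1 with hs
  set a : ℕ → ℝ := fun m => hermiteCoeff f (m + 1) with ha
  obtain ⟨C, hC, hCb⟩ := IsStdGaussianField.exists_integral_sq_sub_le P μ hK s (fun m hm => (Finset.mem_filter.1 hm).2) a
    fun m => a m * (m + 1)
  refine ⟨C, hC, fun Y hY M M' ε hM hM' hMb hMb' hT hε t => ?_⟩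
  set τ := ∫ q, |covKernel Y P q.1 q.2| ^ K ∂(μ.prod μ) with hτ
  set r := ∫ u, hermiteRemainder f (n + 1) u ^ 2 ∂(gaussianReal 0 1)
  have hr0 : 0 ≤ r := integral_nonneg fun _ => sq_nonneg _
  set p := hermiteSum s a
  set g := hermiteShiftSum s a with hg
  set F : Ω → ℝ := fun ω => ∫ x, g.eval (Y x ω) ∂μ with hF
  set I : Ω → ℝ := fun ω => ∫ x, (f (Y x ω) - hermiteCoeff f 0) ∂μ with hI
  have hFL : MemLp F 2 P := hY.memLp_integral_polynomial μ g
  have hIL : MemLp I 2 P :=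
    memLp_two_integral (hY.memLp_prod μ (f := fun u => f u - hermiteCoeff f 0) (hf.sub (memLp_const _)))
  set V := ∫ ω, F ω ^ 2 ∂P with hV
  -- The term of degree K, that is m = K - 1 in the shifted indexing; evenness of K turns ρ^K into
  -- |ρ|^K.
  have hVτ : c ^ 2 * τ ≤ V := by
    have := hY.le_integral_sq_hermiteShiftSum μ s a (m := K - 1)
      (by simp [hs]; omega)
    simp only [ha, show K - 1 + 1 = K by omega] at this
    rw [← hcK] at this
    rw [hτ]
    simpa only [hKe.pow_abs] using this
  have hV0 : 0 < V := lt_of_lt_of_le (by positivity) hVτ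
  have hsqV : c * √τ ≤ √V := by
    rw [← Real.sqrt_sq hc.le, ← Real.sqrt_mul (sq_nonneg c)]
    exact Real.sqrt_le_sqrt hVτ
  -- the remainder
  have hdiff : ∫ ω, (I ω - F ω) ^ 2 ∂P ≤ r * τ := by
    refine Eq.trans_le (integral_congr_ae ?_)
      (hY.integral_sq_hermiteRemainder_le μ hfm hf (show K ≤ n + 1 by omega))
    have hi1 := ((hY.memAllLp_prod μ).polynomial g).integrable.prod_left_ae
    have hi2 := ((hY.memLp_prod μ (memLp_two_hermiteRemainder hf (n + 1))).integrable
      (by norm_num)).prod_left_ae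
    filter_upwards [hi1, hi2] with ω h1 h2
    have : I ω = F ω + ∫ x, hermiteRemainder f (n + 1) (Y x ω) ∂μ := by
      simp only [hI, hF]
      rw [← integral_add h1 h2]
      congr 1; ext x
      exact sub_hermiteCoeff_zero_eq hK0 n _
    rw [this, add_sub_cancel_left]
  have step1 := norm_integral_cexp_sub_le_of_memLp hIL hFL hV0 t
  have b1 : 2 * |t| * √(∫ ω, (I ω - F ω) ^ 2 ∂P) / √V ≤ 2 * |t| * √r / c := by
    have : √(∫ ω, (I ω - F ω) ^ 2 ∂P) ≤ √r * √τ := by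
      rw [← Real.sqrt_mul hr0]; exact Real.sqrt_le_sqrt hdiff
    have hτ0 : 0 < √τ := Real.sqrt_pos.2 hT
    calc _ ≤ 2 * |t| * (√r * √τ) / (c * √τ) := by gcongr
      _ = _ := by field_simp
  -- the polynomial part
  have step2 := hY.norm_integral_cexp_sub_le μ p g (hermiteShiftSum_eq s a) hV rfl (t / √V)
  have hΔ := hCb Y hY M M' hM hM' hMb hMb'
  rw [← derivative_hermiteShiftSum, ← hτ] at hΔ
  have e1 : ∀ ω, t / √V * F ω = t * (F ω / √V) := fun ω => by ring
  have e2 : V * (t / √V) ^ 2 / 2 = t ^ 2 / 2 := by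
    rw [div_pow, Real.sq_sqrt hV0.le]; field_simp
  have e3 : (t / √V) ^ 2 = t ^ 2 / V := by rw [div_pow, Real.sq_sqrt hV0.le]
  rw [e2, e3] at step2
  have b2 : t ^ 2 / V * √(∫ ω, (∫ q, covKernel Y P q.1 q.2 * (p.eval (Y q.1 ω) *
        (Polynomial.derivative g).eval (Y q.2 ω) - ∫ ω', p.eval (Y q.1 ω') *
        (Polynomial.derivative g).eval (Y q.2 ω') ∂P) ∂(μ.prod μ)) ^ 2 ∂P) ≤ t ^ 2 * √(C * ε) / c ^ 2 := by
    have h1 : C * (τ * (M * M')) ≤ C * ε * τ ^ 2 := by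
      calc C * (τ * (M * M')) ≤ C * (τ * (ε * τ)) := by gcongr
        _ = _ := by ring
    have h2 := Real.sqrt_le_sqrt (hΔ.trans h1)
    rw [Real.sqrt_mul' _ (sq_nonneg τ), Real.sqrt_sq hT.le] at h2
    calc _ ≤ t ^ 2 / (c ^ 2 * τ) * (√(C * ε) * τ) := by gcongr
      _ = _ := by field_simp
  have step2' : ‖∫ ω, Complex.exp (((t * (F ω / √V) : ℝ) : ℂ) * Complex.I) ∂P -
      Complex.exp ((-(t ^ 2 / 2) : ℝ) : ℂ)‖ ≤ t ^ 2 * √(C * ε) / c ^ 2 := by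
    simp only [← e1]
    exact step2.trans b2
  refine (norm_sub_le_norm_sub_add_norm_sub _ _ _).trans (add_le_add (step1.trans b1) step2')

namespace IsStdGaussianField

variable {T Ω : Type*} [MeasurableSpace T] [MeasurableSpace Ω] {P : Measure Ω}
  {Y : T → Ω → ℝ} [IsProbabilityMeasure P]

/-- A jointly measurable standard Gaussian field is not a white noise. -/
lemma integral_abs_covKernel_pow_pos (hY : IsStdGaussianField Y P) (μ : Measure T) [IsFiniteMeasure μ]
    (hμ : μ ≠ 0) (K : ℕ) : 0 < ∫ q, |covKernel Y P q.1 q.2| ^ K ∂(μ.prod μ) := by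
  have hi := (hY.integrable_covKernel_pow (μ.prod μ) K).abs
  simp only [abs_pow] at hi
  refine lt_of_le_of_ne (integral_nonneg fun _ => by positivity) fun h => ?_
  rw [eq_comm, integral_eq_zero_iff_of_nonneg (fun _ => by positivity) hi] at h
  have hρ : (fun q : T × T => covKernel Y P q.1 q.2) =ᵐ[μ.prod μ] 0 := by
    filter_upwards [h] with q hq
    exact abs_eq_zero.1 (eq_zero_of_pow_eq_zero hq)
  -- If the kernel vanished almost everywhere, so would the variance of every ∫_A Y. Then Y
  -- integrates to zero over all measurable rectangles, hence is zero almost everywhere, against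
  -- unit variance.
  have hA : ∀ A : Set T, MeasurableSet A → ∀ᵐ ω ∂P, ∫ x in A, Y x ω ∂μ = 0 := by
    intro A hA
    have h1 := hY.integral_sq_integral_comp (μ.restrict A) (f := fun u => u) measurable_id
      (memAllLp_id_gaussianReal 2 (by simp))
    have h2 : ∫ q : T × T, ∫ ω, Y q.1 ω * Y q.2 ω ∂P ∂((μ.restrict A).prod (μ.restrict A)) = 0 := by
      rw [Measure.prod_restrict]
      exact integral_eq_zero_of_ae (ae_restrict_of_ae hρ)
    have h3 : MemLp (fun ω => ∫ x in A, Y x ω ∂μ) 2 P :=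
      memLp_two_integral (hY.memAllLp_prod (μ.restrict A) 2 (by simp))
    rw [h2, integral_eq_zero_iff_of_nonneg (fun _ => sq_nonneg _) h3.integrable_sq] at h1
    filter_upwards [h1] with ω hω
    exact eq_zero_of_pow_eq_zero hω
  have hYi : Integrable (fun z : T × Ω => Y z.1 z.2) (μ.prod P) := (hY.memAllLp_prod μ).integrable
  have hrect : ∀ A : Set T, MeasurableSet A → ∀ B : Set Ω, MeasurableSet B →
      ∫ z in A ×ˢ B, Y z.1 z.2 ∂(μ.prod P) = 0 := by
    intro A hAm B hB
    have hi : Integrable (fun z : T × Ω => Y z.1 z.2) ((μ.restrict A).prod (P.restrict B)) := by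
      rw [Measure.prod_restrict]; exact hYi.restrict
    rw [← Measure.prod_restrict, integral_prod_symm _ hi]
    exact integral_eq_zero_of_ae (ae_restrict_of_ae (hA A hAm))
  have hae := ae_eq_of_setLIntegral_prod_eq (μ := μ.prod P)
    (f := fun z => ENNReal.ofReal (Y z.1 z.2)) (g := fun z => ENNReal.ofReal (-Y z.1 z.2))
    hY.measurable.ennreal_ofReal.aemeasurable hY.measurable.neg.ennreal_ofReal.aemeasurable
    hYi.lintegral_lt_top.ne fun A hAm B hB => by
      have h1 := integral_eq_lintegral_pos_part_sub_lintegral_neg_part (hYi.restrict (s := A ×ˢ B))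
      rw [hrect A hAm B hB, eq_comm, sub_eq_zero] at h1
      exact (ENNReal.toReal_eq_toReal_iff' (hYi.restrict (s := A ×ˢ B)).lintegral_lt_top.ne
        (hYi.restrict (s := A ×ˢ B)).neg.lintegral_lt_top.ne).1 h1
  have hY0 : (fun z : T × Ω => Y z.1 z.2 ^ 2) =ᵐ[μ.prod P] 0 := by
    filter_upwards [hae] with z hz
    have : Y z.1 z.2 = 0 := by
      rcases lt_trichotomy (Y z.1 z.2) 0 with h | h | h
      · rw [ENNReal.ofReal_of_nonpos h.le] at hz
        have := ENNReal.ofReal_eq_zero.1 hz.symm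
        linarith
      · exact h
      · rw [ENNReal.ofReal_of_nonpos (by linarith : -Y z.1 z.2 ≤ 0)] at hz
        have := ENNReal.ofReal_eq_zero.1 hz
        linarith
    simp [this]
  have h2 : ∫ z, Y z.1 z.2 ^ 2 ∂(μ.prod P) = μ.real Set.univ := by
    rw [integral_prod _ (hY.memAllLp_prod μ 2 (by simp)).integrable_sq]
    have : ∀ x, ∫ ω, Y x ω ^ 2 ∂P = 1 := fun x => by
      simpa [covKernel, sq] using hY.covKernel_self x
    simp [this]
  rw [integral_eq_zero_of_ae hY0] at h2
  have : μ Set.univ = 0 := by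
    simpa [Measure.real, ENNReal.toReal_eq_zero_iff] using h2.symm
  exact hμ (Measure.measure_univ_eq_zero.1 this)

end IsStdGaussianField

/-! ### The field of standardized increments and integrals over lags. -/

section Increments

variable {Ω : Type*} [MeasurableSpace Ω] {P : Measure Ω} {G : ℝ → Ω → ℝ} {φ : ℝ → ℝ}

/-- The standardized increments of a Gaussian process with stationary increments. -/
lemma isStdGaussianField_increment [IsProbabilityMeasure P] (hG : IsGaussianProcess G P) (hmean : ∀ x, ∫ ω, G x ω ∂P = 0)
    (hmeas : Measurable (fun p : ℝ × Ω => G p.1 p.2))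
    (hincr : ∀ x y, ∫ ω, (G x ω - G y ω) ^ 2 ∂P = φ (x - y)) {h : ℝ} (hh : 0 < φ h) :
    IsStdGaussianField (fun x ω => (G (x + h) ω - G x ω) / √(φ h)) P := by
  classical
  have hp : IsGaussianProcess (fun x ω => (G (x + h) ω - G x ω) / √(φ h)) P := by
    refine hG.of_isGaussianProcess fun x => ⟨{x + h, x},
      (√(φ h))⁻¹ • (ContinuousLinearMap.proj (R := ℝ) ⟨x + h, by simp⟩ -
        ContinuousLinearMap.proj (R := ℝ) ⟨x, by simp⟩), fun ω => ?_⟩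
    simp [div_eq_inv_mul]
  refine ⟨hp, fun x => ⟨?_, ?_⟩, ?_⟩
  · exact (hp.hasGaussianLaw_eval x).aemeasurable
  · rw [(hp.hasGaussianLaw_eval x).map_eq_gaussianReal]
    have hi : ∀ z, Integrable (G z) P := fun z => (hG.hasGaussianLaw_eval z).memLp_two.integrable (by norm_num)
    have h1 : ∫ ω, (G (x + h) ω - G x ω) / √(φ h) ∂P = 0 := by
      rw [integral_div, integral_sub (hi _) (hi _), hmean, hmean]; simp
    have h2 : Var[fun ω => (G (x + h) ω - G x ω) / √(φ h); P] = 1 := by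
      rw [variance_of_integral_eq_zero (hp.hasGaussianLaw_eval x).aemeasurable h1]
      simp only [div_pow, Real.sq_sqrt hh.le]
      rw [integral_div, hincr, add_sub_cancel_left, div_self hh.ne']
    rw [h1, h2]; simp
  · exact ((hmeas.comp (by fun_prop : Measurable fun p : ℝ × Ω => (p.1 + h, p.2))).sub hmeas).div_const _

/-- Polarization: the product of two increments is a combination of four squared increments, each
with a known expectation. -/
lemma covKernel_increment (hG : IsGaussianProcess G P)
    (hincr : ∀ x y, ∫ ω, (G x ω - G y ω) ^ 2 ∂P = φ (x - y)) {h : ℝ} (hh : 0 < φ h) (x y : ℝ) :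
    covKernel (fun x ω => (G (x + h) ω - G x ω) / √(φ h)) P x y = incrementCorr φ h (x - y) := by
  have hi : ∀ u v, Integrable (fun ω => (G u ω - G v ω) ^ 2) P := fun u v =>
    ((hG.hasGaussianLaw_eval u).memLp_two.sub (hG.hasGaussianLaw_eval v).memLp_two).integrable_sq
  have hi2 : ∀ u v u' v', Integrable (fun ω => (G u ω - G v ω) ^ 2 + (G u' ω - G v' ω) ^ 2) P :=
    fun u v u' v' => (hi u v).add (hi u' v')
  have e : ∀ ω, (G (x + h) ω - G x ω) / √(φ h) * ((G (y + h) ω - G y ω) / √(φ h)) =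
      (((G (x + h) ω - G y ω) ^ 2 + (G x ω - G (y + h) ω) ^ 2) -
        ((G (x + h) ω - G (y + h) ω) ^ 2 + (G x ω - G y ω) ^ 2)) / (2 * φ h) := by
    intro ω
    rw [div_mul_div_comm, Real.mul_self_sqrt hh.le]
    field_simp
    ring
  rw [covKernel]
  simp only [e]
  rw [integral_div, integral_sub (hi2 _ _ _ _) (hi2 _ _ _ _),
    integral_add (hi _ _) (hi _ _), integral_add (hi _ _) (hi _ _)]
  simp only [hincr, incrementCorr]
  congr 1
  rw [show x + h - y = x - y + h by ring, show x - (y + h) = x - y - h by ring,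
    show x + h - (y + h) = x - y by ring]
  ring

lemma measurable_of_integral_sq_increment [IsProbabilityMeasure P]
    (hmeas : Measurable (fun p : ℝ × Ω => G p.1 p.2))
    (hincr : ∀ x y, ∫ ω, (G x ω - G y ω) ^ 2 ∂P = φ (x - y)) : Measurable φ := by
  have e : φ = fun x => ∫ ω, (G x ω - G 0 ω) ^ 2 ∂P := by
    ext x; rw [hincr, sub_zero]
  rw [e]
  have : Measurable fun p : ℝ × Ω => (G p.1 p.2 - G 0 p.2) ^ 2 :=
    (hmeas.sub (hmeas.comp (by fun_prop : Measurable fun p : ℝ × Ω => ((0 : ℝ), p.2)))).pow_const 2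
  exact (this.stronglyMeasurable.integral_prod_right (ν := P)).measurable

end Increments

/-- Integrals over `[a, b]` of an even function of the lag. -/
lemma setIntegral_even_lag_le {w : ℝ → ℝ} (hw0 : ∀ s, 0 ≤ w s) (hwe : ∀ s, w (-s) = w s)
    (hwi : ∀ u v, IntervalIntegrable w volume u v) {a b x : ℝ} (hx : x ∈ Set.Icc a b) :
    ∫ y in Set.Ioc a b, w (x - y) ≤ 2 * ∫ s in (0)..(b - a), w s := by
  rw [← intervalIntegral.integral_of_le (hx.1.trans hx.2), intervalIntegral.integral_comp_sub_left,
    ← intervalIntegral.integral_add_adjacent_intervals (hwi (x - b) 0) (hwi 0 (x - a))]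
  have hneg : ∫ s in (x - b)..0, w s = ∫ s in (0)..(b - x), w s := by
    have := intervalIntegral.integral_comp_neg (a := x - b) (b := 0) w
    simp only [hwe] at this
    rw [this]; simp
  have hle : ∀ u, 0 ≤ u → u ≤ b - a → ∫ s in (0)..u, w s ≤ ∫ s in (0)..(b - a), w s := by
    intro u hu hub
    rw [← intervalIntegral.integral_add_adjacent_intervals (hwi 0 u) (hwi u (b - a))]
    linarith [intervalIntegral.integral_nonneg (μ := volume) hub fun s _ => hw0 s]
  rw [hneg]
  linarith [hle (b - x) (by linarith [hx.2]) (by linarith [hx.1]),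
    hle (x - a) (by linarith [hx.1]) (by linarith [hx.2])]

/-- For x in the right half of the interval the lags x - y cover [0, (b-a)/2]. -/
lemma le_setIntegral_even_lag {w : ℝ → ℝ} (hw0 : ∀ s, 0 ≤ w s)
    (hwi : ∀ u v, IntervalIntegrable w volume u v) {a b x : ℝ} (hx : (a + b) / 2 ≤ x) (hxb : x ≤ b)
    (hab : a ≤ b) :
    ∫ s in (0)..((b - a) / 2), w s ≤ ∫ y in Set.Ioc a b, w (x - y) := by
  rw [← intervalIntegral.integral_of_le hab, intervalIntegral.integral_comp_sub_left,
    ← intervalIntegral.integral_add_adjacent_intervals (hwi (x - b) 0) (hwi 0 (x - a)),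
    ← intervalIntegral.integral_add_adjacent_intervals (hwi 0 ((b - a) / 2)) (hwi _ (x - a))]
  linarith [intervalIntegral.integral_nonneg (μ := volume) (show x - b ≤ 0 by linarith) fun s _ => hw0 s,
    intervalIntegral.integral_nonneg (μ := volume) (show (b - a) / 2 ≤ x - a by linarith)
      fun s _ => hw0 s]

/-- The law of a functional of a Gaussian field does not depend on the version of the integrand. -/
lemma IsStdGaussianField.ae_setIntegral_congr {T Ω : Type*} [MeasurableSpace T] [MeasurableSpace Ω]
    {P : Measure Ω} [IsProbabilityMeasure P] {Y : T → Ω → ℝ} (hY : IsStdGaussianField Y P)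
    (μ : Measure T) [IsFiniteMeasure μ] {f g : ℝ → ℝ} (hfg : f =ᵐ[gaussianReal 0 1] g) :
    ∀ᵐ ω ∂P, ∫ x, f (Y x ω) ∂μ = ∫ x, g (Y x ω) ∂μ := by
  have h1 : ∀ᵐ u ∂((μ.prod P).map fun p : T × Ω => Y p.1 p.2), f u = g u := by
    rw [hY.map_prod]
    exact Measure.smul_absolutelyContinuous.ae_le hfg
  have h2 : ∀ᵐ p ∂(μ.prod P), f (Y p.1 p.2) = g (Y p.1 p.2) :=
    ae_of_ae_map hY.measurable.aemeasurable h1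
  have h3 : ∀ᵐ p ∂(P.prod μ), f (Y p.2 p.1) = g (Y p.2 p.1) :=
    (Measure.measurePreserving_swap (μ := P) (ν := μ)).quasiMeasurePreserving.ae h2
  filter_upwards [Measure.ae_ae_of_ae_prod h3] with ω hω
  exact integral_congr_ae hω

/-- Standardized functionals of a Gaussian field. -/
lemma IsStdGaussianField.ae_standardized_eq {T Ω : Type*} [MeasurableSpace T] [MeasurableSpace Ω]
    {P : Measure Ω} [IsProbabilityMeasure P] {Y : T → Ω → ℝ} (hY : IsStdGaussianField Y P)
    (μ : Measure T) [IsFiniteMeasure μ] {f g : ℝ → ℝ} (hf : MemLp f 2 (gaussianReal 0 1))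
    (hfg : f =ᵐ[gaussianReal 0 1] g) {I : Ω → ℝ} (hI : ∀ ω, I ω = ∫ x, f (Y x ω) ∂μ) :
    (fun ω => (I ω - μ.real Set.univ * ∫ u, f u ∂(gaussianReal 0 1)) / √(Var[I; P])) =ᵐ[P]
      fun ω => (∫ x, (g (Y x ω) - hermiteCoeff g 0) ∂μ) /
        √(∫ ω, (∫ x, (g (Y x ω) - hermiteCoeff g 0) ∂μ) ^ 2 ∂P) := by
  have hg : MemLp g 2 (gaussianReal 0 1) := hf.ae_eq hfg
  have hgY := hY.memLp_prod μ hg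
  have hgi : Integrable (fun z : T × Ω => g (Y z.1 z.2)) (μ.prod P) := hgY.integrable (by norm_num)
  have h0 : hermiteCoeff g 0 = ∫ u, f u ∂(gaussianReal 0 1) := by
    rw [hermiteCoeff_zero]; exact (integral_congr_ae hfg).symm
  have hII : I =ᵐ[P] fun ω => ∫ x, g (Y x ω) ∂μ := by
    filter_upwards [hY.ae_setIntegral_congr μ hfg] with ω hω
    rw [hI, hω]
  have hcent : (fun ω => I ω - μ.real Set.univ * ∫ u, f u ∂(gaussianReal 0 1)) =ᵐ[P]
      fun ω => ∫ x, (g (Y x ω) - hermiteCoeff g 0) ∂μ := by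
    filter_upwards [hII, hgi.prod_left_ae] with ω h1 h2
    rw [integral_sub h2 (integrable_const _), h1, h0, integral_const, smul_eq_mul]
  have hmeanI : ∫ ω, I ω ∂P = μ.real Set.univ * ∫ u, f u ∂(gaussianReal 0 1) := by
    rw [integral_congr_ae hII, ← integral_prod_symm _ hgi, integral_prod _ hgi]
    have : ∀ x, ∫ ω, g (Y x ω) ∂P = ∫ u, f u ∂(gaussianReal 0 1) := fun x => by
      rw [hY.integral_comp x hg.1, ← h0, hermiteCoeff_zero]
    simp [this]
  have hIm : AEMeasurable I P :=
    (memLp_two_integral hgY).1.aemeasurable.congr hII.symm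
  have hvar : Var[I; P] = ∫ ω, (∫ x, (g (Y x ω) - hermiteCoeff g 0) ∂μ) ^ 2 ∂P := by
    rw [variance_eq_integral hIm, hmeanI]
    refine integral_congr_ae ?_
    filter_upwards [hcent] with ω hω
    rw [← hω]
  filter_upwards [hcent] with ω hω
  rw [hω, hvar]

/-! ### Convergence in law and the assembly of the theorem. -/

/-- Lévy's continuity theorem for convergence in law along a countably generated filter. -/
lemma tendstoInDistribution_of_tendsto_charFun {ι Ω : Type*} [MeasurableSpace Ω] {P : Measure Ω}
    [IsProbabilityMeasure P] {l : Filter ι} [l.IsCountablyGenerated] {X : ι → Ω → ℝ}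
    (hX : ∀ i, AEMeasurable (X i) P)
    (h : ∀ t : ℝ, Tendsto (fun i => ∫ ω, Complex.exp (((t * X i ω : ℝ) : ℂ) * Complex.I) ∂P) l
      (𝓝 (Complex.exp ((-(t ^ 2 / 2) : ℝ) : ℂ)))) :
    TendstoInDistribution X l (id : ℝ → ℝ) (fun _ => P) (gaussianReal 0 1) where
  forall_aemeasurable := hX
  tendsto := by
    refine tendsto_of_seq_tendsto fun u hu => ?_
    refine ProbabilityMeasure.tendsto_iff_tendsto_charFun.2 fun t => ?_
    have e1 : charFun ((gaussianReal 0 1).map (id : ℝ → ℝ)) t =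
        Complex.exp ((-(t ^ 2 / 2) : ℝ) : ℂ) := by
      rw [Measure.map_id, charFun_gaussianReal]
      congr 1; push_cast; simp
    have e2 : ∀ i, charFun (P.map (X i)) t =
        ∫ ω, Complex.exp (((t * X i ω : ℝ) : ℂ) * Complex.I) ∂P := fun i => by
      rw [charFun_apply_real, integral_map (hX i) (by fun_prop)]
      simp
    change Tendsto (fun n => charFun (P.map (X (u n))) t) atTop
      (𝓝 (charFun ((gaussianReal 0 1).map (id : ℝ → ℝ)) t))
    rw [e1]
    simp only [e2]
    exact (h t).comp hu

/-- A central limit theorem for functionals of Gaussian fields whose covariance kernels contract. -/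
lemma tendsto_integral_cexp_of_contraction {ι T Ω : Type*} [MeasurableSpace T] [MeasurableSpace Ω]
    (P : Measure Ω) [IsProbabilityMeasure P] (μ : Measure T) [IsFiniteMeasure μ] {f : ℝ → ℝ}
    (hfm : Measurable f) (hf : MemLp f 2 (gaussianReal 0 1)) {K : ℕ} (hK : 1 ≤ K) (hKe : Even K)
    (hKf : hermiteCoeff f K ≠ 0) (hK0 : ∀ k, 1 ≤ k → k < K → hermiteCoeff f k = 0)
    {l : Filter ι} {Y : ι → T → Ω → ℝ} {M M' ε : ι → ℝ} (hε : Tendsto ε l (𝓝 0))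
    (hY : ∀ᶠ i in l, IsStdGaussianField (Y i) P ∧ 0 ≤ M i ∧ 0 ≤ M' i ∧
      (∀ x, ∫ y, |covKernel (Y i) P x y| ∂μ ≤ M i) ∧
      (∀ x, ∫ y, |covKernel (Y i) P x y| ^ (K - 1) ∂μ ≤ M' i) ∧
      0 < ∫ q, |covKernel (Y i) P q.1 q.2| ^ K ∂(μ.prod μ) ∧
      M i * M' i ≤ ε i * ∫ q, |covKernel (Y i) P q.1 q.2| ^ K ∂(μ.prod μ)) (t : ℝ) :
    Tendsto (fun i => ∫ ω, Complex.exp (((t * ((∫ x, (f (Y i x ω) - hermiteCoeff f 0) ∂μ) /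
          √(∫ ω, (∫ x, (f (Y i x ω) - hermiteCoeff f 0) ∂μ) ^ 2 ∂P)) : ℝ) : ℂ) * Complex.I) ∂P) l
      (𝓝 (Complex.exp ((-(t ^ 2 / 2) : ℝ) : ℂ))) := by
  rw [Metric.tendsto_nhds]
  intro δ hδ
  set c := √(hermiteCoeff f K ^ 2 * K.factorial) with hcdef
  have hpos : 0 < hermiteCoeff f K ^ 2 * K.factorial :=
    mul_pos (by positivity) (Nat.cast_pos.2 K.factorial_pos)
  have hc : 0 < c := Real.sqrt_pos.2 hpos
  have hcK : c ^ 2 = hermiteCoeff f K ^ 2 * K.factorial := Real.sq_sqrt hpos.le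
  have hr : Tendsto (fun n => 2 * |t| * √(∫ u, hermiteRemainder f (n + 1) u ^ 2 ∂(gaussianReal 0 1)) / c)
      atTop (𝓝 0) := by
    have h1 := ((tendsto_integral_sq_hermiteRemainder hf).comp (tendsto_add_atTop_nat 1)).sqrt
    simpa using (h1.const_mul (2 * |t|)).div_const c
  -- The truncation error is uniform in `i`, so the degree is fixed first; only then is the constant
  -- `C`, which depends on it, beaten by `ε i`.
  obtain ⟨n, hn, hnK⟩ := ((hr.eventually_lt_const (half_pos hδ)).and (eventually_ge_atTop K)).exists
  obtain ⟨C, hC, hb⟩ := exists_norm_integral_cexp_sub_le (T := T) P μ hfm hf hK hKe hK0 hnK hc hcK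
  have hlim : Tendsto (fun i => t ^ 2 * √(C * ε i) / c ^ 2) l (𝓝 0) := by
    have := ((hε.const_mul C).sqrt.const_mul (t ^ 2)).div_const (c ^ 2)
    simpa using this
  filter_upwards [hY, hlim.eventually_lt_const (half_pos hδ)] with i hi hlt
  obtain ⟨h1, h2, h3, h4, h5, h6, h7⟩ := hi
  rw [dist_eq_norm]
  have := hb (Y i) h1 (M i) (M' i) (ε i) h2 h3 h4 h5 h6 h7 t
  linarith

/-- The contraction estimate for concave and power variance functions. -/
lemma exists_tendsto_integral_incrementCorr_mul_le {φ : ℝ → ℝ} (hφm : Measurable φ)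
    (heven : ∀ s, φ (-s) = φ s) (h0 : ∀ s, 0 ≤ φ s) (hpos : ∀ h, 0 < h → 0 < φ h)
    (hφ : ConcaveOn ℝ (Set.Ici 0) φ ∨ ∃ r : ℝ, 1 < r ∧ r ≤ 3 / 2 ∧ ∀ h, 0 ≤ h → φ h = h ^ r)
    (hb : ∀ h, 0 < h → ∀ s, |incrementCorr φ h s| ≤ 1) {L : ℝ} (hL : 0 < L) {K : ℕ} (hK : 2 ≤ K)
    (hKe : Even K) :
    ∃ ε : ℝ → ℝ, Tendsto ε (𝓝[>] 0) (𝓝 0) ∧ ∀ᶠ h in 𝓝[>] 0,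
      (∫ s in (0)..L, |incrementCorr φ h s|) * (∫ s in (0)..L, |incrementCorr φ h s| ^ (K - 1)) ≤
        ε h * ∫ s in (0)..(L / 2), |incrementCorr φ h s| ^ K := by
  rcases hφ with hφ | ⟨r, hr1, hr2, hφ⟩
  · refine ⟨fun h => 5 * (2 ^ (K - 1) + 3) / 2 * h, ?_, ?_⟩
    · refine Tendsto.mono_left ?_ nhdsWithin_le_nhds
      exact (continuous_const.mul continuous_id).tendsto' 0 0 (by simp)
    · filter_upwards [Ioo_mem_nhdsGT hL] with h hh
      exact hφ.integral_abs_incrementCorr_mul_le h0 hφm heven hh.1 (hpos h hh.1) (hb h hh.1)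
        hh.2.le hK
  · exact exists_tendsto_integral_incrementCorr_mul_le_of_rpow hφm heven hr1 hr2 hφ
      (hb 1 one_pos) hL hK hKe

/-- The contraction of the restriction of a stationary kernel to an interval. -/
lemma integral_abs_incrementCorr_mul_le_integral_prod {φ : ℝ → ℝ} (hφm : Measurable φ)
    {h : ℝ} (hb : ∀ s, |incrementCorr φ h s| ≤ 1) {a b : ℝ} (hab : a < b) (K : ℕ) :
    (b - a) / 2 * ∫ s in (0)..((b - a) / 2), |incrementCorr φ h s| ^ K ≤
      ∫ q, |incrementCorr φ h (q.1 - q.2)| ^ K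
        ∂((volume.restrict (Set.Ioc a b)).prod (volume.restrict (Set.Ioc a b))) := by
  set μ : Measure ℝ := volume.restrict (Set.Ioc a b) with hμ
  have hm : Measurable fun q : ℝ × ℝ => |incrementCorr φ h (q.1 - q.2)| ^ K :=
    (((hφm.incrementCorr h).comp (measurable_fst.sub measurable_snd)).abs.pow_const K)
  have hi : Integrable (fun q : ℝ × ℝ => |incrementCorr φ h (q.1 - q.2)| ^ K) (μ.prod μ) :=
    Integrable.of_bound hm.aestronglyMeasurable 1 (.of_forall fun q => by
      rw [Real.norm_of_nonneg (by positivity)]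
      exact pow_le_one₀ (abs_nonneg _) (hb _))
  have hw := intervalIntegrable_abs_incrementCorr_pow hφm hb K
  set J := ∫ s in (0)..((b - a) / 2), |incrementCorr φ h s| ^ K
  rw [integral_prod _ hi]
  have hsub : Set.Ioc ((a + b) / 2) b ⊆ Set.Ioc a b := Set.Ioc_subset_Ioc_left (by linarith)
  have hvol : (b - a) / 2 * J = ∫ _ in Set.Ioc ((a + b) / 2) b, J := by
    rw [setIntegral_const, Real.volume_real_Ioc_of_le (by linarith), smul_eq_mul]; ring
  calc (b - a) / 2 * J = ∫ _ in Set.Ioc ((a + b) / 2) b, J := hvol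
    _ ≤ ∫ x in Set.Ioc ((a + b) / 2) b, ∫ y, |incrementCorr φ h (x - y)| ^ K ∂μ := by
        refine setIntegral_mono_on (integrable_const _)
          (IntegrableOn.mono_set hi.integral_prod_left hsub) measurableSet_Ioc fun x hx => ?_
        exact le_setIntegral_even_lag (w := fun s => |incrementCorr φ h s| ^ K)
          (fun _ => by positivity) hw hx.1.le hx.2 hab.le
    _ ≤ _ := by
        refine setIntegral_mono_set hi.integral_prod_left
          (.of_forall fun x => integral_nonneg fun _ => by positivity) hsub.eventuallyLE

theorem theorem1p1 {Ω : Type*} [MeasurableSpace Ω] (P : Measure Ω) [IsProbabilityMeasure P]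
    -- a centred Gaussian process on the line, jointly measurable in time and chance
    (G : ℝ → Ω → ℝ) (hG : IsGaussianProcess G P) (hmean : ∀ x, ∫ ω, G x ω ∂P = 0)
    (hmeas : Measurable (fun p : ℝ × Ω => G p.1 p.2))
    -- with stationary increments, whose variance function is not identically zero
    (sigmaSq : ℝ → ℝ) (hincr : ∀ x y, ∫ ω, (G x ω - G y ω) ^ 2 ∂P = sigmaSq (x - y))
    (hne : ∃ h, sigmaSq h ≠ 0)
    (hsigma : ConcaveOn ℝ (Set.Ici 0) sigmaSq ∨
      ∃ r : ℝ, 1 < r ∧ r ≤ 3 / 2 ∧ ∀ h, 0 ≤ h → sigmaSq h = h ^ r)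
    (a b : ℝ) (hab : a < b)
    -- a symmetric square integrable function, not almost everywhere constant
    (f : ℝ → ℝ) (hfsymm : ∀ x, f (-x) = f x) (hf : MemLp f 2 (gaussianReal 0 1))
    (hfconst : ¬ ∃ c : ℝ, f =ᵐ[gaussianReal 0 1] fun _ => c) :
    TendstoInDistribution
      (fun (h : ℝ) (ω : Ω) =>
        (incrementFunctional G sigmaSq f a b h ω - (b - a) * ∫ x, f x ∂(gaussianReal 0 1)) /
          √(variance (incrementFunctional G sigmaSq f a b h) P))
      (𝓝[>] (0 : ℝ)) (id : ℝ → ℝ) (fun _ => P) (gaussianReal 0 1) := by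
  have heven : ∀ s, sigmaSq (-s) = sigmaSq s := fun s => by
    have h1 := hincr 0 s
    have h2 := hincr s 0
    rw [zero_sub] at h1
    rw [sub_zero] at h2
    rw [← h1, ← h2]
    congr 1; ext ω; ring
  have hzero : sigmaSq 0 = 0 := by
    have := hincr 0 0
    simpa using this.symm
  have h0 : ∀ s, 0 ≤ sigmaSq s := fun s => by
    rw [← sub_zero s, ← hincr]; exact integral_nonneg fun _ => sq_nonneg _
  have hφm : Measurable sigmaSq := measurable_of_integral_sq_increment hmeas hincr
  have hpos : ∀ h, 0 < h → 0 < sigmaSq h := by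
    intro h hh
    rcases hsigma with hc | ⟨r, _, _, hr⟩
    · refine hc.pos_of_exists_ne_zero h0 hzero ?_ hh
      obtain ⟨x, hx⟩ := hne
      rcases lt_trichotomy x 0 with hx0 | rfl | hx0
      · exact ⟨-x, by linarith, by rwa [heven]⟩
      · exact absurd hzero hx
      · exact ⟨x, hx0, hx⟩
    · rw [hr h hh.le]; positivity
  have hpos' : ∀ h, h ≠ 0 → 0 < sigmaSq h := fun h hh => by
    rcases lt_or_gt_of_ne hh with hlt | hgt
    · rw [← heven]; exact hpos _ (by linarith)
    · exact hpos h hgt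
  have hfield : ∀ h, h ≠ 0 → IsStdGaussianField (fun x ω => (G (x + h) ω - G x ω) / √(sigmaSq h)) P :=
    fun h hh => isStdGaussianField_increment hG hmean hmeas hincr (hpos' h hh)
  have hcov : ∀ h, h ≠ 0 → ∀ x y, covKernel (fun x ω => (G (x + h) ω - G x ω) / √(sigmaSq h)) P x y =
      incrementCorr sigmaSq h (x - y) := fun h hh => covKernel_increment hG hincr (hpos' h hh)
  have hb : ∀ h, 0 < h → ∀ s, |incrementCorr sigmaSq h s| ≤ 1 := fun h hh s => by
    have := (hfield h hh.ne').abs_covKernel_le_one s 0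
    rwa [hcov h hh.ne', sub_zero] at this
  -- the field of increments, frozen outside the interval of integration
  let cl : ℝ → ℝ := fun x => max a (min b x)
  have hclm : Measurable cl := by fun_prop
  have hclI : ∀ x, cl x ∈ Set.Icc a b := fun x =>
    ⟨le_max_left _ _, max_le hab.le (min_le_left _ _)⟩
  have hcl : ∀ x ∈ Set.Ioc a b, cl x = x := fun x hx => by
    simp only [cl]
    rw [min_eq_right hx.2, max_eq_right hx.1.le]
  let Y : ℝ → ℝ → Ω → ℝ := fun h x ω => (G (cl x + h) ω - G (cl x) ω) / √(sigmaSq h)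
  have hY : ∀ h, h ≠ 0 → IsStdGaussianField (Y h) P := fun h hh => (hfield h hh).comp hclm
  have hYcov : ∀ h, h ≠ 0 → ∀ x y, covKernel (Y h) P x y = incrementCorr sigmaSq h (cl x - cl y) :=
    fun h hh x y => hcov h hh (cl x) (cl y)
  set μ : Measure ℝ := volume.restrict (Set.Ioc a b) with hμ
  have hμreal : μ.real Set.univ = b - a := by
    rw [hμ, measureReal_restrict_apply_univ, Real.volume_real_Ioc_of_le hab.le]
  have hμ0 : μ ≠ 0 := fun h => by
    rw [h] at hμreal
    simp at hμreal
    linarith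
  have hμcl : ∀ᵐ x ∂μ, cl x = x := (ae_restrict_iff' measurableSet_Ioc).2 (.of_forall hcl)
  have hI : ∀ h ω, incrementFunctional G sigmaSq f a b h ω = ∫ x, f (Y h x ω) ∂μ := by
    intro h ω
    rw [incrementFunctional, intervalIntegral.integral_of_le hab.le]
    refine integral_congr_ae ?_
    filter_upwards [hμcl] with x hx
    simp only [Y, hx]
  -- A measurable version, needed for Fubini. It need not be even, so the rank is found for `f` and
  -- transferred through equality of the coefficients.
  obtain ⟨g, hgm, hfg⟩ := hf.aestronglyMeasurable
  have hgm' : Measurable g := hgm.measurable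
  have hg : MemLp g 2 (gaussianReal 0 1) := hf.ae_eq hfg
  obtain ⟨K, hK, hKe, hKf, hK0⟩ := exists_hermiteRank hf hfsymm hfconst
  rw [hermiteCoeff_congr hfg] at hKf
  simp only [hermiteCoeff_congr hfg] at hK0
  have hstd : ∀ h, h ≠ 0 → (fun ω => (incrementFunctional G sigmaSq f a b h ω -
      (b - a) * ∫ x, f x ∂(gaussianReal 0 1)) / √(variance (incrementFunctional G sigmaSq f a b h) P))
      =ᵐ[P] fun ω => (∫ x, (g (Y h x ω) - hermiteCoeff g 0) ∂μ) /
        √(∫ ω, (∫ x, (g (Y h x ω) - hermiteCoeff g 0) ∂μ) ^ 2 ∂P) := fun h hh => by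
    rw [← hμreal]
    exact (hY h hh).ae_standardized_eq μ hf hfg (hI h)
  refine tendstoInDistribution_of_tendsto_charFun (fun h => ?_) fun t => ?_
  -- Measurability is demanded for every real h, not only for small positive ones. At h = 0 the
  -- quotient by σ(0) = 0 is 0 by convention, so the functional is deterministic.
  · rcases eq_or_ne h 0 with rfl | hh
    · simp only [hI, Y, hzero, Real.sqrt_zero, div_zero]
      fun_prop
    · refine AEMeasurable.congr ?_ (hstd h hh).symm
      refine AEMeasurable.div_const ?_ _
      exact (memLp_two_integral ((hY h hh).memLp_prod μ (f := fun u => g u - hermiteCoeff g 0)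
        (hg.sub (memLp_const _)))).1.aemeasurable
  obtain ⟨ε, hε, hεb⟩ := exists_tendsto_integral_incrementCorr_mul_le hφm heven h0 hpos hsigma hb
    (sub_pos.2 hab) hK hKe
  have hmain := tendsto_integral_cexp_of_contraction P μ hgm' hg (by omega : 1 ≤ K) hKe hKf hK0
    (l := 𝓝[>] (0 : ℝ)) (Y := Y)
    (M := fun h => 2 * ∫ s in (0)..(b - a), |incrementCorr sigmaSq h s|)
    (M' := fun h => 2 * ∫ s in (0)..(b - a), |incrementCorr sigmaSq h s| ^ (K - 1))
    -- The factor is 4, from the two-sided lags in `M` and `M'`, divided by (b-a)/2, the length of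
    -- the half interval behind the lower bound of the double integral. The absolute value is there
    -- because the sign of `ε` is not known.
    (ε := fun h => 8 / (b - a) * |ε h|) (by simpa using hε.abs.const_mul (8 / (b - a))) ?_ t
  · refine hmain.congr' ?_
    filter_upwards [self_mem_nhdsWithin] with h hh
    refine integral_congr_ae ?_
    filter_upwards [hstd h (ne_of_gt hh)] with ω hω
    rw [← hω]
  · filter_upwards [hεb, self_mem_nhdsWithin] with h hle hh
    have hh0 : (0 : ℝ) < h := hh
    have hwi := fun j => intervalIntegrable_abs_incrementCorr_pow hφm (hb h hh0) j
    have hwe : ∀ s, incrementCorr sigmaSq h (-s) = incrementCorr sigmaSq h s := fun s => by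
      rw [incrementCorr, incrementCorr, heven s, show -s + h = -(s - h) by ring,
        show -s - h = -(s + h) by ring, heven, heven]
      ring
    -- Required for every real x, not only in the interval; this is what clamping provides, since
    -- `cl x` always lies in [a, b].
    have hbd : ∀ (j : ℕ) x, ∫ y, |covKernel (Y h) P x y| ^ j ∂μ ≤
        2 * ∫ s in (0)..(b - a), |incrementCorr sigmaSq h s| ^ j := by
      intro j x
      refine Eq.trans_le (integral_congr_ae ?_) (setIntegral_even_lag_le
        (w := fun s => |incrementCorr sigmaSq h s| ^ j) (fun _ => by positivity)
        (fun s => by rw [hwe]) (hwi j) (hclI x))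
      filter_upwards [hμcl] with y hy
      rw [hYcov h hh0.ne', hy]
    have hn : ∀ j : ℕ, 0 ≤ ∫ s in (0)..(b - a), |incrementCorr sigmaSq h s| ^ j := fun j =>
      intervalIntegral.integral_nonneg (by linarith) fun _ _ => by positivity
    have hT : (b - a) / 2 * ∫ s in (0)..((b - a) / 2), |incrementCorr sigmaSq h s| ^ K ≤
        ∫ q, |covKernel (Y h) P q.1 q.2| ^ K ∂(μ.prod μ) := by
      refine (integral_abs_incrementCorr_mul_le_integral_prod hφm (hb h hh0) hab K).trans_eq
        (integral_congr_ae ?_)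
      have hμ2 : ∀ᵐ q ∂(μ.prod μ), cl q.1 = q.1 ∧ cl q.2 = q.2 :=
        (Measure.quasiMeasurePreserving_fst.ae hμcl).and (Measure.quasiMeasurePreserving_snd.ae hμcl)
      filter_upwards [hμ2] with q hq
      rw [hYcov h hh0.ne', hq.1, hq.2]
    refine ⟨hY h hh0.ne', ?_, ?_, fun x => by simpa using hbd 1 x, hbd (K - 1),
      (hY h hh0.ne').integral_abs_covKernel_pow_pos μ hμ0 K, ?_⟩
    · have := hn 1
      simp only [pow_one] at this
      linarith
    · linarith [hn (K - 1)]
    · have hJ : 0 ≤ ∫ s in (0)..((b - a) / 2), |incrementCorr sigmaSq h s| ^ K :=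
        intervalIntegral.integral_nonneg (by linarith) fun _ _ => by positivity
      have hL : 0 < b - a := by linarith
      calc _ = 4 * ((∫ s in (0)..(b - a), |incrementCorr sigmaSq h s|) *
            ∫ s in (0)..(b - a), |incrementCorr sigmaSq h s| ^ (K - 1)) := by ring
        _ ≤ 4 * (|ε h| * ∫ s in (0)..((b - a) / 2), |incrementCorr sigmaSq h s| ^ K) := by
            refine mul_le_mul_of_nonneg_left (hle.trans ?_) (by norm_num)
            exact mul_le_mul_of_nonneg_right (le_abs_self _) hJ
        _ = 8 / (b - a) * |ε h| *
            ((b - a) / 2 * ∫ s in (0)..((b - a) / 2), |incrementCorr sigmaSq h s| ^ K) := by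
            field_simp; ring
        _ ≤ _ := mul_le_mul_of_nonneg_left hT (by positivity)
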